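/- **Setting.** Let $n\ge 2$, $N\ge 1$, let $\Omega\subset\mathbb R^n$ be open and bounded, $0<T<\infty$, $p\in(1,\infty)$, $q\in(0,\infty)$, $\nu>0$, and $\Omega_\tau:=\Omega\times[0,\tau)$. Let $E\subset\Omega_T$ be relatively open with time slices $E^t:=\{x:(x,t)\in E\}$. Let $f:\Omega\times\mathbb R^N\times\mathbb R^{Nn}\to[0,\infty)$ be such that $x\mapsto f(x,u,\xi)\in L^1(\Omega)$ for all $(u,\xi)$, $(u,\xi)\mapsto f(x,u,\xi)$ is convex for a.e. $x\in\Omega$, and $\nu|\xi|^p\le f(x,u,\xi)$ for a.e. $x\in\Omega$ and all $(u,\xi)$. Let $u_o\in L^{q+1}(\Omega,\mathbb R^N)$ and $u_*\in L^{q+1}(\Omega,\mathbb R^N)\cap W^{1,p}(\Omega,\mathbb R^N)$ satisfy $\int_\Omega f(x,u_*+\phi,D(u_*+\phi))\,dx<\infty$ for all $\phi\in C_0^\infty(\Omega,\mathbb R^N)$. Write $\boldsymbol u^q:=|u|^{q-1}u$ and $$\mathfrak b[u,v]:=\tfrac1{q+1}|v|^{q+1}-\tfrac1{q+1}|u|^{q+1}-\boldsymbol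 u^q\cdot(v-u)\qquad (u,v\in\mathbb R^N).$$ Let $W^{1,p}_{u_*}(\Omega,\mathbb R^N):=u_*+W^{1,p}_0(\Omega,\mathbb R^N)$, and let $V^p_q(E)$ be the set of all $v\in L^p(0,T;W^{1,p}_{u_*}(\Omega,\mathbb R^N))\cap L^{q+1}(\Omega_T,\mathbb R^N)$ such that, for a.e. $t\in[0,T)$, $v(t)=u_*$ a.e. in $\Omega\setminus E^t$. A map $u\in L^\infty(0,T;L^{q+1}(\Omega,\mathbb R^N))\cap V^p_q(E)$ is called a *variational solution* if for every comparison map $v\in V^p_q(E)$ with weak time derivative $\partial_t v\in L^{q+1}(\Omega_T,\mathbb R^N)$ (taken in its representative in $C^0([0,T);L^{q+1}(\Omega,\mathbb R^N))$) the inequality $$\begin{aligned}\iint_{E\cap\Omega_\tau}f(x,u,Du)\,dx\,dt\le{}&\iint_{E\cap\Omega_\tau}f(x,v,Dv)\,dx\,dt+\iint_{E\cap\Omega_\tau}\partial_tv\cdot(\boldsymbol v^q-\boldsymbol u^q)\,dx\,dt\\&-\int_{E^\tau}\mathfrak b[u(\tau),v(\tau)]\,dx+\int_{E^0}\mathfrak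 b[u_o,v(0)]\,dx\end{aligned}$$ holds for a.e. $\tau\in(0,T)$, where the energies of $u$ and $v$ may take the value $+\infty$. **Proposition.** In the above setting assume in addition that $\mathcal L^{n+1}(\partial E)=0$ and that $E$ is nondecreasing, i.e. $E^s\subset E^t$ for all $0\le s\le t<T$. Then every variational solution $u$ satisfies $u\in C^0([0,T];L^{q+1}(\Omega,\mathbb R^N))$; that is, there is a continuous map $w:[0,T]\to L^{q+1}(\Omega,\mathbb R^N)$ such that $w(t)=u(t)$ a.e. in $\Omega$ for a.e. $t\in(0,T)$. -/

import Mathlib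

open MeasureTheory Set Filter Topology
open scoped NNReal ENNReal ContDiff

namespace DoublyNonlinear

noncomputable section

/-- The Euclidean space `ℝᵏ`. -/
abbrev Vec (k : ℕ) : Type := EuclideanSpace ℝ (Fin k)

/-- The space `ℝ^{Nn}` of `N × n` matrices with the Euclidean (Frobenius) norm; the entry `(i, j)`
of a gradient is `∂_j u^i`. -/
abbrev Mat (N n : ℕ) : Type := EuclideanSpace ℝ (Fin N × Fin n)

/-- The space-time cylinder `Ω_τ = Ω × [0, τ)`. -/
def cylinder {n : ℕ} (Ω : Set (Vec n)) (τ : ℝ) : Set (Vec n × ℝ) := Ω ×ˢ Ico 0 τ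

/-- The time slice `E^t = {x | (x, t) ∈ E}`. -/
def timeSlice {n : ℕ} (E : Set (Vec n × ℝ)) (t : ℝ) : Set (Vec n) := {x | (x, t) ∈ E}

/-- The function `u(t) = u(·, t)` of the space variable. -/
def slice {n : ℕ} {F : Type*} (u : Vec n × ℝ → F) (t : ℝ) : Vec n → F := fun x => u (x, t)

/-- `E` is relatively open in `Ω_T = Ω × [0, T)` (in particular `E ⊆ Ω_T`). -/
def IsRelativelyOpen {n : ℕ} (Ω : Set (Vec n)) (T : ℝ) (E : Set (Vec n × ℝ)) : Prop :=
  ∃ O : Set (Vec n × ℝ), IsOpen O ∧ E = O ∩ cylinder Ω T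

/-- The time slices of `E` are nondecreasing: `E^s ⊆ E^t` for `0 ≤ s ≤ t < T`. -/
def IsNondecreasing {n : ℕ} (T : ℝ) (E : Set (Vec n × ℝ)) : Prop :=
  ∀ s t : ℝ, 0 ≤ s → s ≤ t → t < T → timeSlice E s ⊆ timeSlice E t

/-- The signed power `|u|^{q-1} u` of a vector. -/
def spow {N : ℕ} (q : ℝ) (u : Vec N) : Vec N := ‖u‖ ^ (q - 1) • u

/-- The boundary term `b[u, v]`. -/
def bTerm {N : ℕ} (q : ℝ) (u v : Vec N) : ℝ :=
  1 / (q + 1) * ‖v‖ ^ (q + 1) - 1 / (q + 1) * ‖u‖ ^ (q + 1) - inner ℝ (spow q u) (v - u)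

/-- `φ ∈ C₀^∞(U, F)`: smooth with compact support contained in `U`. -/
def IsTestFunction {G F : Type*} [NormedAddCommGroup G] [NormedSpace ℝ G]
    [NormedAddCommGroup F] [NormedSpace ℝ F] (U : Set G) (φ : G → F) : Prop :=
  ContDiff ℝ ∞ φ ∧ HasCompactSupport φ ∧ tsupport φ ⊆ U

/-- The classical gradient `(∂_j φ^i)_{i,j}` of a smooth map. -/
def classicalGrad {n N : ℕ} (φ : Vec n → Vec N) (x : Vec n) : Mat N n :=
  WithLp.toLp 2 fun ij => fderiv ℝ φ x (EuclideanSpace.single ij.2 1) ij.1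

/-- `w ∈ W^{1,p}(Ω, ℝ^N)` with weak gradient `Dw`. -/
structure MemW1p {n N : ℕ} (Ω : Set (Vec n)) (p : ℝ) (w : Vec n → Vec N)
    (Dw : Vec n → Mat N n) : Prop where
  memLp : MemLp w (ENNReal.ofReal p) (volume.restrict Ω)
  grad_memLp : MemLp Dw (ENNReal.ofReal p) (volume.restrict Ω)
  weak_grad : ∀ φ : Vec n → ℝ, IsTestFunction Ω φ → ∀ (i : Fin N) (j : Fin n),
    ∫ x in Ω, w x i * fderiv ℝ φ x (EuclideanSpace.single j 1) = -∫ x in Ω, Dw x (i, j) * φ x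

/-- `w ∈ W₀^{1,p}(Ω, ℝ^N)` with weak gradient `Dw`: the pair `(w, Dw)` lies in the closure of
`{(φ, Dφ) | φ ∈ C₀^∞(Ω, ℝ^N)}` in `L^p × L^p`. -/
structure MemW1pZero {n N : ℕ} (Ω : Set (Vec n)) (p : ℝ) (w : Vec n → Vec N)
    (Dw : Vec n → Mat N n) : Prop where
  memLp : MemLp w (ENNReal.ofReal p) (volume.restrict Ω)
  grad_memLp : MemLp Dw (ENNReal.ofReal p) (volume.restrict Ω)
  approx : ∀ ε : ℝ≥0∞, 0 < ε → ∃ φ : Vec n → Vec N, IsTestFunction Ω φ ∧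
    eLpNorm (w - φ) (ENNReal.ofReal p) (volume.restrict Ω) < ε ∧
    eLpNorm (Dw - classicalGrad φ) (ENNReal.ofReal p) (volume.restrict Ω) < ε

/-- The structure conditions on the integrand `f : Ω × ℝ^N × ℝ^{Nn} → [0, ∞)`: integrability in
`x`, convexity in `(u, ξ)`, and `p`-coercivity. -/
structure IsIntegrand {n N : ℕ} (Ω : Set (Vec n)) (p ν : ℝ)
    (f : Vec n → Vec N → Mat N n → ℝ≥0) : Prop where
  integrable : ∀ (u : Vec N) (ξ : Mat N n), IntegrableOn (fun x => (f x u ξ : ℝ)) Ω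
  convex : ∀ᵐ x ∂(volume.restrict Ω),
    ConvexOn ℝ univ (fun z : Vec N × Mat N n => (f x z.1 z.2 : ℝ))
  coercive : ∀ᵐ x ∂(volume.restrict Ω), ∀ (u : Vec N) (ξ : Mat N n), ν * ‖ξ‖ ^ p ≤ (f x u ξ : ℝ)

/-- The conditions on the initial datum `u_o` and on the lateral boundary datum `u_*`, whose weak
gradient is `Du_*`. -/
structure AreData {n N : ℕ} (Ω : Set (Vec n)) (p q : ℝ) (f : Vec n → Vec N → Mat N n → ℝ≥0)
    (uo ustar : Vec n → Vec N) (Dustar : Vec n → Mat N n) : Prop where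
  initial_memLp : MemLp uo (ENNReal.ofReal (q + 1)) (volume.restrict Ω)
  boundary_memLp : MemLp ustar (ENNReal.ofReal (q + 1)) (volume.restrict Ω)
  boundary_memW1p : MemW1p Ω p ustar Dustar
  finite_energy : ∀ φ : Vec n → Vec N, IsTestFunction Ω φ →
    ∫⁻ x in Ω, (f x (ustar x + φ x) (Dustar x + classicalGrad φ x) : ℝ≥0∞) < ⊤

/-- `v ∈ V_q^p(E)` with spatial weak gradient `Dv`. The Bochner space
`L^p(0, T; W^{1,p}_{u_*}(Ω, ℝ^N))` is described by (classes of) jointly measurable functions on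
`Ω_T`: `v` and `Dv` are in `L^p(Ω_T)`, and for a.e. `t` one has
`v(t) ∈ u_* + W₀^{1,p}(Ω, ℝ^N)` with gradient `Dv(t)`. -/
structure MemVpq {n N : ℕ} (Ω : Set (Vec n)) (T : ℝ) (E : Set (Vec n × ℝ)) (p q : ℝ)
    (ustar : Vec n → Vec N) (Dustar : Vec n → Mat N n)
    (v : Vec n × ℝ → Vec N) (Dv : Vec n × ℝ → Mat N n) : Prop where
  memLp : MemLp v (ENNReal.ofReal p) (volume.restrict (cylinder Ω T))
  grad_memLp : MemLp Dv (ENNReal.ofReal p) (volume.restrict (cylinder Ω T))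
  boundary : ∀ᵐ t ∂(volume.restrict (Ioo 0 T)),
    MemW1pZero Ω p (slice v t - ustar) (slice Dv t - Dustar)
  eq_outside : ∀ᵐ t ∂(volume.restrict (Ioo 0 T)),
    slice v t =ᵐ[volume.restrict (Ω \ timeSlice E t)] ustar
  memLq : MemLp v (ENNReal.ofReal (q + 1)) (volume.restrict (cylinder Ω T))

/-- `t ↦ v(·, t)` is a continuous map from `I` to `L^r(Ω, ℝ^N)`. -/
def ContinuousInLp {n N : ℕ} (Ω : Set (Vec n)) (r : ℝ) (I : Set ℝ)
    (v : Vec n × ℝ → Vec N) : Prop :=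
  (∀ t ∈ I, MemLp (slice v t) (ENNReal.ofReal r) (volume.restrict Ω)) ∧
  ∀ t ∈ I, Tendsto
    (fun s => eLpNorm (slice v s - slice v t) (ENNReal.ofReal r) (volume.restrict Ω))
    (𝓝[I] t) (𝓝 0)

/-- `v` has the weak (distributional) time derivative `dv` in `L^r(Ω_T, ℝ^N)`. -/
structure HasWeakTimeDeriv {n N : ℕ} (Ω : Set (Vec n)) (T r : ℝ)
    (v dv : Vec n × ℝ → Vec N) : Prop where
  memLp : MemLp dv (ENNReal.ofReal r) (volume.restrict (cylinder Ω T))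
  weak : ∀ φ : Vec n × ℝ → ℝ, IsTestFunction (Ω ×ˢ Ioo 0 T) φ →
    ∫ z in cylinder Ω T, fderiv ℝ φ z (0, 1) • v z = -∫ z in cylinder Ω T, φ z • dv z

/-- `v` is a comparison map: `v ∈ V_q^p(E)` with `∂_t v = dv ∈ L^{q+1}(Ω_T, ℝ^N)`. Every such map
has a representative in `C⁰([0, T); L^{q+1}(Ω, ℝ^N))`, and `v` is taken to be such a one, so that
`v(0)` is meaningful. -/
structure IsComparisonMap {n N : ℕ} (Ω : Set (Vec n)) (T : ℝ) (E : Set (Vec n × ℝ)) (p q : ℝ)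
    (ustar : Vec n → Vec N) (Dustar : Vec n → Mat N n)
    (v : Vec n × ℝ → Vec N) (Dv : Vec n × ℝ → Mat N n) (dv : Vec n × ℝ → Vec N) : Prop where
  memV : MemVpq Ω T E p q ustar Dustar v Dv
  time_deriv : HasWeakTimeDeriv Ω T (q + 1) v dv
  continuous : ContinuousInLp Ω (q + 1) (Ico 0 T) v

/-- The energy `∬_{E ∩ Ω_τ} f(x, v, Dv) dx dt ∈ [0, ∞]`. -/
def energy {n N : ℕ} (Ω : Set (Vec n)) (E : Set (Vec n × ℝ)) (f : Vec n → Vec N → Mat N n → ℝ≥0)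
    (τ : ℝ) (v : Vec n × ℝ → Vec N) (Dv : Vec n × ℝ → Mat N n) : ℝ≥0∞ :=
  ∫⁻ z in E ∩ cylinder Ω τ, (f z.1 (v z) (Dv z) : ℝ≥0∞)

/-- The variational inequality at the time `τ`, tested with `v`. Only the energies may be infinite,
the other three integrals are finite for a.e. `τ`. -/
def VariationalInequality {n N : ℕ} (Ω : Set (Vec n)) (E : Set (Vec n × ℝ)) (q : ℝ)
    (f : Vec n → Vec N → Mat N n → ℝ≥0) (uo : Vec n → Vec N)
    (u : Vec n × ℝ → Vec N) (Du : Vec n × ℝ → Mat N n)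
    (v : Vec n × ℝ → Vec N) (Dv : Vec n × ℝ → Mat N n) (dv : Vec n × ℝ → Vec N) (τ : ℝ) : Prop :=
  (energy Ω E f τ u Du : EReal) ≤ (energy Ω E f τ v Dv : EReal) +
    (((∫ z in E ∩ cylinder Ω τ, inner ℝ (dv z) (spow q (v z) - spow q (u z)))
      - (∫ x in timeSlice E τ, bTerm q (u (x, τ)) (v (x, τ)))
      + (∫ x in timeSlice E 0, bTerm q (uo x) (v (x, 0))) : ℝ) : EReal)

/-- `u` is a variational solution: `u ∈ L^∞(0, T; L^{q+1}(Ω, ℝ^N)) ∩ V_q^p(E)`, and for every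
comparison map the variational inequality holds for a.e. `τ ∈ (0, T)`. -/
def IsVariationalSolution {n N : ℕ} (Ω : Set (Vec n)) (T : ℝ) (E : Set (Vec n × ℝ)) (p q : ℝ)
    (f : Vec n → Vec N → Mat N n → ℝ≥0) (uo ustar : Vec n → Vec N) (Dustar : Vec n → Mat N n)
    (u : Vec n × ℝ → Vec N) : Prop :=
  (∃ C : ℝ≥0, ∀ᵐ t ∂(volume.restrict (Ioo 0 T)),
    eLpNorm (slice u t) (ENNReal.ofReal (q + 1)) (volume.restrict Ω) ≤ C) ∧
  ∃ Du : Vec n × ℝ → Mat N n, MemVpq Ω T E p q ustar Dustar u Du ∧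
    ∀ (v : Vec n × ℝ → Vec N) (Dv : Vec n × ℝ → Mat N n) (dv : Vec n × ℝ → Vec N),
      IsComparisonMap Ω T E p q ustar Dustar v Dv dv →
      ∀ᵐ τ ∂(volume.restrict (Ioo 0 T)), VariationalInequality Ω E q f uo u Du v Dv dv τ

end

end DoublyNonlinear

/-!
A variational solution `u` is shown to be, uniformly for almost all times, a limit in `L^{q+1}` of
curves that are continuous in time; completeness of `L^{q+1}` then provides the continuous
representative (`exists_continuousInLp_of_approx`).

The approximating curves are exponential time mollifications
`v(t) = e^{-λt} (a + λ ∫₀ᵗ e^{λs} u(s) ds)` with initial value `a = u_* + φ`, where `φ` is a test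
function on the slice `E^0`. Such a `v` is a comparison map (`isComparisonMap_mollify`): for each
`t` it is a mean of `a` and the earlier values of `u` with respect to a probability measure on
`[0, t]`, so it stays in the closed affine space `u_* + W₀^{1,p}`, and, as the slices of `E` are
nondecreasing, a point outside `E^t` only sees times at which `u = u_*`. Tested with `v`, the
variational inequality has the following terms.

* Since `∂ₜv = λ (u - v)` and `u ↦ |u|^{q-1} u` is monotone, the term with the time derivative is
  nonpositive.
* By Jensen's inequality for the means and Tonelli's theorem, the energy of `v` exceeds the energy
  of `u` by at most `λ⁻¹` times the energy of `a` (`energy_mollify_le`). This holds first on the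
  whole cylinder. It passes to `E` because outside `E` both maps and their gradients agree with
  `u_*` and `Du_*`; for the gradients this uses that `∂E` is a null set
  (`MemVpq.grad_ae_eq_outside`).

Hence `∫ b[u(τ), v(τ)] ≤ λ⁻¹ ∫ f(x, a, Da) + ∫ b[uₒ, a]` for almost every `τ`
(`ae_integral_bTerm_mollify_le`). The density of test functions in `L^{q+1}(E^0)` makes the last
integral small, and then a large `λ` makes the first one small. By coercivity of `b`
(`exists_norm_sub_rpow_le_bTerm`), which comes from strict positivity off the diagonal, homogeneity
and compactness, `‖u(τ) - v(τ)‖_{q+1}` is small uniformly in `τ`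
(`exists_continuousInLp_approx`).
-/

set_option linter.unusedSectionVars false

namespace DoublyNonlinear

noncomputable section

/-! ### Algebra of the boundary term `b` -/

section

variable {N : ℕ} {q : ℝ}

theorem norm_spow (hq : 0 < q) (u : Vec N) : ‖spow q u‖ = ‖u‖ ^ q := by
  rcases eq_or_ne u 0 with rfl | hu
  · simp [spow, Real.zero_rpow hq.ne']
  · rw [spow, norm_smul, Real.norm_of_nonneg (by positivity),
      ← Real.rpow_add_one (by simpa using hu)]
    congr 1; ring

theorem continuous_spow (hq : 0 < q) : Continuous (spow q : Vec N → Vec N) := by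
  rw [continuous_iff_continuousAt]
  intro u
  rcases eq_or_ne u 0 with rfl | hu
  · have h0 : spow q (0 : Vec N) = 0 := by simp [spow]
    rw [ContinuousAt, h0]
    apply squeeze_zero_norm (a := fun u : Vec N => ‖u‖ ^ q) (fun u => (norm_spow hq u).le)
    have : ContinuousAt (fun u : Vec N => ‖u‖ ^ q) 0 :=
      continuous_norm.continuousAt.rpow_const (Or.inr hq.le)
    simpa [ContinuousAt, Real.zero_rpow hq.ne'] using this
  · exact (continuous_norm.continuousAt.rpow_const (Or.inl (by simpa using hu))).smul
      continuousAt_id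

theorem spow_smul (hq : 0 < q) {r : ℝ} (hr : 0 ≤ r) (u : Vec N) :
    spow q (r • u) = r ^ q • spow q u := by
  rcases hr.eq_or_lt with rfl | hr
  · simp [spow, Real.zero_rpow hq.ne']
  · rw [spow, spow, norm_smul, Real.norm_of_nonneg hr.le, Real.mul_rpow hr.le (norm_nonneg _),
      smul_smul, smul_smul, Real.rpow_sub_one hr.ne']
    congr 1; field_simp

theorem inner_spow_self (hq : 0 < q) (u : Vec N) : inner ℝ (spow q u) u = ‖u‖ ^ (q + 1) := by
  rcases eq_or_ne u 0 with rfl | hu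
  · simp [Real.zero_rpow (by linarith : q + 1 ≠ 0)]
  · have : 0 < ‖u‖ := by simpa using hu
    rw [spow, inner_smul_left, real_inner_self_eq_norm_sq, Real.rpow_add_one this.ne',
      Real.rpow_sub_one this.ne']
    simp; field_simp

theorem bTerm_eq (hq : 0 < q) (u v : Vec N) :
    bTerm q u v = 1 / (q + 1) * ‖v‖ ^ (q + 1) + q / (q + 1) * ‖u‖ ^ (q + 1)
      - inner ℝ (spow q u) v := by
  rw [bTerm, inner_sub_right, inner_spow_self hq]
  field_simp; ring

theorem bTerm_self (u : Vec N) : bTerm q u u = 0 := by simp [bTerm]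

theorem continuous_bTerm (hq : 0 < q) : Continuous fun z : Vec N × Vec N => bTerm q z.1 z.2 := by
  unfold bTerm
  have h1 : Continuous fun z : Vec N × Vec N => ‖z.1‖ ^ (q + 1) :=
    continuous_fst.norm.rpow_const fun _ => Or.inr (by linarith)
  have h2 : Continuous fun z : Vec N × Vec N => ‖z.2‖ ^ (q + 1) :=
    continuous_snd.norm.rpow_const fun _ => Or.inr (by linarith)
  have h3 : Continuous fun z : Vec N × Vec N => spow q z.1 :=
    (continuous_spow (N := N) hq).comp continuous_fst
  exact ((continuous_const.mul h2).sub (continuous_const.mul h1)).sub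
    (h3.inner (continuous_snd.sub continuous_fst))

theorem bTerm_smul (hq : 0 < q) {r : ℝ} (hr : 0 ≤ r) (u v : Vec N) :
    bTerm q (r • u) (r • v) = r ^ (q + 1) * bTerm q u v := by
  rw [bTerm_eq hq, bTerm_eq hq, spow_smul hq hr, norm_smul, norm_smul, Real.norm_of_nonneg hr,
    Real.mul_rpow hr (norm_nonneg _), Real.mul_rpow hr (norm_nonneg _), inner_smul_left,
    inner_smul_right, Real.rpow_add_one' hr (by linarith)]
  simp; ring

/-- Strict form of Young's inequality; it is Bernoulli's inequality for `t / s`. -/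
theorem rpow_mul_lt_young (hq : 0 < q) {s t : ℝ} (hs : 0 ≤ s) (ht : 0 ≤ t) (hst : s ≠ t) :
    s ^ q * t < 1 / (q + 1) * t ^ (q + 1) + q / (q + 1) * s ^ (q + 1) := by
  rcases hs.eq_or_lt with rfl | hs
  · have : 0 < t := lt_of_le_of_ne ht hst
    rw [Real.zero_rpow hq.ne', Real.zero_rpow (by linarith : q + 1 ≠ 0)]
    have : 0 < 1 / (q + 1) * t ^ (q + 1) := by positivity
    simpa using this
  · have hB := one_add_mul_self_lt_rpow_one_add (s := t / s - 1) (p := q + 1)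
      (by have := div_nonneg ht hs.le; linarith) (by
        intro h; apply hst; field_simp at h; linarith) (by linarith)
    rw [add_sub_cancel, Real.div_rpow ht hs.le, lt_div_iff₀ (by positivity)] at hB
    rw [Real.rpow_add_one hs.ne'] at hB ⊢
    have h1 : (1 + (q + 1) * (t / s - 1)) * (s ^ q * s) =
        (q + 1) * (s ^ q * t) - q * (s ^ q * s) := by
      field_simp; ring
    rw [h1] at hB
    have h2 : s ^ q * t = 1 / (q + 1) * ((q + 1) * (s ^ q * t)) := by field_simp
    rw [h2]
    calc _ < 1 / (q + 1) * (t ^ (q + 1) + q * (s ^ q * s)) := by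
          apply mul_lt_mul_of_pos_left _ (by positivity); linarith
      _ = _ := by ring

theorem rpow_mul_le_young (hq : 0 < q) {s t : ℝ} (hs : 0 ≤ s) (ht : 0 ≤ t) :
    s ^ q * t ≤ 1 / (q + 1) * t ^ (q + 1) + q / (q + 1) * s ^ (q + 1) := by
  rcases eq_or_ne s t with rfl | h
  · rw [Real.rpow_add_one' hs (by linarith)]
    apply le_of_eq; field_simp; ring
  · exact (rpow_mul_lt_young hq hs ht h).le

theorem inner_spow_le (hq : 0 < q) (u v : Vec N) : inner ℝ (spow q u) v ≤ ‖u‖ ^ q * ‖v‖ := by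
  rw [← norm_spow hq]; exact real_inner_le_norm _ _

theorem bTerm_nonneg (hq : 0 < q) (u v : Vec N) : 0 ≤ bTerm q u v := by
  rw [bTerm_eq hq]
  linarith [inner_spow_le hq u v, rpow_mul_le_young hq (norm_nonneg u) (norm_nonneg v)]

/-- For `|u| ≠ |v|` Young's inequality is strict, and for `|u| = |v|`, `u ≠ v`, the Cauchy-Schwarz
inequality is. -/
theorem bTerm_pos (hq : 0 < q) {u v : Vec N} (h : u ≠ v) : 0 < bTerm q u v := by
  rw [bTerm_eq hq]
  rcases eq_or_ne ‖u‖ ‖v‖ with hn | hn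
  · have hu : u ≠ 0 := by
      rintro rfl; apply h; symm; simpa using hn.symm
    have hu' : 0 < ‖u‖ := by simpa using hu
    have h1 : inner ℝ u v < ‖u‖ * ‖v‖ := by
      apply lt_of_le_of_ne (real_inner_le_norm u v)
      intro he
      rw [inner_eq_norm_mul_iff_real, hn] at he
      rw [hn] at hu'
      exact h (smul_right_injective _ hu'.ne' he.symm).symm
    have h2 : inner ℝ (spow q u) v < ‖u‖ ^ q * ‖v‖ := by
      rw [spow, inner_smul_left, Real.rpow_sub_one hu'.ne']
      calc _ < ‖u‖ ^ q / ‖u‖ * (‖u‖ * ‖v‖) := by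
            simpa using mul_lt_mul_of_pos_left h1 (by positivity : 0 < ‖u‖ ^ q / ‖u‖)
        _ = _ := by field_simp
    linarith [rpow_mul_le_young hq (norm_nonneg u) (norm_nonneg v)]
  · linarith [inner_spow_le hq u v, rpow_mul_lt_young hq (norm_nonneg u) (norm_nonneg v) hn]

theorem bTerm_add_bTerm (u v : Vec N) :
    bTerm q u v + bTerm q v u = inner ℝ (v - u) (spow q v - spow q u) := by
  rw [bTerm, bTerm, real_inner_comm (v - u), real_inner_comm (u - v), inner_sub_right,
    ← neg_sub v u, inner_neg_left]
  ring

/-- The map `u ↦ |u|^{q-1} u` is monotone. -/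
theorem inner_sub_spow_sub_nonneg (hq : 0 < q) (u v : Vec N) :
    0 ≤ inner ℝ (v - u) (spow q v - spow q u) := by
  rw [← bTerm_add_bTerm]
  exact add_nonneg (bTerm_nonneg hq _ _) (bTerm_nonneg hq _ _)

theorem bTerm_le_max (hq : 0 < q) (u v : Vec N) :
    bTerm q u v ≤ 2 * (max ‖u‖ ‖v‖ ^ q * ‖v - u‖) := by
  have h1 : bTerm q u v ≤ inner ℝ (v - u) (spow q v - spow q u) := by
    rw [← bTerm_add_bTerm]; linarith [bTerm_nonneg hq v u]
  have h2 : ‖spow q v - spow q u‖ ≤ 2 * max ‖u‖ ‖v‖ ^ q := by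
    calc _ ≤ ‖v‖ ^ q + ‖u‖ ^ q := by
          simpa only [norm_spow hq] using norm_sub_le (spow q v) (spow q u)
      _ ≤ max ‖u‖ ‖v‖ ^ q + max ‖u‖ ‖v‖ ^ q := by
          gcongr
          · exact le_max_right _ _
          · exact le_max_left _ _
      _ = _ := by ring
  calc _ ≤ ‖v - u‖ * ‖spow q v - spow q u‖ := h1.trans (real_inner_le_norm _ _)
    _ ≤ ‖v - u‖ * (2 * max ‖u‖ ‖v‖ ^ q) := by gcongr
    _ = _ := by ring

theorem max_rpow_le_add {r : ℝ} {s t : ℝ} (hs : 0 ≤ s) (ht : 0 ≤ t) :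
    max s t ^ r ≤ s ^ r + t ^ r := by
  rcases max_choice s t with h | h <;> rw [h]
  · linarith [Real.rpow_nonneg ht r]
  · linarith [Real.rpow_nonneg hs r]

/-- The two cases `|v - u| ≤ ε max(|u|, |v|)` and `|v - u| ≥ ε max(|u|, |v|)` of `bTerm_le_max`. -/
theorem bTerm_le (hq : 0 < q) {ε : ℝ} (hε : 0 < ε) (u v : Vec N) :
    bTerm q u v ≤ 2 * ε * (‖u‖ ^ (q + 1) + ‖v‖ ^ (q + 1)) + 2 * ε⁻¹ ^ q * ‖v - u‖ ^ (q + 1) := by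
  refine (bTerm_le_max hq u v).trans ?_
  set M := max ‖u‖ ‖v‖ with hM
  have hM0 : 0 ≤ M := (norm_nonneg u).trans (le_max_left _ _)
  have hMle : M ^ (q + 1) ≤ ‖u‖ ^ (q + 1) + ‖v‖ ^ (q + 1) :=
    max_rpow_le_add (norm_nonneg _) (norm_nonneg _)
  rcases le_total ‖v - u‖ (ε * M) with h | h
  · calc _ ≤ 2 * (M ^ q * (ε * M)) := by gcongr
      _ = 2 * ε * M ^ (q + 1) := by rw [Real.rpow_add_one' hM0 (by linarith)]; ring
      _ ≤ 2 * ε * (‖u‖ ^ (q + 1) + ‖v‖ ^ (q + 1)) := by gcongr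
      _ ≤ _ := le_add_of_nonneg_right (by positivity)
  · have : M ≤ ε⁻¹ * ‖v - u‖ := by rw [inv_mul_eq_div, le_div_iff₀ hε]; linarith
    calc _ ≤ 2 * ((ε⁻¹ * ‖v - u‖) ^ q * ‖v - u‖) := by gcongr
      _ = 2 * ε⁻¹ ^ q * ‖v - u‖ ^ (q + 1) := by
        rw [Real.mul_rpow (by positivity) (norm_nonneg _),
          Real.rpow_add_one' (norm_nonneg _) (by linarith)]; ring
      _ ≤ _ := le_add_of_nonneg_left (by positivity)

theorem bTerm_le_const (hq : 0 < q) (u v : Vec N) :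
    bTerm q u v ≤ 4 * (‖u‖ ^ (q + 1) + ‖v‖ ^ (q + 1)) := by
  refine (bTerm_le_max hq u v).trans ?_
  set M := max ‖u‖ ‖v‖ with hM
  have hM0 : 0 ≤ M := (norm_nonneg u).trans (le_max_left _ _)
  have hMle : M ^ (q + 1) ≤ ‖u‖ ^ (q + 1) + ‖v‖ ^ (q + 1) :=
    max_rpow_le_add (norm_nonneg _) (norm_nonneg _)
  have : ‖v - u‖ ≤ 2 * M := by
    linarith [norm_sub_le v u, le_max_left ‖u‖ ‖v‖, le_max_right ‖u‖ ‖v‖]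
  calc _ ≤ 2 * (M ^ q * (2 * M)) := by gcongr
    _ = 4 * M ^ (q + 1) := by rw [Real.rpow_add_one' hM0 (by linarith)]; ring
    _ ≤ _ := by gcongr

/-- On the unit sphere of `ℝᴺ × ℝᴺ` off a neighbourhood of the diagonal, `b` is bounded below by
strict positivity and compactness; the general case follows by homogeneity. -/
theorem exists_norm_sub_rpow_le (hq : 0 < q) {ε : ℝ} (hε : 0 < ε) :
    ∃ C : ℝ, 0 < C ∧ ∀ u v : Vec N,
      ‖u - v‖ ^ (q + 1) ≤ ε * (‖u‖ ^ (q + 1) + ‖v‖ ^ (q + 1)) + C * bTerm q u v := by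
  have hq1 : 0 ≤ q + 1 := by linarith
  have hcd : Continuous fun z : Vec N × Vec N => ‖z.1 - z.2‖ ^ (q + 1) :=
    (continuous_fst.sub continuous_snd).norm.rpow_const fun _ => Or.inr hq1
  let K : Set (Vec N × Vec N) := Metric.sphere 0 1 ∩ {z | ε ≤ ‖z.1 - z.2‖ ^ (q + 1)}
  have hK : IsCompact K := (isCompact_sphere _ _).inter_right (isClosed_le continuous_const hcd)
  obtain ⟨c, hc, hcK⟩ : ∃ c : ℝ, 0 < c ∧ ∀ z ∈ K, c ≤ bTerm q z.1 z.2 := by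
    rcases K.eq_empty_or_nonempty with h | h
    · exact ⟨1, one_pos, by simp [h]⟩
    · obtain ⟨z, hz, hmin⟩ := hK.exists_isMinOn h (continuous_bTerm hq).continuousOn
      refine ⟨_, bTerm_pos hq ?_, fun y hy => hmin hy⟩
      intro he
      have := hz.2
      rw [mem_ofPred_eq, he, sub_self, norm_zero, Real.zero_rpow (by linarith)] at this
      linarith
  refine ⟨2 ^ (q + 1) / c, by positivity, fun u v => ?_⟩
  rcases eq_or_ne (u, v) 0 with h0 | h0
  · obtain ⟨rfl, rfl⟩ := Prod.mk_eq_zero.1 h0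
    simp [bTerm_self, Real.zero_rpow (by linarith : q + 1 ≠ 0)]
  set r : ℝ := ‖(u, v)‖ with hr
  have hr0 : 0 < r := norm_pos_iff.2 h0
  have hrm : r ^ (q + 1) ≤ ‖u‖ ^ (q + 1) + ‖v‖ ^ (q + 1) :=
    max_rpow_le_add (norm_nonneg _) (norm_nonneg _)
  have hu : u = r • (r⁻¹ • u) := by rw [smul_inv_smul₀ hr0.ne']
  have hv : v = r • (r⁻¹ • v) := by rw [smul_inv_smul₀ hr0.ne']
  have hs : ‖(r⁻¹ • u, r⁻¹ • v)‖ = 1 := by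
    rw [← Prod.smul_mk, norm_smul, norm_inv, Real.norm_of_nonneg hr0.le, ← hr,
      inv_mul_cancel₀ hr0.ne']
  have hd : ‖u - v‖ ^ (q + 1) = r ^ (q + 1) * ‖r⁻¹ • u - r⁻¹ • v‖ ^ (q + 1) := by
    conv_lhs => rw [hu, hv, ← smul_sub, norm_smul, Real.norm_of_nonneg hr0.le]
    rw [Real.mul_rpow hr0.le (norm_nonneg _)]
  have hb : bTerm q u v = r ^ (q + 1) * bTerm q (r⁻¹ • u) (r⁻¹ • v) := by
    conv_lhs => rw [hu, hv]
    rw [bTerm_smul hq hr0.le]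
  have hbn := bTerm_nonneg hq u v
  rcases lt_or_ge (‖r⁻¹ • u - r⁻¹ • v‖ ^ (q + 1)) ε with h | h
  · calc _ ≤ r ^ (q + 1) * ε := by rw [hd]; gcongr
      _ ≤ ε * (‖u‖ ^ (q + 1) + ‖v‖ ^ (q + 1)) := by rw [mul_comm]; gcongr
      _ ≤ _ := le_add_of_nonneg_right (by positivity)
  · have hcb := hcK (r⁻¹ • u, r⁻¹ • v) ⟨by simpa using hs, h⟩
    have hle : ‖r⁻¹ • u - r⁻¹ • v‖ ≤ 2 := by
      have h1 : ‖r⁻¹ • u‖ ≤ 1 := (le_max_left _ _).trans hs.le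
      have h2 : ‖r⁻¹ • v‖ ≤ 1 := (le_max_right _ _).trans hs.le
      linarith [norm_sub_le (r⁻¹ • u) (r⁻¹ • v)]
    calc ‖u - v‖ ^ (q + 1) ≤ r ^ (q + 1) * 2 ^ (q + 1) := by rw [hd]; gcongr
      _ = 2 ^ (q + 1) / c * (r ^ (q + 1) * c) := by field_simp
      _ ≤ 2 ^ (q + 1) / c * bTerm q u v := by rw [hb]; gcongr
      _ ≤ _ := le_add_of_nonneg_left (by positivity)

end

/-! ### Slices of functions on a product as elements of `L^p` -/

section

section SliceLp

variable {α β F : Type*} [MeasurableSpace α] [NormedAddCommGroup F]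
  {p : ℝ≥0∞} {μ : Measure α}

/-- The slice `g(·, s)` as an element of `L^p`; the value is `0` when the slice is not in `L^p`. -/
def sliceLp (p : ℝ≥0∞) (μ : Measure α) (g : α × β → F) (s : β) : Lp F p μ :=
  open scoped Classical in if h : MemLp (fun x => g (x, s)) p μ then h.toLp else 0

theorem sliceLp_coeFn {g : α × β → F} {s : β} (h : MemLp (fun x => g (x, s)) p μ) :
    sliceLp p μ g s =ᵐ[μ] fun x => g (x, s) := by
  rw [sliceLp, dif_pos h]; exact h.coeFn_toLp

theorem sliceLp_of_memLp {g : α × β → F} {s : β} (h : MemLp (fun x => g (x, s)) p μ) :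
    sliceLp p μ g s = h.toLp := dif_pos h

theorem sliceLp_congr {g g' : α × β → F} {s : β}
    (h : (fun x => g (x, s)) =ᵐ[μ] fun x => g' (x, s)) : sliceLp p μ g s = sliceLp p μ g' s := by
  by_cases hg : MemLp (fun x => g (x, s)) p μ
  · rw [sliceLp_of_memLp hg, sliceLp_of_memLp (hg.ae_eq h)]
    exact (MemLp.toLp_eq_toLp_iff _ _).2 h
  · have hg' : ¬ MemLp (fun x => g' (x, s)) p μ := fun h' => hg (h'.ae_eq h.symm)
    rw [sliceLp, sliceLp, dif_neg hg, dif_neg hg']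

variable [MeasurableSpace β] {ν : Measure β}

/-- The converse of `ae_ae_slice`, which needs the set to be measurable. -/
theorem ae_prod_of_ae_ae_slice [SFinite μ] [SFinite ν] {P : α × β → Prop}
    (hP : MeasurableSet {z | P z}) (h : ∀ᵐ s ∂ν, ∀ᵐ x ∂μ, P (x, s)) : ∀ᵐ z ∂μ.prod ν, P z := by
  rw [ae_iff, ← compl_ofPred, Measure.prod_apply_symm hP.compl,
    lintegral_eq_zero_iff (measurable_measure_prodMk_right hP.compl)]
  filter_upwards [h] with s hs using ae_iff.1 hs

/-- Fubini: almost everywhere statements on a product hold on almost all slices in the second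
variable. -/
theorem ae_ae_slice [SFinite μ] [SFinite ν] {P : α × β → Prop} (h : ∀ᵐ z ∂μ.prod ν, P z) :
    ∀ᵐ s ∂ν, ∀ᵐ x ∂μ, P (x, s) :=
  Measure.ae_ae_of_ae_prod (Measure.measurePreserving_swap.quasiMeasurePreserving.ae h)

theorem ae_memLp_slice [SFinite μ] [SFinite ν] (hp0 : p ≠ 0) (hp : p ≠ ⊤) {g : α × β → F}
    (hg : MemLp g p (μ.prod ν)) : ∀ᵐ s ∂ν, MemLp (fun x => g (x, s)) p μ := by
  have h1 := (eLpNorm_lt_top_iff_lintegral_rpow_enorm_lt_top hp0 hp).1 hg.2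
  have hm := hg.1.enorm.pow_const p.toReal
  rw [lintegral_prod_symm _ hm] at h1
  filter_upwards [ae_lt_top' hm.lintegral_prod_left' h1.ne,
    hg.1.prod_swap.prodMk_left] with s hs hms
  exact ⟨hms, (eLpNorm_lt_top_iff_lintegral_rpow_enorm_lt_top hp0 hp).2 hs⟩

variable [SecondCountableTopology F] [Fact (1 ≤ p)]

/-- The space `L^p` is separable, so its Borel sets are generated by the balls, and the preimage of
a ball is described by the measurable functions `s ↦ ‖g(·, s) - c‖_p`. -/
theorem measurable_sliceLp [SFinite μ] [MeasureTheory.IsSeparable μ] (hp : p ≠ ⊤) {g : α × β → F}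
    (hg : StronglyMeasurable g) : @Measurable _ _ _ (borel (Lp F p μ)) (sliceLp p μ g) := by
  have hp0 : p ≠ 0 := (zero_lt_one.trans_le Fact.out).ne'
  have : Fact (p ≠ ⊤) := ⟨hp⟩
  have hm : ∀ s, AEStronglyMeasurable (fun x => g (x, s)) μ := fun s =>
    (hg.comp_measurable measurable_prodMk_right).aestronglyMeasurable
  have hN : ∀ c : α → F, StronglyMeasurable c →
      Measurable fun s => eLpNorm (fun x => g (x, s) - c x) p μ := by
    intro c hc
    simp_rw [eLpNorm_eq_lintegral_rpow_enorm_toReal hp0 hp]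
    exact (Measurable.lintegral_prod_left' (f := fun z : α × β => ‖g z - c z.1‖ₑ ^ p.toReal)
      ((hg.sub (hc.comp_measurable measurable_fst)).enorm.pow_const _)).pow_const _
  have hS : MeasurableSet {s | MemLp (fun x => g (x, s)) p μ} := by
    have : {s | MemLp (fun x => g (x, s)) p μ} =
        {s | eLpNorm (fun x => g (x, s) - (0 : α → F) x) p μ < ⊤} := by
      ext s; simp [MemLp, hm s]
    rw [this]
    exact measurableSet_lt (hN 0 stronglyMeasurable_zero) measurable_const
  have hbasis : TopologicalSpace.IsTopologicalBasis
      {U : Set (Lp F p μ) | ∃ c r, U = Metric.ball c r} :=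
    TopologicalSpace.isTopologicalBasis_of_isOpen_of_nhds
      (by rintro _ ⟨c, r, rfl⟩; exact Metric.isOpen_ball) (by
        intro a U ha hU
        obtain ⟨r, hr, hrU⟩ := Metric.isOpen_iff.1 hU a ha
        exact ⟨_, ⟨a, r, rfl⟩, Metric.mem_ball_self hr, hrU⟩)
  rw [hbasis.borel_eq_generateFrom]
  refine measurable_generateFrom ?_
  rintro _ ⟨c, r, rfl⟩
  have hset : sliceLp p μ g ⁻¹' Metric.ball c r =
      ({s | MemLp (fun x => g (x, s)) p μ} ∩ {s | eLpNorm (fun x => g (x, s) - c x) p μ <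
        ENNReal.ofReal r}) ∪ ({s | MemLp (fun x => g (x, s)) p μ}ᶜ ∩ {_s | dist 0 c < r}) := by
    ext s
    by_cases h : MemLp (fun x => g (x, s)) p μ
    · simp only [mem_preimage, Metric.mem_ball, mem_union, mem_inter_iff, mem_ofPred_eq, h,
        mem_compl_iff, not_true_eq_false, false_and, or_false, true_and]
      rw [← edist_lt_ofReal, sliceLp_of_memLp h, Lp.edist_def]
      rw [eLpNorm_congr_ae (h.coeFn_toLp.sub (ae_eq_refl c))]
      rfl
    · simp only [mem_preimage, Metric.mem_ball, mem_union, mem_inter_iff, mem_ofPred_eq, h,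
        mem_compl_iff, not_false_eq_true, false_and, false_or, true_and]
      rw [sliceLp, dif_neg h]
  rw [hset]
  exact (hS.inter (measurableSet_lt (hN c (Lp.stronglyMeasurable c)) measurable_const)).union
    (hS.compl.inter (MeasurableSet.const _))

theorem aestronglyMeasurable_sliceLp [SFinite μ] [MeasureTheory.IsSeparable μ] [SFinite ν]
    (hp : p ≠ ⊤) {g : α × β → F} (hg : AEStronglyMeasurable g (μ.prod ν)) :
    AEStronglyMeasurable (sliceLp p μ g) ν := by
  have : Fact (p ≠ ⊤) := ⟨hp⟩
  let _ : MeasurableSpace (Lp F p μ) := borel _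
  have : BorelSpace (Lp F p μ) := ⟨rfl⟩
  have h1 := (measurable_sliceLp (μ := μ) hp hg.stronglyMeasurable_mk).aestronglyMeasurable (μ := ν)
  refine h1.congr ?_
  filter_upwards [ae_ae_slice hg.ae_eq_mk] with s hs
  exact (sliceLp_congr hs).symm

theorem memLp_sliceLp [SFinite μ] [MeasureTheory.IsSeparable μ] [SFinite ν] (hp : p ≠ ⊤)
    {g : α × β → F} (hg : MemLp g p (μ.prod ν)) : MemLp (sliceLp p μ g) p ν := by
  have hp0 : p ≠ 0 := (zero_lt_one.trans_le Fact.out).ne'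
  refine ⟨aestronglyMeasurable_sliceLp hp hg.1, ?_⟩
  rw [eLpNorm_lt_top_iff_lintegral_rpow_enorm_lt_top hp0 hp]
  have h1 := (eLpNorm_lt_top_iff_lintegral_rpow_enorm_lt_top hp0 hp).1 hg.2
  rw [lintegral_prod_symm _ (hg.1.enorm.pow_const p.toReal)] at h1
  refine lt_of_eq_of_lt (lintegral_congr_ae ?_) h1
  filter_upwards [ae_memLp_slice hp0 hp hg] with s hs
  rw [sliceLp_of_memLp hs, Lp.enorm_toLp, eLpNorm_eq_lintegral_rpow_enorm_toReal hp0 hp,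
    ← ENNReal.rpow_mul, one_div_mul_cancel (ENNReal.toReal_pos hp0 hp).ne', ENNReal.rpow_one]

theorem integrable_sliceLp [SFinite μ] [MeasureTheory.IsSeparable μ] [IsFiniteMeasure ν]
    (hp : p ≠ ⊤) {g : α × β → F} (hg : MemLp g p (μ.prod ν)) : Integrable (sliceLp p μ g) ν :=
  (memLp_sliceLp hp hg).integrable Fact.out

variable [NormedSpace ℝ F] [CompleteSpace F]

/-- Integration against a bounded weight `c` as a continuous linear map on `L^p` of a finite
measure. -/
def weightedIntegralLp (p : ℝ≥0∞) [Fact (1 ≤ p)] (μ : Measure α) [IsFiniteMeasure μ] {c : α → ℝ}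
    {C : ℝ} (hc : AEStronglyMeasurable c μ) (hC : ∀ x, ‖c x‖ ≤ C) : Lp F p μ →L[ℝ] F :=
  LinearMap.mkContinuous
    { toFun := fun f => ∫ x, c x • f x ∂μ
      map_add' := fun f g => by
        refine Eq.trans (integral_congr_ae ?_) (integral_add
          (((Lp.memLp f).integrable Fact.out).bdd_smul C hc (ae_of_all _ hC))
          (((Lp.memLp g).integrable Fact.out).bdd_smul C hc (ae_of_all _ hC)))
        filter_upwards [Lp.coeFn_add f g] with x hx
        rw [hx, Pi.add_apply, smul_add]
      map_smul' := fun r f => by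
        rw [RingHom.id_apply, ← integral_smul]
        refine integral_congr_ae ?_
        filter_upwards [Lp.coeFn_smul r f] with x hx
        rw [hx, Pi.smul_apply, smul_comm] }
    (|C| * (μ univ ^ (1 / (1 : ℝ≥0∞).toReal - 1 / p.toReal)).toReal) (by
      intro f
      have hfi := (Lp.memLp f).integrable (Fact.out : 1 ≤ p)
      calc ‖∫ x, c x • f x ∂μ‖ ≤ ∫ x, ‖c x • f x‖ ∂μ := norm_integral_le_integral_norm _
        _ ≤ ∫ x, |C| * ‖f x‖ ∂μ := by
          refine integral_mono (hfi.bdd_smul C hc (ae_of_all _ hC)).norm (hfi.norm.const_mul _)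
            fun x => ?_
          simp only [norm_smul]
          gcongr
          exact (hC x).trans (le_abs_self C)
        _ = |C| * (eLpNorm f 1 μ).toReal := by
          rw [integral_const_mul, integral_norm_eq_lintegral_enorm hfi.1,
            eLpNorm_one_eq_lintegral_enorm]
        _ ≤ |C| * (eLpNorm f p μ * μ univ ^ (1 / (1 : ℝ≥0∞).toReal - 1 / p.toReal)).toReal := by
          gcongr
          · refine ENNReal.mul_ne_top (Lp.memLp f).2.ne (ENNReal.rpow_ne_top_of_nonneg ?_
              (measure_ne_top _ _))
            rw [ENNReal.toReal_one, div_one, sub_nonneg]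
            rcases eq_or_ne p ⊤ with rfl | hp
            · simp
            · rw [div_le_one (ENNReal.toReal_pos (zero_lt_one.trans_le Fact.out).ne' hp)]
              exact (ENNReal.ofReal_le_iff_le_toReal hp).1 (by simpa using Fact.out)
          · exact eLpNorm_le_eLpNorm_mul_rpow_measure_univ Fact.out (Lp.memLp f).1
        _ = _ := by rw [ENNReal.toReal_mul, Lp.norm_def]; ring)

theorem weightedIntegralLp_apply [IsFiniteMeasure μ] {c : α → ℝ} {C : ℝ}
    (hc : AEStronglyMeasurable c μ) (hC : ∀ x, ‖c x‖ ≤ C) (f : Lp F p μ) :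
    weightedIntegralLp p μ hc hC f = ∫ x, c x • f x ∂μ := rfl

/-- The Bochner integral of the slices in `L^p` is the pointwise integral. -/
theorem integral_sliceLp_coeFn [IsFiniteMeasure μ] [MeasureTheory.IsSeparable μ]
    [IsFiniteMeasure ν] (hp : p ≠ ⊤) {g : α × β → F} (hg : MemLp g p (μ.prod ν)) :
    (∫ s, sliceLp p μ g s ∂ν : Lp F p μ) =ᵐ[μ] fun x => ∫ s, g (x, s) ∂ν := by
  have hp0 : p ≠ 0 := (zero_lt_one.trans_le Fact.out).ne'
  have hgi : Integrable g (μ.prod ν) := hg.integrable Fact.out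
  refine ae_eq_of_forall_setIntegral_eq_of_sigmaFinite
    (fun A _ _ => ((Lp.memLp _).integrable (Fact.out : 1 ≤ p)).integrableOn)
    (fun A _ _ => hgi.integral_prod_left.integrableOn) fun A hA _ => ?_
  have hc : AEStronglyMeasurable (A.indicator fun _ => (1 : ℝ)) μ :=
    (stronglyMeasurable_one.indicator hA).aestronglyMeasurable
  have hC : ∀ x, ‖A.indicator (fun _ => (1 : ℝ)) x‖ ≤ 1 := fun x =>
    (norm_indicator_le_norm_self _ _).trans (by simp)
  have hcA : ∀ f : α → F, ∫ x, A.indicator (fun _ => (1 : ℝ)) x • f x ∂μ = ∫ x in A, f x ∂μ := by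
    intro f
    rw [← integral_indicator hA]
    refine integral_congr_ae (ae_of_all _ fun x => ?_)
    by_cases hx : x ∈ A <;> simp [hx]
  have h1 := (weightedIntegralLp (F := F) p μ hc hC).integral_comp_comm (integrable_sliceLp hp hg)
  simp only [weightedIntegralLp_apply, hcA] at h1
  have hgA : Integrable g ((μ.restrict A).prod ν) := by
    have h2 := hgi.integrableOn (s := A ×ˢ univ)
    rwa [IntegrableOn, ← Measure.prod_restrict, Measure.restrict_univ] at h2
  refine Eq.trans h1.symm ?_
  rw [integral_integral_swap (f := fun x s => g (x, s)) hgA]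
  refine integral_congr_ae ?_
  filter_upwards [ae_memLp_slice hp0 hp hg] with s hs
  exact integral_congr_ae (ae_restrict_of_ae (sliceLp_coeFn hs))

end SliceLp

end

/-! ### The exponential kernel -/

section

section Kernel

variable {lam t : ℝ}

/-- The probability measure `e^{-λt} δ₀ + λ e^{λ(s-t)} ds` on `[0, t]`, whose means are the
exponential time mollification. -/
def expKernel (lam t : ℝ) : Measure ℝ :=
  ENNReal.ofReal (Real.exp (-(lam * t))) • Measure.dirac 0 +
    (volume.restrict (Ioc 0 t)).withDensity fun s =>
      ((Real.toNNReal (lam * Real.exp (lam * (s - t))) : ℝ≥0) : ℝ≥0∞)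

theorem measurable_expDensity (lam t : ℝ) :
    Measurable fun s => Real.toNNReal (lam * Real.exp (lam * (s - t))) := by fun_prop

theorem lintegral_expKernel (F : ℝ → ℝ≥0∞) :
    ∫⁻ s, F s ∂expKernel lam t = ENNReal.ofReal (Real.exp (-(lam * t))) * F 0 +
      ∫⁻ s in Ioc 0 t, ENNReal.ofReal (lam * Real.exp (lam * (s - t))) * F s := by
  rw [expKernel, lintegral_add_measure, lintegral_smul_measure, lintegral_dirac, smul_eq_mul,
    lintegral_withDensity_eq_lintegral_mul_non_measurable _
      (measurable_expDensity lam t).coe_nnreal_ennreal (ae_of_all _ fun _ => ENNReal.coe_lt_top)]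
  rfl

theorem ae_expKernel {P : ℝ → Prop} (h0 : P 0) (h : ∀ᵐ s ∂volume.restrict (Ioc 0 t), P s) :
    ∀ᵐ s ∂expKernel lam t, P s := by
  rw [expKernel, ae_add_measure_iff]
  refine ⟨?_, (withDensity_absolutelyContinuous _ _).ae_le h⟩
  refine Measure.ae_smul_measure ?_ _
  rwa [ae_dirac_eq, eventually_pure]

theorem integral_expDensity (ht : 0 ≤ t) :
    ∫ s in Ioc 0 t, lam * Real.exp (lam * (s - t)) = 1 - Real.exp (-(lam * t)) := by
  rw [← intervalIntegral.integral_of_le ht,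
    intervalIntegral.integral_eq_sub_of_hasDerivAt (f := fun s => Real.exp (lam * (s - t)))]
  · simp
  · intro s _
    have h1 : HasDerivAt (fun s => lam * (s - t)) lam s := by
      simpa using ((hasDerivAt_id s).sub_const t).const_mul lam
    simpa [mul_comm] using h1.exp
  · exact Continuous.intervalIntegrable (by fun_prop) _ _

theorem isProbabilityMeasure_expKernel (hlam : 0 < lam) (ht : 0 ≤ t) :
    IsProbabilityMeasure (expKernel lam t) := by
  constructor
  rw [← lintegral_one, lintegral_expKernel]
  simp only [mul_one]
  rw [← ofReal_integral_eq_lintegral_ofReal, integral_expDensity ht,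
    ← ENNReal.ofReal_add (Real.exp_nonneg _)]
  · simp
  · have : Real.exp (-(lam * t)) ≤ 1 := Real.exp_le_one_iff.2 (by nlinarith)
    linarith
  · exact (Continuous.integrableOn_Icc (by fun_prop)).mono_set Ioc_subset_Icc_self
  · exact ae_of_all _ fun s => by positivity

variable {F : Type*} [NormedAddCommGroup F] [NormedSpace ℝ F] [CompleteSpace F]

theorem integrable_withDensity_expDensity {h : ℝ → F} (hh : IntegrableOn h (Ioc 0 t)) :
    Integrable h ((volume.restrict (Ioc 0 t)).withDensity fun s =>
      ((Real.toNNReal (lam * Real.exp (lam * (s - t))) : ℝ≥0) : ℝ≥0∞)) := by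
  rw [integrable_withDensity_iff_integrable_smul (measurable_expDensity lam t)]
  have : IntegrableOn (fun s => max (lam * Real.exp (lam * (s - t))) 0 • h s) (Ioc 0 t) :=
    have h1 : IntegrableOn h (Icc 0 t) := by rwa [integrableOn_Icc_iff_integrableOn_Ioc]
    (h1.continuousOn_smul (by fun_prop) isCompact_Icc).mono_set Ioc_subset_Icc_self
  exact this

theorem integrable_expKernel {h : ℝ → F} (hh : IntegrableOn h (Ioc 0 t)) :
    Integrable h (expKernel lam t) := by
  rw [expKernel, integrable_add_measure]
  refine ⟨Integrable.smul_measure ?_ ENNReal.ofReal_ne_top, integrable_withDensity_expDensity hh⟩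
  exact integrable_dirac enorm_lt_top

theorem integral_expKernel (hlam : 0 < lam) {h : ℝ → F} (hh : IntegrableOn h (Ioc 0 t)) :
    ∫ s, h s ∂expKernel lam t = Real.exp (-(lam * t)) • (h 0 +
      ∫ s in Ioc 0 t, (lam * Real.exp (lam * s)) • h s) := by
  rw [expKernel, integral_add_measure
    (Integrable.smul_measure (integrable_dirac enorm_lt_top) ENNReal.ofReal_ne_top)
    (integrable_withDensity_expDensity hh), integral_smul_measure, integral_dirac,
    integral_withDensity_eq_integral_smul (measurable_expDensity lam t), smul_add, ← integral_smul,
    ENNReal.toReal_ofReal (Real.exp_nonneg _)]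
  congr 1
  refine integral_congr_ae (ae_of_all _ fun s => ?_)
  simp only
  rw [NNReal.smul_def, Real.coe_toNNReal _ (by positivity), smul_smul]
  congr 1
  rw [show lam * (s - t) = -(lam * t) + lam * s by ring, Real.exp_add]
  ring

theorem lintegral_Ioi_exp (hlam : 0 < lam) (s : ℝ) :
    ∫⁻ t in Ioi s, ENNReal.ofReal (lam * Real.exp (lam * (s - t))) = 1 := by
  have h1 := integrableOn_exp_mul_Ioi (neg_lt_zero.2 hlam) s
  have h2 : (fun t => lam * Real.exp (lam * (s - t))) =
      fun t => lam * Real.exp (lam * s) * Real.exp (-lam * t) := by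
    ext t
    rw [mul_assoc, ← Real.exp_add]; congr 2; ring
  rw [← ofReal_integral_eq_lintegral_ofReal, h2, integral_const_mul,
    integral_exp_mul_Ioi (neg_lt_zero.2 hlam)]
  · rw [neg_div_neg_eq, mul_div_assoc', mul_assoc, ← Real.exp_add]
    simp [hlam.ne']
  · rw [h2]; exact h1.const_mul _
  · exact ae_of_all _ fun s => by positivity

/-- Tonelli: averaging with the exponential kernels increases the integral over `(0, τ)` by at most
the contribution `λ⁻¹ Φ(0)` of the initial value. -/
theorem lintegral_lintegral_expKernel_le (hlam : 0 < lam) (τ : ℝ) {Φ : ℝ → ℝ≥0∞}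
    (hΦ : Measurable Φ) :
    ∫⁻ t in Ioc 0 τ, ∫⁻ s, Φ s ∂expKernel lam t ≤
      ENNReal.ofReal lam⁻¹ * Φ 0 + ∫⁻ s in Ioc 0 τ, Φ s := by
  simp_rw [lintegral_expKernel]
  rw [lintegral_add_left (by fun_prop)]
  gcongr ?_ + ?_
  · rw [lintegral_mul_const _ (by fun_prop)]
    gcongr
    have h1 := lintegral_Ioi_exp hlam 0
    calc ∫⁻ t in Ioc 0 τ, ENNReal.ofReal (Real.exp (-(lam * t)))
        ≤ ∫⁻ t in Ioi 0, ENNReal.ofReal (Real.exp (-(lam * t))) :=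
          lintegral_mono_set Ioc_subset_Ioi_self
      _ = ∫⁻ t in Ioi 0, ENNReal.ofReal lam⁻¹ *
            ENNReal.ofReal (lam * Real.exp (lam * (0 - t))) := by
          refine lintegral_congr fun t => ?_
          rw [← ENNReal.ofReal_mul (by positivity)]
          congr 1; field_simp; ring_nf
      _ = ENNReal.ofReal lam⁻¹ := by rw [lintegral_const_mul _ (by fun_prop), h1, mul_one]
  · have hker : Measurable fun z : ℝ × ℝ => {z : ℝ × ℝ | z.2 ≤ z.1}.indicator (fun z =>
        ENNReal.ofReal (lam * Real.exp (lam * (z.2 - z.1))) * Φ z.2) z := by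
      refine Measurable.indicator ?_ (measurableSet_le measurable_snd measurable_fst)
      exact (by fun_prop : Measurable fun z : ℝ × ℝ =>
        ENNReal.ofReal (lam * Real.exp (lam * (z.2 - z.1)))).mul (hΦ.comp measurable_snd)
    calc ∫⁻ t in Ioc 0 τ, ∫⁻ s in Ioc 0 t, ENNReal.ofReal (lam * Real.exp (lam * (s - t))) * Φ s
        = ∫⁻ t in Ioc 0 τ, ∫⁻ s in Ioc 0 τ, {z : ℝ × ℝ | z.2 ≤ z.1}.indicator (fun z =>
            ENNReal.ofReal (lam * Real.exp (lam * (z.2 - z.1))) * Φ z.2) (t, s) := by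
          refine setLIntegral_congr_fun measurableSet_Ioc fun t ht => ?_
          rw [← lintegral_indicator measurableSet_Ioc, ← lintegral_indicator measurableSet_Ioc]
          refine lintegral_congr fun s => ?_
          have := ht.2
          simp only [indicator, mem_Ioc, mem_ofPred_eq]
          split_ifs <;> first | rfl | (exfalso; grind)
      _ = ∫⁻ s in Ioc 0 τ, ∫⁻ t in Ioc 0 τ, {z : ℝ × ℝ | z.2 ≤ z.1}.indicator (fun z =>
            ENNReal.ofReal (lam * Real.exp (lam * (z.2 - z.1))) * Φ z.2) (t, s) :=
          lintegral_lintegral_swap hker.aemeasurable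
      _ ≤ ∫⁻ s in Ioc 0 τ, Φ s := by
          refine lintegral_mono fun s => ?_
          calc _ ≤ ∫⁻ t, (Ici s).indicator (fun t =>
                  ENNReal.ofReal (lam * Real.exp (lam * (s - t))) * Φ s) t := by
                refine (setLIntegral_le_lintegral _ _).trans_eq (lintegral_congr fun t => ?_)
                simp only [indicator, mem_Ici, mem_ofPred_eq]
            _ = 1 * Φ s := by
                rw [lintegral_indicator measurableSet_Ici, lintegral_mul_const _ (by fun_prop),
                  setLIntegral_congr Ioi_ae_eq_Ici.symm, lintegral_Ioi_exp hlam]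
            _ = Φ s := one_mul _

end Kernel

end

/-! ### Exponential time mollification -/

section

section Mollify

variable {α F : Type*} {lam t T : ℝ} {a : α → F} {g : α × ℝ → F}

/-- The function `g` at positive times, and `a` at nonpositive times. -/
def extendPast (a : α → F) (g : α × ℝ → F) (z : α × ℝ) : F := if z.2 ≤ 0 then a z.1 else g z

theorem extendPast_of_pos {x : α} {s : ℝ} (hs : 0 < s) : extendPast a g (x, s) = g (x, s) :=
  if_neg (not_le.2 hs)

theorem extendPast_zero (x : α) : extendPast a g (x, 0) = a x := if_pos le_rfl

variable [NormedAddCommGroup F] [NormedSpace ℝ F]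

/-- The exponential time mollification `e^{-λt}(a + λ ∫₀ᵗ e^{λs} g(s) ds)` of `g` with initial value
`a`. It solves `∂ₜ w = λ (g - w)`, `w(0) = a`. -/
def mollify (lam : ℝ) (a : α → F) (g : α × ℝ → F) (z : α × ℝ) : F :=
  Real.exp (-(lam * z.2)) • (a z.1 + ∫ s in Ioc 0 z.2, (lam * Real.exp (lam * s)) • g (z.1, s))

theorem mollify_zero (x : α) : mollify lam a g (x, 0) = a x := by simp [mollify]

theorem mollify_eq_integral [CompleteSpace F] (hlam : 0 < lam) {x : α}
    (hg : IntegrableOn (fun s => g (x, s)) (Ioc 0 t)) :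
    mollify lam a g (x, t) = ∫ s, extendPast a g (x, s) ∂expKernel lam t := by
  have he : EqOn (fun s => extendPast a g (x, s)) (fun s => g (x, s)) (Ioc 0 t) :=
    fun s hs => extendPast_of_pos hs.1
  rw [integral_expKernel hlam (hg.congr_fun he.symm measurableSet_Ioc), mollify, extendPast_zero]
  congr 2
  exact setIntegral_congr_fun measurableSet_Ioc fun s hs => by simp only [extendPast_of_pos hs.1]

theorem integrable_extendPast [CompleteSpace F] {x : α}
    (hg : IntegrableOn (fun s => g (x, s)) (Ioc 0 t)) :
    Integrable (fun s => extendPast a g (x, s)) (expKernel lam t) :=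
  integrable_expKernel (hg.congr_fun (fun _ hs => (extendPast_of_pos hs.1).symm) measurableSet_Ioc)

variable [MeasurableSpace α] {μ : Measure α} {p : ℝ≥0∞}

theorem stronglyMeasurable_extendPast (ha : StronglyMeasurable a) (hg : StronglyMeasurable g) :
    StronglyMeasurable (extendPast a g) :=
  StronglyMeasurable.ite (measurableSet_le measurable_snd measurable_const)
    (ha.comp_measurable measurable_fst) hg

theorem stronglyMeasurable_mollify (ha : StronglyMeasurable a) (hg : StronglyMeasurable g) :
    StronglyMeasurable (mollify lam a g) := by
  have h1 : StronglyMeasurable fun z : α × ℝ =>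
      ∫ s in Ioc 0 z.2, (lam * Real.exp (lam * s)) • g (z.1, s) := by
    have h2 : (fun z : α × ℝ => ∫ s in Ioc 0 z.2, (lam * Real.exp (lam * s)) • g (z.1, s)) =
        fun z : α × ℝ => ∫ s, {y : (α × ℝ) × ℝ | 0 < y.2 ∧ y.2 ≤ y.1.2}.indicator
          (fun y => (lam * Real.exp (lam * y.2)) • g (y.1.1, y.2)) (z, s) := by
      ext z
      rw [← integral_indicator measurableSet_Ioc]
      rfl
    rw [h2]
    refine StronglyMeasurable.integral_prod_right ?_
    refine StronglyMeasurable.indicator ?_ ?_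
    · exact (by fun_prop : Continuous fun r : ℝ => lam * Real.exp (lam * r)).stronglyMeasurable
        |>.comp_measurable measurable_snd |>.smul (hg.comp_measurable (by fun_prop))
    · exact (measurableSet_lt measurable_const measurable_snd).inter
        (measurableSet_le measurable_snd (by fun_prop))
  exact ((by fun_prop : Continuous fun r : ℝ => Real.exp (-(lam * r))).stronglyMeasurable
    |>.comp_measurable measurable_snd).smul ((ha.comp_measurable measurable_fst).add h1)

theorem ae_integrableOn_slice [SFinite μ] (hg : Integrable g (μ.prod (volume.restrict (Ioc 0 T)))) :
    ∀ᵐ x ∂μ, IntegrableOn (fun s => g (x, s)) (Ioc 0 T) := hg.prod_right_ae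

theorem ae_integrableOn_slice_of_memLp [IsFiniteMeasure μ] (hp : 1 ≤ p)
    (hg : MemLp g p (μ.prod (volume.restrict (Ioc 0 T)))) :
    ∀ᵐ x ∂μ, IntegrableOn (fun s => g (x, s)) (Ioc 0 T) :=
  ae_integrableOn_slice (hg.integrable hp)

/-- Jensen's inequality for `t ↦ t ^ r`. -/
theorem enorm_integral_rpow_le {β : Type*} [MeasurableSpace β] {ν : Measure β}
    [IsProbabilityMeasure ν] {r : ℝ} (hr : 1 ≤ r) {h : β → F} (hh : AEStronglyMeasurable h ν) :
    ‖∫ s, h s ∂ν‖ₑ ^ r ≤ ∫⁻ s, ‖h s‖ₑ ^ r ∂ν := by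
  have h0 : 0 < r := by linarith
  have h1 : eLpNorm h 1 ν ≤ eLpNorm h (ENNReal.ofReal r) ν :=
    eLpNorm_le_eLpNorm_of_exponent_le (by simpa using ENNReal.ofReal_le_ofReal hr) hh
  rw [eLpNorm_one_eq_lintegral_enorm, eLpNorm_eq_lintegral_rpow_enorm_toReal
    (by simpa using h0) ENNReal.ofReal_ne_top, ENNReal.toReal_ofReal h0.le] at h1
  calc _ ≤ ((∫⁻ s, ‖h s‖ₑ ^ r ∂ν) ^ (1 / r)) ^ r := by
        gcongr
        exact (enorm_integral_le_lintegral_enorm _).trans h1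
    _ = _ := by rw [← ENNReal.rpow_mul, one_div_mul_cancel h0.ne', ENNReal.rpow_one]

theorem lintegral_enorm_rpow_lt_top {β : Type*} [MeasurableSpace β] {ν : Measure β} {r : ℝ}
    (hr : 1 ≤ r) {h : β → F} (hh : MemLp h (ENNReal.ofReal r) ν) : ∫⁻ s, ‖h s‖ₑ ^ r ∂ν < ⊤ := by
  have h0 : 0 < r := by linarith
  have := (eLpNorm_lt_top_iff_lintegral_rpow_enorm_lt_top (by simpa using h0)
    ENNReal.ofReal_ne_top).1 hh.2
  rwa [ENNReal.toReal_ofReal h0.le] at this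

theorem memLp_of_lintegral_enorm_rpow {β : Type*} [MeasurableSpace β] {ν : Measure β} {r : ℝ}
    (hr : 1 ≤ r) {h : β → F} (hm : AEStronglyMeasurable h ν) (hh : ∫⁻ s, ‖h s‖ₑ ^ r ∂ν < ⊤) :
    MemLp h (ENNReal.ofReal r) ν := by
  have h0 : 0 < r := by linarith
  refine ⟨hm, (eLpNorm_lt_top_iff_lintegral_rpow_enorm_lt_top (by simpa using h0)
    ENNReal.ofReal_ne_top).2 ?_⟩
  rwa [ENNReal.toReal_ofReal h0.le]

/-- The space-time version of `lintegral_lintegral_expKernel_le`. -/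
theorem lintegral_expKernel_extendPast_le [SFinite μ] (hlam : 0 < lam) (τ : ℝ)
    {Φ : α × ℝ → ℝ≥0∞} (hΦ : Measurable Φ) :
    ∫⁻ z, ∫⁻ s, Φ (z.1, s) ∂expKernel lam z.2 ∂μ.prod (volume.restrict (Ioc 0 τ)) ≤
      ENNReal.ofReal lam⁻¹ * ∫⁻ x, Φ (x, 0) ∂μ +
        ∫⁻ z, Φ z ∂μ.prod (volume.restrict (Ioc 0 τ)) := by
  have hm : Measurable fun z : α × ℝ => ∫⁻ s, Φ (z.1, s) ∂expKernel lam z.2 := by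
    simp_rw [lintegral_expKernel]
    refine Measurable.add (by fun_prop) ?_
    have h2 : (fun z : α × ℝ => ∫⁻ s in Ioc 0 z.2,
          ENNReal.ofReal (lam * Real.exp (lam * (s - z.2))) * Φ (z.1, s)) =
        fun z : α × ℝ => ∫⁻ s, {y : (α × ℝ) × ℝ | 0 < y.2 ∧ y.2 ≤ y.1.2}.indicator
          (fun y => ENNReal.ofReal (lam * Real.exp (lam * (y.2 - y.1.2))) * Φ (y.1.1, y.2))
          (z, s) := by
      ext z
      rw [← lintegral_indicator measurableSet_Ioc]
      rfl
    rw [h2]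
    refine Measurable.lintegral_prod_right' (Measurable.indicator (by fun_prop) ?_)
    exact (measurableSet_lt measurable_const measurable_snd).inter
      (measurableSet_le measurable_snd (by fun_prop))
  have hΦ0 : Measurable fun x => Φ (x, 0) := by fun_prop
  rw [lintegral_prod _ hm.aemeasurable, lintegral_prod _ hΦ.aemeasurable,
    ← lintegral_const_mul _ hΦ0, ← lintegral_add_left (hΦ0.const_mul _)]
  exact lintegral_mono fun x => lintegral_lintegral_expKernel_le hlam τ
    (hΦ.comp measurable_prodMk_left)

theorem ae_snd_mem_Ioc [SFinite μ] (τ : ℝ) :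
    ∀ᵐ z ∂μ.prod (volume.restrict (Ioc 0 τ)), z.2 ∈ Ioc 0 τ :=
  Measure.quasiMeasurePreserving_snd.ae (ae_restrict_mem measurableSet_Ioc)

theorem ae_extendPast_eq [SFinite μ] {G : Type*} (b : α → G) (h : α × ℝ → G) (τ : ℝ) :
    ∀ᵐ z ∂μ.prod (volume.restrict (Ioc 0 τ)), extendPast b h z = h z := by
  filter_upwards [ae_snd_mem_Ioc τ] with z hz
  exact extendPast_of_pos hz.1

/-- Almost everywhere in space-time, the mollification is a mean with respect to the exponential
kernels. -/
theorem ae_mollify_eq_integral [IsFiniteMeasure μ] [CompleteSpace F] (hlam : 0 < lam)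
    (hg : Integrable g (μ.prod (volume.restrict (Ioc 0 T)))) :
    ∀ᵐ z ∂μ.prod (volume.restrict (Ioc 0 T)), IntegrableOn (fun s => g (z.1, s)) (Ioc 0 z.2) ∧
      mollify lam a g z = ∫ s, extendPast a g (z.1, s) ∂expKernel lam z.2 := by
  filter_upwards [Measure.quasiMeasurePreserving_fst.ae (ae_integrableOn_slice hg),
    ae_snd_mem_Ioc T] with z hz hzt
  have h1 := hz.mono_set (Ioc_subset_Ioc_right hzt.2)
  exact ⟨h1, mollify_eq_integral hlam h1⟩

theorem memLp_mollify [IsFiniteMeasure μ] [CompleteSpace F] (hlam : 0 < lam) {r : ℝ} (hr : 1 ≤ r)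
    (ha : StronglyMeasurable a) (hg : StronglyMeasurable g) (haL : MemLp a (ENNReal.ofReal r) μ)
    (hgL : MemLp g (ENNReal.ofReal r) (μ.prod (volume.restrict (Ioc 0 T)))) :
    MemLp (mollify lam a g) (ENNReal.ofReal r) (μ.prod (volume.restrict (Ioc 0 T))) := by
  refine memLp_of_lintegral_enorm_rpow hr (stronglyMeasurable_mollify ha hg).aestronglyMeasurable ?_
  have hm := stronglyMeasurable_extendPast ha hg
  have hΦ : Measurable fun z => ‖extendPast a g z‖ₑ ^ r := hm.enorm.pow_const r
  have h1 := lintegral_expKernel_extendPast_le (μ := μ) hlam T hΦ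
  simp only [extendPast_zero] at h1
  have h2 : ∫⁻ z, ‖extendPast a g z‖ₑ ^ r ∂μ.prod (volume.restrict (Ioc 0 T)) =
      ∫⁻ z, ‖g z‖ₑ ^ r ∂μ.prod (volume.restrict (Ioc 0 T)) :=
    lintegral_congr_ae ((ae_extendPast_eq a g T).mono fun z hz => by simp only [hz])
  refine lt_of_le_of_lt ((lintegral_mono_ae ?_).trans h1) ?_
  · filter_upwards [ae_mollify_eq_integral (a := a) hlam
      (hgL.integrable (by simpa using
      ENNReal.ofReal_le_ofReal hr)), ae_snd_mem_Ioc T] with z hz hzt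
    have hP := isProbabilityMeasure_expKernel hlam hzt.1.le
    rw [hz.2]
    exact enorm_integral_rpow_le hr (integrable_extendPast hz.1).1
  · rw [h2]
    exact ENNReal.add_lt_top.2 ⟨ENNReal.mul_lt_top ENNReal.ofReal_lt_top
      (lintegral_enorm_rpow_lt_top hr haL), lintegral_enorm_rpow_lt_top hr hgL⟩

/-- The density of the exponential kernel is at most `λ`, so `L^r` in space-time carries over. -/
theorem memLp_extendPast [IsFiniteMeasure μ] (hlam : 0 < lam) (ht : t ∈ Icc 0 T)
    {r : ℝ} (hr : 1 ≤ r) (ha : StronglyMeasurable a) (hg : StronglyMeasurable g)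
    (haL : MemLp a (ENNReal.ofReal r) μ)
    (hgL : MemLp g (ENNReal.ofReal r) (μ.prod (volume.restrict (Ioc 0 T)))) :
    MemLp (extendPast a g) (ENNReal.ofReal r) (μ.prod (expKernel lam t)) := by
  have := isProbabilityMeasure_expKernel hlam ht.1
  have hm := stronglyMeasurable_extendPast ha hg
  refine memLp_of_lintegral_enorm_rpow hr hm.aestronglyMeasurable ?_
  have hΦ : Measurable fun z => ‖extendPast a g z‖ₑ ^ r := hm.enorm.pow_const r
  have hgr : Measurable fun z => ‖g z‖ₑ ^ r := hg.enorm.pow_const r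
  have har : Measurable fun x => ‖a x‖ₑ ^ r := ha.enorm.pow_const r
  rw [lintegral_prod _ hΦ.aemeasurable]
  calc _ ≤ ∫⁻ x, (‖a x‖ₑ ^ r + ENNReal.ofReal lam * ∫⁻ s in Ioc 0 T, ‖g (x, s)‖ₑ ^ r) ∂μ := by
        refine lintegral_mono fun x => ?_
        rw [lintegral_expKernel, extendPast_zero, ← lintegral_const_mul _ (by fun_prop)]
        gcongr ?_ + ?_
        · refine mul_le_of_le_one_left' (ENNReal.ofReal_le_one.2 (Real.exp_le_one_iff.2 ?_))
          nlinarith [ht.1]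
        · refine (setLIntegral_mono' measurableSet_Ioc fun s hs => ?_).trans
            (lintegral_mono_set (Ioc_subset_Ioc_right ht.2))
          rw [extendPast_of_pos hs.1]
          gcongr
          refine mul_le_of_le_one_right hlam.le (Real.exp_le_one_iff.2 ?_)
          nlinarith [hs.2]
    _ = ∫⁻ x, ‖a x‖ₑ ^ r ∂μ + ENNReal.ofReal lam *
          ∫⁻ z, ‖g z‖ₑ ^ r ∂μ.prod (volume.restrict (Ioc 0 T)) := by
        rw [lintegral_add_left har, lintegral_const_mul _ hgr.lintegral_prod_right',
          lintegral_prod _ hgr.aemeasurable]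
    _ < ⊤ := ENNReal.add_lt_top.2 ⟨lintegral_enorm_rpow_lt_top hr haL,
        ENNReal.mul_lt_top ENNReal.ofReal_lt_top (lintegral_enorm_rpow_lt_top hr hgL)⟩

/-- The mollification as a continuous curve in `L^r`. -/
theorem exists_continuousOn_mollify [IsFiniteMeasure μ] [CompleteSpace F]
    [SecondCountableTopology F] [MeasureTheory.IsSeparable μ]
    {r : ℝ} [Fact (1 ≤ ENNReal.ofReal r)] (haL : MemLp a (ENNReal.ofReal r) μ)
    (hgL : MemLp g (ENNReal.ofReal r) (μ.prod (volume.restrict (Ioc 0 T)))) :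
    ∃ V : ℝ → Lp F (ENNReal.ofReal r) μ, ContinuousOn V (Icc 0 T) ∧
      ∀ t ∈ Icc 0 T, V t =ᵐ[μ] fun x => mollify lam a g (x, t) := by
  set wg : α × ℝ → F := fun z => (lam * Real.exp (lam * z.2)) • g z with hwg
  have hwgL : MemLp wg (ENNReal.ofReal r) (μ.prod (volume.restrict (Ioc 0 T))) := by
    obtain ⟨C, hC⟩ := (isCompact_Icc (a := 0) (b := T)).exists_bound_of_continuousOn
      (by fun_prop : Continuous fun s => lam * Real.exp (lam * s)).continuousOn
    refine hgL.of_le_mul (c := C) ?_ ?_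
    · exact ((by fun_prop : Continuous fun s : ℝ => lam * Real.exp (lam * s)).stronglyMeasurable
        |>.comp_measurable measurable_snd).aestronglyMeasurable.smul hgL.1
    · filter_upwards [ae_snd_mem_Ioc T] with z hz
      rw [hwg, norm_smul]
      gcongr
      exact hC _ (Ioc_subset_Icc_self hz)
  have hint := integrable_sliceLp ENNReal.ofReal_ne_top hwgL
  refine ⟨fun t => Real.exp (-(lam * t)) • (haL.toLp + ∫ s in Ioc 0 t,
    sliceLp (ENNReal.ofReal r) μ wg s), ?_, fun t ht => ?_⟩
  · refine ContinuousOn.smul (f := fun t => Real.exp (-(lam * t))) (by fun_prop)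
      (continuousOn_const.add ?_)
    exact intervalIntegral.continuousOn_primitive
      ((integrableOn_Icc_iff_integrableOn_Ioc (by finiteness)).2 hint)
  · have hsub : MemLp wg (ENNReal.ofReal r) (μ.prod (volume.restrict (Ioc 0 t))) :=
      hwgL.mono_measure (Measure.prod_mono le_rfl
        (Measure.restrict_mono (Ioc_subset_Ioc_right ht.2) le_rfl))
    filter_upwards [Lp.coeFn_smul (Real.exp (-(lam * t))) (haL.toLp + ∫ s in Ioc 0 t,
      sliceLp (ENNReal.ofReal r) μ wg s), Lp.coeFn_add haL.toLp (∫ s in Ioc 0 t,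
      sliceLp (ENNReal.ofReal r) μ wg s), haL.coeFn_toLp,
      integral_sliceLp_coeFn ENNReal.ofReal_ne_top hsub] with x h1 h2 h3 h4
    rw [h1, Pi.smul_apply, h2, Pi.add_apply, h3, h4, mollify]

end Mollify

end

/-! ### The weak time derivative of the mollification -/

section

section WeakTimeDerivative

variable {F : Type*} [NormedAddCommGroup F] [NormedSpace ℝ F] [CompleteSpace F] {lam T : ℝ}

/-- Integration by parts against a primitive `∫₀ᵗ h`, by Fubini. -/
theorem integral_deriv_smul_primitive {ψ ψ' : ℝ → ℝ}
    (hψ : ∀ t, HasDerivAt ψ (ψ' t) t) (hc : Continuous ψ') (hψT : ψ T = 0)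
    {h : ℝ → F} (hh : IntegrableOn h (Ioc 0 T)) :
    ∫ t in Ioc 0 T, ψ' t • ∫ s in Ioc 0 t, h s = -∫ s in Ioc 0 T, ψ s • h s := by
  have hψi : IntegrableOn ψ' (Ioc 0 T) := hc.integrableOn_Icc.mono_set Ioc_subset_Icc_self
  have hprod : Integrable (fun z : ℝ × ℝ => ψ' z.1 • h z.2)
      ((volume.restrict (Ioc 0 T)).prod (volume.restrict (Ioc 0 T))) := hψi.smul_prod hh
  have hind : Integrable ({z : ℝ × ℝ | z.2 ≤ z.1}.indicator fun z : ℝ × ℝ => ψ' z.1 • h z.2)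
      ((volume.restrict (Ioc 0 T)).prod (volume.restrict (Ioc 0 T))) :=
    hprod.indicator (measurableSet_le measurable_snd measurable_fst)
  calc ∫ t in Ioc 0 T, ψ' t • ∫ s in Ioc 0 t, h s
      = ∫ t in Ioc 0 T, ∫ s in Ioc 0 T,
          {z : ℝ × ℝ | z.2 ≤ z.1}.indicator (fun z : ℝ × ℝ => ψ' z.1 • h z.2) (t, s) := by
        refine setIntegral_congr_fun measurableSet_Ioc fun t ht => ?_
        rw [← integral_smul, ← integral_indicator measurableSet_Ioc,
          ← integral_indicator measurableSet_Ioc]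
        refine integral_congr_ae (ae_of_all _ fun s => ?_)
        have := ht.2
        simp only [indicator, mem_Ioc, mem_ofPred_eq]
        split_ifs <;> first | rfl | (exfalso; grind)
    _ = ∫ s in Ioc 0 T, ∫ t in Ioc 0 T,
          {z : ℝ × ℝ | z.2 ≤ z.1}.indicator (fun z : ℝ × ℝ => ψ' z.1 • h z.2) (t, s) :=
        integral_integral_swap hind
    _ = ∫ s in Ioc 0 T, -(ψ s • h s) := by
        refine setIntegral_congr_fun measurableSet_Ioc fun s hs => ?_
        have h1 : ∫ t in Ioc s T, ψ' t = -ψ s := by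
          rw [← intervalIntegral.integral_of_le hs.2,
            intervalIntegral.integral_eq_sub_of_hasDerivAt (fun t _ => hψ t)
              (hc.intervalIntegrable _ _), hψT, zero_sub]
        rw [← neg_smul, ← h1, ← integral_smul_const,
          setIntegral_congr_set (Ioc_ae_eq_Icc (a := s) (b := T)),
          ← integral_indicator measurableSet_Icc, ← integral_indicator measurableSet_Ioc]
        refine integral_congr_ae (ae_of_all _ fun t => ?_)
        have := hs.1
        simp only [indicator, mem_Ioc, mem_Icc, mem_ofPred_eq]
        split_ifs <;> first | rfl | (exfalso; grind)
    _ = _ := integral_neg _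

/-- The weak form of `∂ₜ w = λ (g - w)` at a fixed point `x` of space. -/
theorem integral_deriv_smul_mollify {α : Type*} {a : α → F} {g : α × ℝ → F} {x : α}
    {φ φ' : ℝ → ℝ} (hφ : ∀ t, HasDerivAt φ (φ' t) t) (hc : Continuous φ')
    (hφ0 : φ 0 = 0) (hφT : φ T = 0) (hT : 0 ≤ T)
    (hg : IntegrableOn (fun s => g (x, s)) (Ioc 0 T)) :
    ∫ t in Ioc 0 T, φ' t • mollify lam a g (x, t) =
      -∫ t in Ioc 0 T, φ t • (lam • (g (x, t) - mollify lam a g (x, t))) := by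
  have hφc : Continuous φ := continuous_iff_continuousAt.2 fun t => (hφ t).continuousAt
  set ψ : ℝ → ℝ := fun t => φ t * Real.exp (-(lam * t)) with hψdef
  set ψ' : ℝ → ℝ := fun t => φ' t * Real.exp (-(lam * t)) - lam * (φ t * Real.exp (-(lam * t)))
    with hψ'def
  have hψ : ∀ t, HasDerivAt ψ (ψ' t) t := by
    intro t
    have h1 : HasDerivAt (fun t => -(lam * t)) (-lam) t := by
      simpa using ((hasDerivAt_id' t).const_mul lam).fun_neg
    convert! (hφ t).mul h1.exp using 1
    simp only [hψ'def]; ring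
  have hψ'c : Continuous ψ' := by fun_prop
  set h : ℝ → F := fun s => (lam * Real.exp (lam * s)) • g (x, s) with hhdef
  have hgc : ∀ c : ℝ → ℝ, Continuous c → IntegrableOn (fun s => c s • g (x, s)) (Ioc 0 T) := by
    intro c hc
    have h1 : IntegrableOn (fun s => g (x, s)) (Icc 0 T) := by
      rwa [integrableOn_Icc_iff_integrableOn_Ioc]
    exact (h1.continuousOn_smul hc.continuousOn isCompact_Icc).mono_set Ioc_subset_Icc_self
  have hh : IntegrableOn h (Ioc 0 T) := hgc _ (by fun_prop)
  have hprim : ContinuousOn (fun t => ∫ s in Ioc 0 t, h s) (Icc 0 T) :=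
    intervalIntegral.continuousOn_primitive
      ((integrableOn_Icc_iff_integrableOn_Ioc (by finiteness)).2 hh)
  have hA : ContinuousOn (fun t => a x + ∫ s in Ioc 0 t, h s) (Icc 0 T) :=
    continuousOn_const.add hprim
  have hcA : ∀ c : ℝ → ℝ, Continuous c →
      IntegrableOn (fun t => c t • (a x + ∫ s in Ioc 0 t, h s)) (Ioc 0 T) := fun c hc =>
    (ContinuousOn.integrableOn_Icc (hc.continuousOn.smul hA)).mono_set Ioc_subset_Icc_self
  have key : ∫ t in Ioc 0 T, ψ' t • (a x + ∫ s in Ioc 0 t, h s) = -∫ t in Ioc 0 T, ψ t • h t := by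
    simp_rw [smul_add]
    rw [integral_add, integral_deriv_smul_primitive hψ hψ'c (by simp [hψdef, hφT]) hh,
      integral_smul_const, ← intervalIntegral.integral_of_le hT,
      intervalIntegral.integral_eq_sub_of_hasDerivAt (fun t _ => hψ t)
        (hψ'c.intervalIntegrable _ _)]
    · simp [hψdef, hφT, hφ0]
    · exact (ContinuousOn.integrableOn_Icc (by fun_prop)).mono_set Ioc_subset_Icc_self
    · exact (ContinuousOn.integrableOn_Icc (hψ'c.continuousOn.smul hprim)).mono_set
        Ioc_subset_Icc_self
  have e1 : ∀ t, φ' t • mollify lam a g (x, t) = ψ' t • (a x + ∫ s in Ioc 0 t, h s) +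
      (lam * (φ t * Real.exp (-(lam * t)))) • (a x + ∫ s in Ioc 0 t, h s) := by
    intro t
    rw [mollify, ← add_smul, smul_smul]
    congr 1; simp only [hψ'def]; ring
  have e2 : ∀ t, φ t • (lam • (g (x, t) - mollify lam a g (x, t))) = ψ t • h t -
      (lam * (φ t * Real.exp (-(lam * t)))) • (a x + ∫ s in Ioc 0 t, h s) := by
    intro t
    rw [mollify, smul_smul, smul_sub, smul_smul, hhdef, smul_smul, hψdef]
    congr 2
    · rw [show φ t * Real.exp (-(lam * t)) * (lam * Real.exp (lam * t)) =
        φ t * lam * (Real.exp (-(lam * t)) * Real.exp (lam * t)) by ring, ← Real.exp_add]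
      simp
    · ring
  simp_rw [e1, e2]
  rw [integral_add (hcA _ hψ'c) (hcA _ (by fun_prop)), integral_sub _ (hcA _ (by fun_prop)), key]
  · abel
  · simp only [hhdef, smul_smul]
    exact hgc _ (by fun_prop)

end WeakTimeDerivative

variable {n N : ℕ} {Ω : Set (Vec n)} {T lam : ℝ}

theorem volume_restrict_cylinder (Ω : Set (Vec n)) (T : ℝ) :
    volume.restrict (cylinder Ω T) =
      (volume.restrict Ω).prod (volume.restrict (Ioc 0 T)) := by
  rw [cylinder, Measure.volume_eq_prod, ← Measure.prod_restrict,
    Measure.restrict_congr_set Ico_ae_eq_Ioc]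

theorem hasWeakTimeDeriv_mollify {r : ℝ} (hr : 1 ≤ r) [IsFiniteMeasure (volume.restrict Ω)]
    (hT : 0 < T) (hlam : 0 < lam) {a : Vec n → Vec N} {g : Vec n × ℝ → Vec N}
    (ha : StronglyMeasurable a) (hg : StronglyMeasurable g)
    (haL : MemLp a (ENNReal.ofReal r) (volume.restrict Ω))
    (hgL : MemLp g (ENNReal.ofReal r) (volume.restrict (cylinder Ω T))) :
    HasWeakTimeDeriv Ω T r (mollify lam a g) (fun z => lam • (g z - mollify lam a g z)) := by
  have hr' : 1 ≤ ENNReal.ofReal r := by simpa using ENNReal.ofReal_le_ofReal hr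
  rw [volume_restrict_cylinder] at hgL
  have hmL := memLp_mollify hlam hr ha hg haL hgL
  have hdL : MemLp (fun z => lam • (g z - mollify lam a g z)) (ENNReal.ofReal r)
      ((volume.restrict Ω).prod (volume.restrict (Ioc 0 T))) := (hgL.sub hmL).const_smul lam
  refine ⟨by rwa [volume_restrict_cylinder], fun φ hφ => ?_⟩
  rw [volume_restrict_cylinder]
  obtain ⟨hsm, hcs, hsupp⟩ := hφ
  have hd : Continuous fun z => fderiv ℝ φ z (0, 1) :=
    (hsm.continuous_fderiv (by simp)).clm_apply continuous_const
  have hdb : ∃ C, ∀ z, ‖fderiv ℝ φ z (0, 1)‖ ≤ C :=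
    (hcs.fderiv_apply (𝕜 := ℝ) (0, 1)).exists_bound_of_continuous hd
  have hφb : ∃ C, ∀ z, ‖φ z‖ ≤ C := hcs.exists_bound_of_continuous hsm.continuous
  have hi : ∀ (c : Vec n × ℝ → ℝ) (k : Vec n × ℝ → Vec N), Continuous c → (∃ C, ∀ z, ‖c z‖ ≤ C) →
      MemLp k (ENNReal.ofReal r) ((volume.restrict Ω).prod (volume.restrict (Ioc 0 T))) →
      Integrable (fun z => c z • k z) ((volume.restrict Ω).prod (volume.restrict (Ioc 0 T))) := by
    rintro c k hc ⟨C, hC⟩ hk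
    exact (hk.integrable hr').bdd_smul C hc.aestronglyMeasurable (ae_of_all _ hC)
  rw [integral_prod _ (hi _ _ hd hdb hmL), integral_prod _ (hi _ _ hsm.continuous hφb hdL),
    ← integral_neg]
  refine integral_congr_ae ?_
  have hvan : ∀ (x : Vec n) (t : ℝ), t ∉ Ioo 0 T → φ (x, t) = 0 := fun x t ht =>
    image_eq_zero_of_notMem_tsupport fun h => ht (hsupp h).2
  filter_upwards [ae_integrableOn_slice_of_memLp hr' hgL] with x hx
  refine integral_deriv_smul_mollify (φ := fun t => φ (x, t)) (fun t => ?_) (by fun_prop)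
    (hvan x 0 (by simp)) (hvan x T (by simp)) hT.le hx
  have h1 : HasDerivAt (fun t : ℝ => (x, t)) ((0 : Vec n), (1 : ℝ)) t :=
    (hasDerivAt_const t x).prodMk (hasDerivAt_id t)
  exact ((hsm.differentiable (by simp)).differentiableAt.hasFDerivAt).comp_hasDerivAt t h1

end

/-! ### Test functions and `W₀^{1,p}` -/

section

variable {n N : ℕ} {Ω : Set (Vec n)} {T lam p q : ℝ}

theorem IsTestFunction.zero {G F : Type*} [NormedAddCommGroup G] [NormedSpace ℝ G]
    [NormedAddCommGroup F] [NormedSpace ℝ F] {U : Set G} : IsTestFunction U (0 : G → F) :=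
  ⟨contDiff_const, HasCompactSupport.zero, by simp [tsupport]⟩

theorem IsTestFunction.add {G F : Type*} [NormedAddCommGroup G] [NormedSpace ℝ G]
    [NormedAddCommGroup F] [NormedSpace ℝ F] {U : Set G} {φ ψ : G → F} (hφ : IsTestFunction U φ)
    (hψ : IsTestFunction U ψ) : IsTestFunction U (φ + ψ) :=
  ⟨hφ.1.add hψ.1, hφ.2.1.add hψ.2.1, (tsupport_add φ ψ).trans (union_subset hφ.2.2 hψ.2.2)⟩

theorem IsTestFunction.const_smul {G F : Type*} [NormedAddCommGroup G] [NormedSpace ℝ G]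
    [NormedAddCommGroup F] [NormedSpace ℝ F] {U : Set G} {φ : G → F} (c : ℝ)
    (hφ : IsTestFunction U φ) : IsTestFunction U (c • φ) :=
  ⟨hφ.1.const_smul c, hφ.2.1.smul_left (f := fun _ => c),
    (closure_mono (Function.support_const_smul_subset c φ)).trans hφ.2.2⟩

theorem IsTestFunction.mono {G F : Type*} [NormedAddCommGroup G] [NormedSpace ℝ G]
    [NormedAddCommGroup F] [NormedSpace ℝ F] {U V : Set G} {φ : G → F}
    (hφ : IsTestFunction U φ) (hUV : U ⊆ V) : IsTestFunction V φ :=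
  ⟨hφ.1, hφ.2.1, hφ.2.2.trans hUV⟩

theorem IsTestFunction.differentiable {G F : Type*} [NormedAddCommGroup G] [NormedSpace ℝ G]
    [NormedAddCommGroup F] [NormedSpace ℝ F] {U : Set G} {φ : G → F}
    (hφ : IsTestFunction U φ) : Differentiable ℝ φ := hφ.1.differentiable (by simp)

theorem classicalGrad_zero : classicalGrad (0 : Vec n → Vec N) = 0 := by
  ext x ij
  simp [classicalGrad]

theorem classicalGrad_add {φ ψ : Vec n → Vec N} (hφ : Differentiable ℝ φ)
    (hψ : Differentiable ℝ ψ) : classicalGrad (φ + ψ) = classicalGrad φ + classicalGrad ψ := by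
  ext x ij
  simp [classicalGrad, fderiv_add (hφ x) (hψ x)]

theorem classicalGrad_const_smul {φ : Vec n → Vec N} (c : ℝ) (hφ : Differentiable ℝ φ) :
    classicalGrad (c • φ) = c • classicalGrad φ := by
  ext x ij
  simp [classicalGrad, fderiv_const_smul (hφ x) c]

theorem continuous_classicalGrad {φ : Vec n → Vec N} (hφ : ContDiff ℝ ∞ φ) :
    Continuous (classicalGrad φ) := by
  refine (PiLp.continuous_toLp 2 _).comp (continuous_pi fun ij => ?_)
  exact (EuclideanSpace.proj ij.1).continuous.comp
    ((hφ.continuous_fderiv (by simp)).clm_apply continuous_const)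

theorem hasCompactSupport_classicalGrad {φ : Vec n → Vec N} (hφ : HasCompactSupport φ) :
    HasCompactSupport (classicalGrad φ) := by
  refine (hφ.fderiv ℝ).mono fun x hx => ?_
  contrapose! hx
  have h0 : fderiv ℝ φ x = 0 := by simpa using hx
  have : classicalGrad φ x = 0 := by ext ij; simp [classicalGrad, h0]
  simpa using this

theorem IsTestFunction.memLp {U : Set (Vec n)} {φ : Vec n → Vec N} (hφ : IsTestFunction U φ)
    (r : ℝ≥0∞) : MemLp φ r (volume.restrict Ω) :=
  (hφ.1.continuous.memLp_of_hasCompactSupport hφ.2.1).restrict Ω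

theorem IsTestFunction.memLp_grad {U : Set (Vec n)} {φ : Vec n → Vec N} (hφ : IsTestFunction U φ)
    (r : ℝ≥0∞) : MemLp (classicalGrad φ) r (volume.restrict Ω) :=
  ((continuous_classicalGrad hφ.1).memLp_of_hasCompactSupport
    (hasCompactSupport_classicalGrad hφ.2.1)).restrict Ω

theorem classicalGrad_eq_zero {U : Set (Vec n)} {φ : Vec n → Vec N} (hφ : IsTestFunction U φ)
    {x : Vec n} (hx : x ∉ U) : classicalGrad φ x = 0 := by
  have h1 : x ∉ tsupport φ := fun h => hx (hφ.2.2 h)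
  have h2 : fderiv ℝ φ x = 0 := by
    by_contra h
    exact h1 (support_fderiv_subset ℝ h)
  ext ij
  simp [classicalGrad, h2]

theorem IsTestFunction.eq_zero {U : Set (Vec n)} {φ : Vec n → Vec N} (hφ : IsTestFunction U φ)
    {x : Vec n} (hx : x ∉ U) : φ x = 0 :=
  image_eq_zero_of_notMem_tsupport fun h => hx (hφ.2.2 h)

/-- The pairs `(φ, Dφ)`, `φ ∈ C₀^∞(Ω, ℝᴺ)`, as a subspace of `L^p × L^p`. Its closure is
`W₀^{1,p}(Ω, ℝᴺ)`. -/
def testSubmodule (N : ℕ) (Ω : Set (Vec n)) (p : ℝ) [Fact (1 ≤ ENNReal.ofReal p)] :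
    Submodule ℝ (Lp (Vec N) (ENNReal.ofReal p) (volume.restrict Ω) ×
      Lp (Mat N n) (ENNReal.ofReal p) (volume.restrict Ω)) where
  carrier := {y | ∃ φ : Vec n → Vec N, IsTestFunction Ω φ ∧ y.1 =ᵐ[volume.restrict Ω] φ ∧
    y.2 =ᵐ[volume.restrict Ω] classicalGrad φ}
  zero_mem' := ⟨0, .zero, Lp.coeFn_zero _ _ _, by
    rw [classicalGrad_zero]; exact Lp.coeFn_zero _ _ _⟩
  add_mem' := by
    rintro y z ⟨φ, hφ, h1, h2⟩ ⟨ψ, hψ, h3, h4⟩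
    refine ⟨φ + ψ, hφ.add hψ, (Lp.coeFn_add _ _).trans (h1.add h3), ?_⟩
    rw [classicalGrad_add hφ.differentiable hψ.differentiable]
    exact (Lp.coeFn_add _ _).trans (h2.add h4)
  smul_mem' := by
    rintro c y ⟨φ, hφ, h1, h2⟩
    refine ⟨c • φ, hφ.const_smul c, (Lp.coeFn_smul _ _).trans (h1.const_smul c), ?_⟩
    rw [classicalGrad_const_smul c hφ.differentiable]
    exact (Lp.coeFn_smul _ _).trans (h2.const_smul c)

variable [Fact (1 ≤ ENNReal.ofReal p)]

/-- Membership in `W₀^{1,p}` is membership of the pair `(w, Dw)` in a closed subspace. -/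
theorem memW1pZero_iff {w : Vec n → Vec N} {Dw : Vec n → Mat N n}
    {y : Lp (Vec N) (ENNReal.ofReal p) (volume.restrict Ω) ×
      Lp (Mat N n) (ENNReal.ofReal p) (volume.restrict Ω)}
    (h1 : y.1 =ᵐ[volume.restrict Ω] w) (h2 : y.2 =ᵐ[volume.restrict Ω] Dw) :
    MemW1pZero Ω p w Dw ↔ y ∈ (testSubmodule N Ω p).topologicalClosure := by
  rw [← SetLike.mem_coe, Submodule.topologicalClosure_coe, EMetric.mem_closure_iff]
  constructor
  · rintro ⟨hw, hDw, happ⟩ ε hε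
    obtain ⟨φ, hφ, h3, h4⟩ := happ ε hε
    refine ⟨((hφ.memLp _).toLp, (hφ.memLp_grad _).toLp), ⟨φ, hφ, (hφ.memLp _).coeFn_toLp,
      (hφ.memLp_grad _).coeFn_toLp⟩, ?_⟩
    rw [Prod.edist_eq, max_lt_iff, Lp.edist_def, Lp.edist_def,
      eLpNorm_congr_ae (h1.sub (hφ.memLp _).coeFn_toLp),
      eLpNorm_congr_ae (h2.sub (hφ.memLp_grad _).coeFn_toLp)]
    exact ⟨h3, h4⟩
  · intro h
    refine ⟨(memLp_congr_ae h1).1 (Lp.memLp _), (memLp_congr_ae h2).1 (Lp.memLp _),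
      fun ε hε => ?_⟩
    obtain ⟨z, ⟨φ, hφ, h3, h4⟩, hd⟩ := h ε hε
    rw [Prod.edist_eq, max_lt_iff, Lp.edist_def, Lp.edist_def,
      eLpNorm_congr_ae (h1.sub h3), eLpNorm_congr_ae (h2.sub h4)] at hd
    exact ⟨φ, hφ, hd⟩

theorem MemW1pZero.congr {w w' : Vec n → Vec N} {Dw Dw' : Vec n → Mat N n}
    (h : MemW1pZero Ω p w Dw) (h1 : w =ᵐ[volume.restrict Ω] w')
    (h2 : Dw =ᵐ[volume.restrict Ω] Dw') : MemW1pZero Ω p w' Dw' := by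
  have e1 := h.memLp.coeFn_toLp
  have e2 := h.grad_memLp.coeFn_toLp
  exact (memW1pZero_iff (y := (h.memLp.toLp, h.grad_memLp.toLp)) (e1.trans h1) (e2.trans h2)).2
    ((memW1pZero_iff e1 e2).1 h)

theorem IsTestFunction.memW1pZero {φ : Vec n → Vec N} (hφ : IsTestFunction Ω φ) :
    MemW1pZero Ω p φ (classicalGrad φ) :=
  ⟨hφ.memLp _, hφ.memLp_grad _, fun ε hε => ⟨φ, hφ, by simpa using hε, by simpa using hε⟩⟩

/-- Integration by parts in `W₀^{1,p}`, with a test function. Both sides are continuous in the pair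
`(w, Dw)`, so the classical formula for `C₀^∞` passes to the closure. -/
theorem MemW1pZero.integral_smul_grad [IsFiniteMeasure (volume.restrict Ω)]
    {w : Vec n → Vec N} {Dw : Vec n → Mat N n} (h : MemW1pZero Ω p w Dw)
    {η : Vec n → ℝ} (hη : IsTestFunction Ω η) (ij : Fin N × Fin n) :
    (∫ x in Ω, η x • Dw x) ij +
      (∫ x in Ω, fderiv ℝ η x (EuclideanSpace.single ij.2 1) • w x) ij.1 = 0 := by
  have hηc := hη.1.continuous
  have hd : Continuous fun x => fderiv ℝ η x (EuclideanSpace.single ij.2 1) :=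
    (hη.1.continuous_fderiv (by simp)).clm_apply continuous_const
  obtain ⟨C, hC⟩ := hη.2.1.exists_bound_of_continuous hηc
  obtain ⟨C', hC'⟩ := (hη.2.1.fderiv_apply (𝕜 := ℝ)
    (EuclideanSpace.single ij.2 1)).exists_bound_of_continuous hd
  let L1 := weightedIntegralLp (F := Mat N n) (ENNReal.ofReal p) (volume.restrict Ω)
    hηc.aestronglyMeasurable hC
  let L2 := weightedIntegralLp (F := Vec N) (ENNReal.ofReal p) (volume.restrict Ω)
    hd.aestronglyMeasurable hC'
  let L : Lp (Vec N) (ENNReal.ofReal p) (volume.restrict Ω) ×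
      Lp (Mat N n) (ENNReal.ofReal p) (volume.restrict Ω) → ℝ := fun y => L1 y.2 ij + L2 y.1 ij.1
  have hLc : Continuous L :=
    ((EuclideanSpace.proj (𝕜 := ℝ) ij).continuous.comp (L1.continuous.comp continuous_snd)).add
      ((EuclideanSpace.proj (𝕜 := ℝ) ij.1).continuous.comp (L2.continuous.comp continuous_fst))
  have hval : ∀ (y : Lp (Vec N) (ENNReal.ofReal p) (volume.restrict Ω) ×
      Lp (Mat N n) (ENNReal.ofReal p) (volume.restrict Ω)) (v : Vec n → Vec N)
      (Dv : Vec n → Mat N n), y.1 =ᵐ[volume.restrict Ω] v → y.2 =ᵐ[volume.restrict Ω] Dv →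
      L y = (∫ x in Ω, η x • Dv x) ij +
        (∫ x in Ω, fderiv ℝ η x (EuclideanSpace.single ij.2 1) • v x) ij.1 := by
    intro y v Dv h1 h2
    have e1 : L1 y.2 = ∫ x in Ω, η x • Dv x :=
      integral_congr_ae (h2.mono fun x hx => by simp only [hx])
    have e2 : L2 y.1 = ∫ x in Ω, fderiv ℝ η x (EuclideanSpace.single ij.2 1) • v x :=
      integral_congr_ae (h1.mono fun x hx => by simp only [hx])
    simp only [L, e1, e2]
  have hzero : (testSubmodule N Ω p : Set _) ⊆ {y | L y = 0} := by
    rintro y ⟨φ, hφ, h1, h2⟩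
    rw [mem_ofPred_eq, hval y φ _ h1 h2]
    have i1 : Integrable (fun x => η x • classicalGrad φ x) :=
      (hηc.smul (continuous_classicalGrad hφ.1)).integrable_of_hasCompactSupport hη.2.1.smul_right
    have i2 : Integrable (fun x => fderiv ℝ η x (EuclideanSpace.single ij.2 1) • φ x) :=
      (hd.smul hφ.1.continuous).integrable_of_hasCompactSupport
        (hη.2.1.fderiv_apply (𝕜 := ℝ) _).smul_right
    have s1 : ∫ x in Ω, η x • classicalGrad φ x = ∫ x, η x • classicalGrad φ x :=
      setIntegral_eq_integral_of_forall_compl_eq_zero fun x hx => by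
        rw [image_eq_zero_of_notMem_tsupport fun h => hx (hη.2.2 h), zero_smul]
    have s2 : ∫ x in Ω, fderiv ℝ η x (EuclideanSpace.single ij.2 1) • φ x =
        ∫ x, fderiv ℝ η x (EuclideanSpace.single ij.2 1) • φ x :=
      setIntegral_eq_integral_of_forall_compl_eq_zero fun x hx => by
        rw [hφ.eq_zero hx, smul_zero]
    have c1 := (EuclideanSpace.proj (𝕜 := ℝ) ij).integral_comp_comm i1
    have c2 := (EuclideanSpace.proj (𝕜 := ℝ) ij.1).integral_comp_comm i2
    simp only [PiLp.proj_apply] at c1 c2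
    rw [s1, s2, ← c1, ← c2]
    have hg : ∀ x, classicalGrad φ x ij =
        fderiv ℝ (fun x => φ x ij.1) x (EuclideanSpace.single ij.2 1) := by
      intro x
      have := ((EuclideanSpace.proj (𝕜 := ℝ) ij.1).hasFDerivAt.comp x
        (hφ.differentiable x).hasFDerivAt).fderiv
      simp only [Function.comp_def, PiLp.proj_apply] at this
      rw [this]; rfl
    have hφi : ContDiff ℝ ∞ fun x => φ x ij.1 :=
      (EuclideanSpace.proj (𝕜 := ℝ) ij.1).contDiff.comp hφ.1
    have hφc : Continuous fun x => fderiv ℝ (fun x => φ x ij.1) x (EuclideanSpace.single ij.2 1) :=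
      (hφi.continuous_fderiv (by simp)).clm_apply continuous_const
    have hparts := integral_mul_fderiv_eq_neg_fderiv_mul_of_integrable (μ := volume) (f := η)
      (g := fun x => φ x ij.1) (v := EuclideanSpace.single ij.2 1)
      ((hd.mul hφi.continuous).integrable_of_hasCompactSupport
        (hη.2.1.fderiv_apply (𝕜 := ℝ) _).mul_right)
      ((hηc.mul hφc).integrable_of_hasCompactSupport hη.2.1.mul_right)
      ((hηc.mul hφi.continuous).integrable_of_hasCompactSupport hη.2.1.mul_right)
      (fun x _ => hη.differentiable x) (fun x _ => hφi.differentiable (by simp) x)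
    simp only [PiLp.smul_apply, smul_eq_mul, hg]
    rw [hparts]; ring
  have hcl : (testSubmodule N Ω p : Set _) ⊆ {y | L y = 0} →
      ((testSubmodule N Ω p).topologicalClosure : Set _) ⊆ {y | L y = 0} := fun hs => by
    rw [Submodule.topologicalClosure_coe]
    exact closure_minimal hs (isClosed_eq hLc continuous_const)
  have e1 := h.memLp.coeFn_toLp
  have e2 := h.grad_memLp.coeFn_toLp
  rw [← hval (h.memLp.toLp, h.grad_memLp.toLp) w Dw e1 e2]
  exact hcl hzero ((memW1pZero_iff e1 e2).1 h)

/-- The weak gradient vanishes on every open set on which the function vanishes. -/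
theorem MemW1pZero.grad_eq_zero [IsFiniteMeasure (volume.restrict Ω)]
    {w : Vec n → Vec N} {Dw : Vec n → Mat N n} (h : MemW1pZero Ω p w Dw) {U : Set (Vec n)}
    (hU : IsOpen U) (hUΩ : U ⊆ Ω) (hw : ∀ᵐ x ∂volume.restrict U, w x = 0) :
    ∀ᵐ x ∂volume.restrict U, Dw x = 0 := by
  have hi : Integrable Dw (volume.restrict Ω) := h.grad_memLp.integrable Fact.out
  rw [ae_restrict_iff' hU.measurableSet] at hw ⊢
  refine hU.ae_eq_zero_of_integral_contDiff_smul_eq_zero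
    (IntegrableOn.locallyIntegrableOn (hi.mono_measure (Measure.restrict_mono hUΩ le_rfl)))
    fun η hη hηc hηU => ?_
  have ht : IsTestFunction Ω η := ⟨hη, hηc, hηU.trans hUΩ⟩
  rw [← setIntegral_eq_integral_of_forall_compl_eq_zero (s := Ω) fun x hx => by
    rw [image_eq_zero_of_notMem_tsupport fun h => hx (ht.2.2 h), zero_smul]]
  ext ij
  have h1 := h.integral_smul_grad ht ij
  have h2 : ∫ x in Ω, fderiv ℝ η x (EuclideanSpace.single ij.2 1) • w x = 0 := by
    refine integral_eq_zero_of_ae (ae_restrict_of_ae ?_)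
    filter_upwards [hw] with x hx
    by_cases hxU : x ∈ U
    · simp [hx hxU]
    · have : fderiv ℝ η x = 0 := by
        by_contra h
        exact hxU (hηU (support_fderiv_subset ℝ h))
      simp [this]
  rw [h2] at h1
  simpa using h1

end

/-! ### Mollification of Sobolev-valued maps and continuity in time -/

section

theorem mollify_add_left {α F : Type*} [NormedAddCommGroup F] [NormedSpace ℝ F] [CompleteSpace F]
    {lam t : ℝ} (hlam : 0 < lam) (ht : 0 ≤ t) {a b : α → F} {g : α × ℝ → F} {x : α}
    (hg : IntegrableOn (fun s => g (x, s)) (Ioc 0 t)) :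
    mollify lam (b + a) (fun z => b z.1 + g z) (x, t) = b x + mollify lam a g (x, t) := by
  have := isProbabilityMeasure_expKernel hlam ht
  have h1 : IntegrableOn (fun s => b x + g (x, s)) (Ioc 0 t) :=
    (integrableOn_const (by simp)).add hg
  rw [mollify_eq_integral hlam hg, mollify_eq_integral hlam h1]
  have h2 : ∀ s, extendPast (b + a) (fun z => b z.1 + g z) (x, s) =
      b x + extendPast a g (x, s) := by
    intro s
    unfold extendPast
    split_ifs <;> simp
  simp_rw [h2]
  rw [integral_add (integrable_const _) (integrable_extendPast hg)]
  simp

theorem mollify_eq_const {α F : Type*} [NormedAddCommGroup F] [NormedSpace ℝ F] [CompleteSpace F]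
    {lam t : ℝ} (hlam : 0 < lam) (ht : 0 ≤ t) {a : α → F} {g : α × ℝ → F} {x : α} {c : F}
    (ha : a x = c) (hg : ∀ᵐ s ∂volume.restrict (Ioc 0 t), g (x, s) = c) :
    mollify lam a g (x, t) = c := by
  have := isProbabilityMeasure_expKernel hlam ht
  have h1 : IntegrableOn (fun s => g (x, s)) (Ioc 0 t) :=
    (integrable_const c).congr (hg.mono fun s hs => hs.symm)
  rw [mollify_eq_integral hlam h1, integral_congr_ae (g := fun _ => c)]
  · simp
  · refine ae_expKernel (by simp [extendPast_zero, ha]) ?_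
    filter_upwards [hg, ae_restrict_mem measurableSet_Ioc] with s hs hs0
    rw [extendPast_of_pos hs0.1, hs]

theorem one_le_ofReal {r : ℝ} (hr : 1 ≤ r) : 1 ≤ ENNReal.ofReal r := by
  simpa using ENNReal.ofReal_le_ofReal hr

theorem restrict_Ioo_eq_Ioc (T : ℝ) :
    (volume.restrict (Ioo 0 T) : Measure ℝ) = volume.restrict (Ioc 0 T) :=
  Measure.restrict_congr_set Ioo_ae_eq_Ioc

variable {n N : ℕ} {Ω : Set (Vec n)} {T lam p q t : ℝ}

/-- A mean of elements of the closed subspace `W₀^{1,p}` lies in `W₀^{1,p}`. -/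
theorem memW1pZero_mollify [IsFiniteMeasure (volume.restrict Ω)] (hp : 1 ≤ p) (hlam : 0 < lam)
    (ht : t ∈ Icc 0 T) {φ : Vec n → Vec N} (hφ : IsTestFunction Ω φ)
    {h : Vec n × ℝ → Vec N} {H : Vec n × ℝ → Mat N n} (hh : StronglyMeasurable h)
    (hH : StronglyMeasurable H)
    (hhL : MemLp h (ENNReal.ofReal p) ((volume.restrict Ω).prod (volume.restrict (Ioc 0 T))))
    (hHL : MemLp H (ENNReal.ofReal p) ((volume.restrict Ω).prod (volume.restrict (Ioc 0 T))))
    (hW : ∀ᵐ s ∂volume.restrict (Ioc 0 T), MemW1pZero Ω p (slice h s) (slice H s)) :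
    MemW1pZero Ω p (slice (mollify lam φ h) t) (slice (mollify lam (classicalGrad φ) H) t) := by
  have hp' := one_le_ofReal hp
  have : Fact (1 ≤ ENNReal.ofReal p) := ⟨hp'⟩
  have hpt : ENNReal.ofReal p ≠ ⊤ := ENNReal.ofReal_ne_top
  have := isProbabilityMeasure_expKernel hlam ht.1
  have hφm := hφ.1.continuous.stronglyMeasurable
  have hφm' := (continuous_classicalGrad hφ.1).stronglyMeasurable
  have e1 := memLp_extendPast hlam ht hp hφm hh (hφ.memLp (Ω := Ω) _) hhL
  have e2 := memLp_extendPast hlam ht hp hφm' hH (hφ.memLp_grad (Ω := Ω) _) hHL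
  have i1 := integrable_sliceLp hpt e1
  have i2 := integrable_sliceLp hpt e2
  have hmem : (∫ s, (sliceLp (ENNReal.ofReal p) (volume.restrict Ω) (extendPast φ h) s,
      sliceLp (ENNReal.ofReal p) (volume.restrict Ω) (extendPast (classicalGrad φ) H) s)
      ∂expKernel lam t) ∈ ((testSubmodule N Ω p).topologicalClosure : Set _) := by
    refine (Submodule.convex _).integral_mem (Submodule.isClosed_topologicalClosure _) ?_
      (i1.prodMk i2)
    have key : ∀ s, MemW1pZero Ω p (fun x => extendPast φ h (x, s))
        (fun x => extendPast (classicalGrad φ) H (x, s)) →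
        (sliceLp (ENNReal.ofReal p) (volume.restrict Ω) (extendPast φ h) s,
        sliceLp (ENNReal.ofReal p) (volume.restrict Ω) (extendPast (classicalGrad φ) H) s) ∈
        ((testSubmodule N Ω p).topologicalClosure : Set _) := fun s hs =>
      (memW1pZero_iff (sliceLp_coeFn hs.memLp) (sliceLp_coeFn hs.grad_memLp)).1 hs
    refine ae_expKernel (key 0 ?_) ?_
    · simp only [extendPast_zero]
      exact hφ.memW1pZero
    · filter_upwards [ae_restrict_of_ae_restrict_of_subset (Ioc_subset_Ioc_right ht.2) hW,
        ae_restrict_mem measurableSet_Ioc] with s hs hs0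
      refine key s ?_
      simp only [extendPast_of_pos hs0.1]
      exact hs
  refine (memW1pZero_iff ?_ ?_).2 hmem
  · rw [fst_integral (i1.prodMk i2)]
    filter_upwards [integral_sliceLp_coeFn hpt e1, ae_integrableOn_slice_of_memLp hp' hhL] with x
      hx hx'
    rw [hx, slice, mollify_eq_integral hlam (hx'.mono_set (Ioc_subset_Ioc_right ht.2))]
  · rw [snd_integral (i1.prodMk i2)]
    filter_upwards [integral_sliceLp_coeFn hpt e2, ae_integrableOn_slice_of_memLp hp' hHL] with x
      hx hx'
    rw [hx, slice, mollify_eq_integral hlam (hx'.mono_set (Ioc_subset_Ioc_right ht.2))]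

theorem continuousInLp_mollify [IsFiniteMeasure (volume.restrict Ω)] {r : ℝ} (hr : 1 ≤ r)
    {a : Vec n → Vec N} {g : Vec n × ℝ → Vec N}
    (haL : MemLp a (ENNReal.ofReal r) (volume.restrict Ω))
    (hgL : MemLp g (ENNReal.ofReal r) (volume.restrict (cylinder Ω T))) :
    ContinuousInLp Ω r (Icc 0 T) (mollify lam a g) := by
  have : Fact (1 ≤ ENNReal.ofReal r) := ⟨one_le_ofReal hr⟩
  rw [volume_restrict_cylinder] at hgL
  obtain ⟨V, hV, hVm⟩ := exists_continuousOn_mollify (lam := lam) haL hgL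
  refine ⟨fun t ht => (memLp_congr_ae (hVm t ht)).1 (Lp.memLp _), fun t ht => ?_⟩
  have h1 := tendsto_iff_edist_tendsto_0.1 (hV t ht)
  refine h1.congr' ?_
  filter_upwards [self_mem_nhdsWithin] with s hs
  rw [Lp.edist_def]
  exact eLpNorm_congr_ae ((hVm s hs).sub (hVm t ht))

theorem ContinuousInLp.mono {r : ℝ} {I J : Set ℝ} {v : Vec n × ℝ → Vec N}
    (h : ContinuousInLp Ω r J v) (hIJ : I ⊆ J) : ContinuousInLp Ω r I v :=
  ⟨fun t ht => h.1 t (hIJ ht), fun t ht => (h.2 t (hIJ ht)).mono_left (nhdsWithin_mono _ hIJ)⟩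

variable {E : Set (Vec n × ℝ)}

theorem IsRelativelyOpen.measurableSet (hE : IsRelativelyOpen Ω T E) (hΩ : IsOpen Ω) :
    MeasurableSet E := by
  obtain ⟨O, hO, rfl⟩ := hE
  exact hO.measurableSet.inter (hΩ.measurableSet.prod measurableSet_Ico)

theorem IsRelativelyOpen.timeSlice_zero (hE : IsRelativelyOpen Ω T E) (hΩ : IsOpen Ω)
    (hT : 0 < T) : IsOpen (timeSlice E 0) ∧ timeSlice E 0 ⊆ Ω := by
  obtain ⟨O, hO, rfl⟩ := hE
  have : timeSlice (O ∩ cylinder Ω T) 0 = (fun x => (x, (0 : ℝ))) ⁻¹' O ∩ Ω := by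
    ext x; simp [timeSlice, cylinder, hT]
  rw [this]
  exact ⟨(hO.preimage (by fun_prop)).inter hΩ, inter_subset_right⟩

/-- Equality with a time-independent function on almost all slices of the complement of `E`, as a
statement on space-time. -/
theorem ae_eq_of_slice_eq_outside {F : Type*} [NormedAddCommGroup F] (hE : MeasurableSet E)
    (hΩ : MeasurableSet Ω)
    {v : Vec n × ℝ → F} {b : Vec n → F} (hv : StronglyMeasurable v) (hb : StronglyMeasurable b)
    (h : ∀ᵐ s ∂volume.restrict (Ioc 0 T),
      slice v s =ᵐ[volume.restrict (Ω \ timeSlice E s)] b) :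
    ∀ᵐ z ∂(volume.restrict Ω).prod (volume.restrict (Ioc 0 T)), z ∉ E → v z = b z.1 := by
  have hEs : ∀ s, MeasurableSet (timeSlice E s) := fun s => measurable_prodMk_right hE
  refine ae_prod_of_ae_ae_slice ?_ ?_
  · have hm := hE.compl.imp
      (hv.sub (hb.comp_measurable measurable_fst)).measurableSet_support.compl
    convert hm using 1
    ext z
    simp [sub_eq_zero]
  · filter_upwards [h] with s hs
    rw [Filter.EventuallyEq, ae_restrict_iff' (hΩ.diff (hEs s))] at hs
    rw [ae_restrict_iff' hΩ]
    filter_upwards [hs] with x hx hxΩ hxE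
    exact hx ⟨hxΩ, hxE⟩

end

/-! ### Admissibility of the mollification -/

section

variable {n N : ℕ} {Ω : Set (Vec n)} {T lam p q : ℝ} {E : Set (Vec n × ℝ)}
  {ustar : Vec n → Vec N} {Dustar : Vec n → Mat N n}
  {u : Vec n × ℝ → Vec N} {Du : Vec n × ℝ → Mat N n}

theorem MemVpq.ae_eq_outside (hV : MemVpq Ω T E p q ustar Dustar u Du) (hE : MeasurableSet E)
    (hΩ : MeasurableSet Ω) (hu : StronglyMeasurable u) (hs : StronglyMeasurable ustar) :
    ∀ᵐ z ∂(volume.restrict Ω).prod (volume.restrict (Ioc 0 T)), z ∉ E → u z = ustar z.1 :=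
  ae_eq_of_slice_eq_outside hE hΩ hu hs (by rw [← restrict_Ioo_eq_Ioc]; exact hV.eq_outside)

/-- Outside `E` also the gradients agree: since `∂E` is a null set, almost every point of the
complement of `E` is interior to it, and there the gradient of `u(t) - u_*` vanishes. -/
theorem MemVpq.grad_ae_eq_outside (hV : MemVpq Ω T E p q ustar Dustar u Du) (hp : 1 ≤ p)
    (hΩ : IsOpen Ω) [IsFiniteMeasure (volume.restrict Ω)]
    (hE0 : volume (frontier E) = 0) (hDu : StronglyMeasurable Du)
    (hDs : StronglyMeasurable Dustar) :
    ∀ᵐ z ∂(volume.restrict Ω).prod (volume.restrict (Ioc 0 T)), z ∉ E → Du z = Dustar z.1 := by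
  have : Fact (1 ≤ ENNReal.ofReal p) := ⟨one_le_ofReal hp⟩
  have h1 : ∀ᵐ z ∂(volume.restrict Ω).prod (volume.restrict (Ioc 0 T)), z ∉ frontier E := by
    rw [← volume_restrict_cylinder]
    exact ae_restrict_of_ae (measure_eq_zero_iff_ae_notMem.1 hE0)
  have h2 : ∀ᵐ z ∂(volume.restrict Ω).prod (volume.restrict (Ioc 0 T)),
      z ∉ closure E → Du z = Dustar z.1 := by
    refine ae_eq_of_slice_eq_outside isClosed_closure.measurableSet hΩ.measurableSet hDu hDs ?_
    have hb := hV.boundary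
    have ho := hV.eq_outside
    rw [restrict_Ioo_eq_Ioc] at hb ho
    filter_upwards [hb, ho] with s hs hs'
    have hU : IsOpen (Ω \ timeSlice (closure E) s) := by
      rw [sdiff_eq]
      exact hΩ.inter ((isClosed_closure.preimage (by fun_prop : Continuous fun x : Vec n =>
        (x, s))).isOpen_compl)
    have hsub : Ω \ timeSlice (closure E) s ⊆ Ω \ timeSlice E s :=
      sdiff_subset_sdiff_right fun x hx => subset_closure hx
    have h3 := hs.grad_eq_zero hU sdiff_subset
      ((ae_restrict_of_ae_restrict_of_subset hsub hs').mono fun x hx => by simp [hx])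
    exact h3.mono fun x hx => sub_eq_zero.1 hx
  filter_upwards [h1, h2] with z hz1 hz2 hz
  refine hz2 fun hc => hz1 ⟨hc, fun hi => hz (interior_subset hi)⟩

/-- Since the slices of `E` are nondecreasing, the mollification only averages over times at which
the point is outside `E`. -/
theorem ae_mollify_eq_outside {F : Type*} [NormedAddCommGroup F] [NormedSpace ℝ F]
    [CompleteSpace F] (hlam : 0 < lam) [IsFiniteMeasure (volume.restrict Ω)]
    (hEmono : IsNondecreasing T E) {v : Vec n × ℝ → F} {b ψ : Vec n → F}
    (hψ : ∀ x, x ∉ timeSlice E 0 → ψ x = 0)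
    (h : ∀ᵐ z ∂(volume.restrict Ω).prod (volume.restrict (Ioc 0 T)), z ∉ E → v z = b z.1) :
    ∀ᵐ x ∂volume.restrict Ω, ∀ t ∈ Ico 0 T, (x, t) ∉ E → mollify lam (b + ψ) v (x, t) = b x := by
  filter_upwards [Measure.ae_ae_of_ae_prod h] with x hx t ht hxt
  have hxs : ∀ s, 0 ≤ s → s ≤ t → (x, s) ∉ E := fun s h0 hst hxs =>
    hxt (hEmono s t h0 hst ht.2 hxs)
  refine mollify_eq_const hlam ht.1 (by simp [hψ x (hxs 0 le_rfl ht.1)]) ?_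
  filter_upwards [ae_restrict_of_ae_restrict_of_subset (Ioc_subset_Ioc_right ht.2.le) hx,
    ae_restrict_mem measurableSet_Ioc] with s hs hs0
  exact hs (hxs s hs0.1.le hs0.2)

/-- The mollification of `u` is an admissible comparison map, if its initial value differs from
`u_*` by a test function supported in `E^0`. -/
theorem isComparisonMap_mollify (hΩ : IsOpen Ω) [IsFiniteMeasure (volume.restrict Ω)] (hT : 0 < T)
    (hp : 1 ≤ p) (hq : 0 ≤ q) (hlam : 0 < lam) (hE : IsRelativelyOpen Ω T E)
    (hEmono : IsNondecreasing T E) (hV : MemVpq Ω T E p q ustar Dustar u Du)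
    (hu : StronglyMeasurable u) (hDu : StronglyMeasurable Du) (hs : StronglyMeasurable ustar)
    (hDs : StronglyMeasurable Dustar)
    (hsp : MemLp ustar (ENNReal.ofReal p) (volume.restrict Ω))
    (hDsp : MemLp Dustar (ENNReal.ofReal p) (volume.restrict Ω))
    (hsq : MemLp ustar (ENNReal.ofReal (q + 1)) (volume.restrict Ω))
    {φ : Vec n → Vec N} (hφ : IsTestFunction (timeSlice E 0) φ) :
    IsComparisonMap Ω T E p q ustar Dustar (mollify lam (ustar + φ) u)
      (mollify lam (Dustar + classicalGrad φ) Du)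
      (fun z => lam • (u z - mollify lam (ustar + φ) u z)) := by
  have hq1 : 1 ≤ q + 1 := by linarith
  have hp' := one_le_ofReal hp
  have hEm := hE.measurableSet hΩ
  have hφΩ := hφ.mono (hE.timeSlice_zero hΩ hT).2
  have ha : StronglyMeasurable (ustar + φ) := hs.add hφ.1.continuous.stronglyMeasurable
  have hDa : StronglyMeasurable (Dustar + classicalGrad φ) :=
    hDs.add (continuous_classicalGrad hφ.1).stronglyMeasurable
  have huL := hV.memLp
  have hDuL := hV.grad_memLp
  have huq := hV.memLq
  rw [volume_restrict_cylinder] at huL hDuL huq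
  refine ⟨⟨?_, ?_, ?_, ?_, ?_⟩, hasWeakTimeDeriv_mollify hq1 hT hlam ha hu
    (hsq.add (hφ.memLp _)) hV.memLq,
    (continuousInLp_mollify hq1 (hsq.add (hφ.memLp _)) hV.memLq).mono Ico_subset_Icc_self⟩
  · rw [volume_restrict_cylinder]
    exact memLp_mollify hlam hp ha hu (hsp.add (hφ.memLp _)) huL
  · rw [volume_restrict_cylinder]
    exact memLp_mollify hlam hp hDa hDu (hDsp.add (hφ.memLp_grad _)) hDuL
  · have hsL : MemLp (fun z : Vec n × ℝ => ustar z.1) (ENNReal.ofReal p)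
        ((volume.restrict Ω).prod (volume.restrict (Ioc 0 T))) := hsp.comp_fst _
    have hDsL : MemLp (fun z : Vec n × ℝ => Dustar z.1) (ENNReal.ofReal p)
        ((volume.restrict Ω).prod (volume.restrict (Ioc 0 T))) := hDsp.comp_fst _
    have hb := hV.boundary
    rw [restrict_Ioo_eq_Ioc] at hb
    filter_upwards [ae_restrict_mem measurableSet_Ioo] with t ht
    have hW := memW1pZero_mollify (lam := lam) hp hlam (Ioo_subset_Icc_self ht) hφΩ
      (hu.sub (hs.comp_measurable measurable_fst)) (hDu.sub (hDs.comp_measurable measurable_fst))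
      (huL.sub hsL) (hDuL.sub hDsL) hb
    have : Fact (1 ≤ ENNReal.ofReal p) := ⟨hp'⟩
    have hsubI : Ioc 0 t ⊆ Ioc 0 T := Ioc_subset_Ioc_right ht.2.le
    refine hW.congr ?_ ?_
    · filter_upwards [ae_integrableOn_slice_of_memLp hp' (huL.sub hsL)] with x hx
      have h1 := mollify_add_left (a := φ) (b := ustar) hlam ht.1.le (hx.mono_set hsubI)
      simp only [Pi.sub_apply, add_sub_cancel] at h1
      simp only [slice, Pi.sub_apply]
      exact eq_sub_of_add_eq' h1.symm
    · filter_upwards [ae_integrableOn_slice_of_memLp hp' (hDuL.sub hDsL)] with x hx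
      have h1 := mollify_add_left (a := classicalGrad φ) (b := Dustar) hlam ht.1.le
        (hx.mono_set hsubI)
      simp only [Pi.sub_apply, add_sub_cancel] at h1
      simp only [slice, Pi.sub_apply]
      exact eq_sub_of_add_eq' h1.symm
  · have h1 := ae_mollify_eq_outside hlam hEmono (fun x hx => hφ.eq_zero hx)
      (hV.ae_eq_outside hEm hΩ.measurableSet hu hs)
    filter_upwards [ae_restrict_mem measurableSet_Ioo] with t ht
    have hEt : MeasurableSet (timeSlice E t) := measurable_prodMk_right hEm
    refine (ae_restrict_iff' (hΩ.measurableSet.diff hEt)).2 ?_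
    filter_upwards [(ae_restrict_iff' hΩ.measurableSet).1 h1] with x hx hxm
    exact hx hxm.1 t (Ioo_subset_Ico_self ht) hxm.2
  · rw [volume_restrict_cylinder]
    exact memLp_mollify hlam hq1 ha hu (hsq.add (hφ.memLp _)) huq

end

/-! ### Jensen's inequality and the energy of the mollification -/

section

variable {n N : ℕ} {Ω : Set (Vec n)} {T lam p q ν τ : ℝ} {E : Set (Vec n × ℝ)}
  {f F : Vec n → Vec N → Mat N n → ℝ≥0}

/-- A jointly measurable integrand that is convex in `(u, ξ)` for every `x`. -/
structure IsNormalIntegrand (F : Vec n → Vec N → Mat N n → ℝ≥0) : Prop where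
  measurable : Measurable fun z : Vec n × (Vec N × Mat N n) => F z.1 z.2.1 z.2.2
  convex : ∀ x, ConvexOn ℝ univ (fun z : Vec N × Mat N n => (F x z.1 z.2 : ℝ))

theorem continuous_of_convexOn_coe {V : Type*} [NormedAddCommGroup V] [NormedSpace ℝ V]
    [FiniteDimensional ℝ V] {g : V → ℝ≥0} (h : ConvexOn ℝ univ fun z => (g z : ℝ)) :
    Continuous g :=
  NNReal.isEmbedding_coe.continuous_iff.2 h.locallyLipschitz.continuous

/-- After a change on a null set of `x`, a Carathéodory integrand is jointly measurable. Convexity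
gives continuity in `(u, ξ)`, so that a countable dense set of pairs `(u, ξ)` suffices. -/
theorem IsIntegrand.exists_isNormalIntegrand (hf : IsIntegrand Ω p ν f) :
    ∃ F, IsNormalIntegrand F ∧ ∀ᵐ x ∂volume.restrict Ω, ∀ u ξ, F x u ξ = f x u ξ := by
  classical
  let y : ℕ → Vec N × Mat N n := TopologicalSpace.denseSeq _
  have hy : DenseRange y := TopologicalSpace.denseRange_denseSeq _
  have hm : ∀ k, AEMeasurable (fun x => f x (y k).1 (y k).2) (volume.restrict Ω) := fun k => by
    have h1 := (hf.integrable (y k).1 (y k).2).aestronglyMeasurable.aemeasurable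
    simpa using h1.real_toNNReal
  have hgood : ∀ᵐ x ∂volume.restrict Ω,
      ConvexOn ℝ univ (fun z : Vec N × Mat N n => (f x z.1 z.2 : ℝ)) ∧
      ∀ k, f x (y k).1 (y k).2 = (hm k).mk _ x := by
    filter_upwards [hf.convex, ae_all_iff.2 fun k => (hm k).ae_eq_mk] with x h1 h2
    exact ⟨h1, h2⟩
  obtain ⟨B, hBs, hBm, hB0⟩ := exists_measurable_superset_of_null (ae_iff.1 hgood)
  have hB : ∀ x, x ∉ B → ConvexOn ℝ univ (fun z : Vec N × Mat N n => (f x z.1 z.2 : ℝ)) ∧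
      ∀ k, f x (y k).1 (y k).2 = (hm k).mk _ x := fun x hx => by
    by_contra h
    exact hx (hBs h)
  let F : Vec n → Vec N → Mat N n → ℝ≥0 := fun x u ξ => if x ∈ B then 0 else f x u ξ
  have hconv : ∀ x, ConvexOn ℝ univ (fun z : Vec N × Mat N n => (F x z.1 z.2 : ℝ)) := by
    intro x
    by_cases hx : x ∈ B
    · simpa [F, hx] using convexOn_const (0 : ℝ) convex_univ
    · simpa [F, hx] using (hB x hx).1
  have hcont : ∀ x, Continuous fun z : Vec N × Mat N n => F x z.1 z.2 :=
    fun x => continuous_of_convexOn_coe (hconv x)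
  have hmy : ∀ k, Measurable fun x => F x (y k).1 (y k).2 := by
    intro k
    have : (fun x => F x (y k).1 (y k).2) = fun x => if x ∈ B then 0 else (hm k).mk _ x := by
      ext x
      by_cases hx : x ∈ B
      · simp [F, hx]
      · simp [F, hx, (hB x hx).2 k]
    rw [this]
    exact Measurable.ite hBm measurable_const (hm k).measurable_mk
  have hmz : ∀ z : Vec N × Mat N n, Measurable fun x => F x z.1 z.2 := by
    intro z
    obtain ⟨w, hw, hwz⟩ := mem_closure_iff_seq_limit.1 (hy z)
    choose k hk using hw
    refine measurable_of_tendsto_metrizable (f := fun j x => F x (w j).1 (w j).2) (fun j => ?_) ?_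
    · rw [← hk j]; exact hmy (k j)
    · exact tendsto_pi_nhds.2 fun x => ((hcont x).tendsto z).comp hwz
  refine ⟨F, ⟨?_, hconv⟩, ?_⟩
  · exact (measurable_uncurry_of_continuous_of_measurable
      (u := fun (z : Vec N × Mat N n) x => F x z.1 z.2) hcont hmz).comp measurable_swap
  · filter_upwards [measure_eq_zero_iff_ae_notMem.1 hB0] with x hx u ξ
    simp [F, hx]

theorem IsNormalIntegrand.measurable_comp {α : Type*} [MeasurableSpace α]
    (hF : IsNormalIntegrand F) {x : α → Vec n} {v : α → Vec N} {w : α → Mat N n}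
    (hx : Measurable x) (hv : Measurable v) (hw : Measurable w) :
    Measurable fun z => F (x z) (v z) (w z) :=
  hF.measurable.comp (hx.prodMk (hv.prodMk hw))

/-- Jensen's inequality, where the right-hand side may be infinite. -/
theorem IsNormalIntegrand.le_lintegral (hF : IsNormalIntegrand F) {κ : Measure ℝ}
    [IsProbabilityMeasure κ] (x : Vec n) {v : ℝ → Vec N} {w : ℝ → Mat N n} (hv : Integrable v κ)
    (hw : Integrable w κ) :
    (F x (∫ s, v s ∂κ) (∫ s, w s ∂κ) : ℝ≥0∞) ≤ ∫⁻ s, F x (v s) (w s) ∂κ := by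
  have hc := hF.convex x
  have hcont : Continuous fun z : Vec N × Mat N n => (F x z.1 z.2 : ℝ) :=
    hc.locallyLipschitz.continuous
  by_cases htop : ∫⁻ s, F x (v s) (w s) ∂κ = ⊤
  · rw [htop]; exact le_top
  have hvw := hv.prodMk hw
  have hi : Integrable
      ((fun z : Vec N × Mat N n => (F x z.1 z.2 : ℝ)) ∘ fun s => (v s, w s)) κ := by
    refine ⟨hcont.comp_aestronglyMeasurable hvw.1, ?_⟩
    rw [HasFiniteIntegral]
    simpa [Function.comp_def, Real.enorm_eq_ofReal] using lt_top_iff_ne_top.2 htop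
  have hJ := hc.map_integral_le hcont.continuousOn isClosed_univ (ae_of_all _ fun _ => mem_univ _)
    hvw hi
  rw [fst_integral hvw, snd_integral hvw] at hJ
  have h2 := ENNReal.ofReal_le_ofReal hJ
  rw [ENNReal.ofReal_coe_nnreal, ofReal_integral_eq_lintegral_ofReal
    (f := fun s => (F x (v s) (w s) : ℝ)) hi (ae_of_all _ fun s => NNReal.coe_nonneg _)] at h2
  simpa only [ENNReal.ofReal_coe_nnreal] using h2

/-- The energy of the mollification exceeds that of the function at most by `λ⁻¹` times the energy
of the initial value. -/
theorem lintegral_mollify_le [IsFiniteMeasure (volume.restrict Ω)] (hF : IsNormalIntegrand F)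
    (hlam : 0 < lam) {a : Vec n → Vec N} {A : Vec n → Mat N n} {u : Vec n × ℝ → Vec N}
    {Du : Vec n × ℝ → Mat N n} (ha : StronglyMeasurable a) (hA : StronglyMeasurable A)
    (hu : StronglyMeasurable u) (hDu : StronglyMeasurable Du)
    (hui : Integrable u ((volume.restrict Ω).prod (volume.restrict (Ioc 0 τ))))
    (hDui : Integrable Du ((volume.restrict Ω).prod (volume.restrict (Ioc 0 τ)))) :
    ∫⁻ z, F z.1 (mollify lam a u z) (mollify lam A Du z)
        ∂(volume.restrict Ω).prod (volume.restrict (Ioc 0 τ)) ≤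
      (ENNReal.ofReal lam⁻¹ * ∫⁻ x in Ω, F x (a x) (A x)) +
        ∫⁻ z, F z.1 (u z) (Du z) ∂(volume.restrict Ω).prod (volume.restrict (Ioc 0 τ)) := by
  have hm : Measurable fun z : Vec n × ℝ =>
      (F z.1 (extendPast a u z) (extendPast A Du z) : ℝ≥0∞) :=
    (hF.measurable_comp measurable_fst (stronglyMeasurable_extendPast ha hu).measurable
      (stronglyMeasurable_extendPast hA hDu).measurable).coe_nnreal_ennreal
  have h1 := lintegral_expKernel_extendPast_le (μ := volume.restrict Ω) hlam τ hm
  simp only [extendPast_zero] at h1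
  have h2 : ∫⁻ z, (F z.1 (extendPast a u z) (extendPast A Du z) : ℝ≥0∞)
        ∂(volume.restrict Ω).prod (volume.restrict (Ioc 0 τ)) =
      ∫⁻ z, F z.1 (u z) (Du z) ∂(volume.restrict Ω).prod (volume.restrict (Ioc 0 τ)) := by
    refine lintegral_congr_ae ?_
    filter_upwards [ae_extendPast_eq a u τ, ae_extendPast_eq A Du τ] with z h3 h4
    rw [h3, h4]
  rw [h2] at h1
  refine (lintegral_mono_ae ?_).trans h1
  filter_upwards [ae_mollify_eq_integral (a := a) hlam hui,
    ae_mollify_eq_integral (a := A) hlam hDui, ae_snd_mem_Ioc τ] with z h3 h4 h5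
  have := isProbabilityMeasure_expKernel hlam h5.1.le
  rw [h3.2, h4.2]
  exact hF.le_lintegral z.1 (integrable_extendPast h3.1) (integrable_extendPast h4.1)

theorem lintegral_cylinder_const_lt_top {ustar : Vec n → Vec N} {Dustar : Vec n → Mat N n}
    [IsFiniteMeasure (volume.restrict Ω)]
    (hF : IsNormalIntegrand F) (hs : StronglyMeasurable ustar) (hDs : StronglyMeasurable Dustar)
    (h : ∫⁻ x in Ω, (F x (ustar x) (Dustar x) : ℝ≥0∞) < ⊤) (τ : ℝ) :
    ∫⁻ z in cylinder Ω τ, (F z.1 (ustar z.1) (Dustar z.1) : ℝ≥0∞) < ⊤ := by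
  have hm : Measurable fun z : Vec n × ℝ => (F z.1 (ustar z.1) (Dustar z.1) : ℝ≥0∞) :=
    (hF.measurable_comp measurable_fst (hs.measurable.comp measurable_fst)
      (hDs.measurable.comp measurable_fst)).coe_nnreal_ennreal
  rw [volume_restrict_cylinder, lintegral_prod _ hm.aemeasurable]
  simp only [lintegral_const]
  rw [lintegral_mul_const' _ _ (measure_ne_top _ _)]
  exact ENNReal.mul_lt_top h (measure_lt_top _ _)

theorem prod_restrict_mono (μ : Measure (Vec n)) [SFinite μ] (hτ : τ ≤ T) :
    μ.prod (volume.restrict (Ioc 0 τ)) ≤ μ.prod (volume.restrict (Ioc 0 T)) :=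
  Measure.prod_mono le_rfl (Measure.restrict_mono (Ioc_subset_Ioc_right hτ) le_rfl)

/-- The energy estimate on `E`. It follows from the one on the whole cylinder, since outside `E`
both functions agree with `u_*`. -/
theorem energy_mollify_le {ustar : Vec n → Vec N} {Dustar : Vec n → Mat N n}
    {u : Vec n × ℝ → Vec N} {Du : Vec n × ℝ → Mat N n}
    [IsFiniteMeasure (volume.restrict Ω)] (hF : IsNormalIntegrand F)
    (hΩ : IsOpen Ω) (hp : 1 ≤ p) (hlam : 0 < lam) (hE : IsRelativelyOpen Ω T E)
    (hEmono : IsNondecreasing T E) (hE0 : volume (frontier E) = 0)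
    (hV : MemVpq Ω T E p q ustar Dustar u Du)
    (hu : StronglyMeasurable u) (hDu : StronglyMeasurable Du) (hs : StronglyMeasurable ustar)
    (hDs : StronglyMeasurable Dustar)
    (hfin : ∫⁻ x in Ω, (F x (ustar x) (Dustar x) : ℝ≥0∞) < ⊤)
    {φ : Vec n → Vec N} (hφ : IsTestFunction (timeSlice E 0) φ) (hτ : τ < T) :
    energy Ω E F τ (mollify lam (ustar + φ) u) (mollify lam (Dustar + classicalGrad φ) Du) ≤
      energy Ω E F τ u Du +
        ENNReal.ofReal lam⁻¹ * ∫⁻ x in Ω, F x ((ustar + φ) x) ((Dustar + classicalGrad φ) x) := by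
  have hEm := hE.measurableSet hΩ
  have huL := hV.memLp
  have hDuL := hV.grad_memLp
  rw [volume_restrict_cylinder] at huL hDuL
  have hmono := prod_restrict_mono (volume.restrict Ω) hτ.le
  have hmain := lintegral_mollify_le hF hlam (hs.add hφ.1.continuous.stronglyMeasurable)
    (hDs.add (continuous_classicalGrad hφ.1).stronglyMeasurable) hu hDu
    ((huL.integrable (one_le_ofReal hp)).mono_measure hmono)
    ((hDuL.integrable (one_le_ofReal hp)).mono_measure hmono)
  set v := mollify lam (ustar + φ) u
  set Dv := mollify lam (Dustar + classicalGrad φ) Du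
  have hu1 := hV.ae_eq_outside hEm hΩ.measurableSet hu hs
  have hu2 := hV.grad_ae_eq_outside hp hΩ hE0 hDu hDs
  have hv1 := ae_mollify_eq_outside hlam hEmono (fun x hx => hφ.eq_zero hx) hu1
  have hv2 := ae_mollify_eq_outside hlam hEmono (fun x hx => classicalGrad_eq_zero hφ hx) hu2
  have hsplit : ∀ (w : Vec n × ℝ → Vec N) (Dw : Vec n × ℝ → Mat N n),
      (∀ᵐ z ∂(volume.restrict Ω).prod (volume.restrict (Ioc 0 τ)), z ∉ E →
        w z = ustar z.1 ∧ Dw z = Dustar z.1) →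
      ∫⁻ z, F z.1 (w z) (Dw z) ∂(volume.restrict Ω).prod (volume.restrict (Ioc 0 τ)) =
        energy Ω E F τ w Dw + ∫⁻ z in cylinder Ω τ \ E, F z.1 (ustar z.1) (Dustar z.1) := by
    intro w Dw h
    rw [← volume_restrict_cylinder] at h ⊢
    rw [← lintegral_inter_add_sdiff _ (cylinder Ω τ) hEm, energy, inter_comm]
    congr 1
    refine lintegral_congr_ae ?_
    filter_upwards [ae_restrict_of_ae_restrict_of_subset sdiff_subset h,
      ae_restrict_mem ((hΩ.measurableSet.prod measurableSet_Ico).diff hEm)] with z hz hzE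
    rw [(hz hzE.2).1, (hz hzE.2).2]
  -- The part of the energy outside `E` is the same for `u` and its mollification, and it can be
  -- cancelled because it is finite.
  have hX : ∫⁻ z in cylinder Ω τ \ E, (F z.1 (ustar z.1) (Dustar z.1) : ℝ≥0∞) ≠ ⊤ :=
    ((lintegral_mono_set sdiff_subset).trans_lt
      (lintegral_cylinder_const_lt_top hF hs hDs hfin τ)).ne
  have hmem : ∀ᵐ z ∂(volume.restrict Ω).prod (volume.restrict (Ioc 0 τ)), z.2 ∈ Ico 0 T :=
    (ae_snd_mem_Ioc τ).mono fun z hz => ⟨hz.1.le, hz.2.trans_lt hτ⟩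
  rw [hsplit v Dv, hsplit u Du] at hmain
  · refine ENNReal.le_of_add_le_add_right hX (hmain.trans_eq ?_)
    rw [add_comm, add_right_comm]
  · filter_upwards [ae_mono hmono hu1, ae_mono hmono hu2] with z h1 h2 hz
    exact ⟨h1 hz, h2 hz⟩
  · filter_upwards [Measure.quasiMeasurePreserving_fst.ae hv1,
      Measure.quasiMeasurePreserving_fst.ae hv2, hmem] with z h1 h2 h3 hz
    exact ⟨h1 z.2 h3 hz, h2 z.2 h3 hz⟩

end

/-! ### Coercivity of `b` and approximation of the initial datum -/

section

theorem norm_rpow_le_add {N : ℕ} {r : ℝ} (hr : 0 ≤ r) (u v : Vec N) :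
    ‖v‖ ^ r ≤ 2 ^ r * (‖u‖ ^ r + ‖u - v‖ ^ r) := by
  have h1 : ‖v‖ ≤ 2 * max ‖u‖ ‖u - v‖ := by
    have : ‖v‖ ≤ ‖u‖ + ‖u - v‖ := by
      calc ‖v‖ = ‖u - (u - v)‖ := by simp
        _ ≤ _ := norm_sub_le _ _
    linarith [le_max_left ‖u‖ ‖u - v‖, le_max_right ‖u‖ ‖u - v‖]
  have h0 : 0 ≤ max ‖u‖ ‖u - v‖ := (norm_nonneg u).trans (le_max_left _ _)
  calc ‖v‖ ^ r ≤ (2 * max ‖u‖ ‖u - v‖) ^ r := by gcongr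
    _ = 2 ^ r * max ‖u‖ ‖u - v‖ ^ r := Real.mul_rpow (by norm_num) h0
    _ ≤ _ := by
      gcongr
      exact max_rpow_le_add (norm_nonneg _) (norm_nonneg _)

/-- The coercivity of `b` that turns smallness of `∫ b[u, v]` into smallness of
`∫ |u - v|^{q+1}` for bounded `∫ |u|^{q+1}`. -/
theorem exists_norm_sub_rpow_le_bTerm {N : ℕ} {q : ℝ} (hq : 0 < q) {ε : ℝ} (hε : 0 < ε) :
    ∃ C : ℝ, 0 < C ∧ ∀ u v : Vec N,
      ‖u - v‖ ^ (q + 1) ≤ ε * ‖u‖ ^ (q + 1) + C * bTerm q u v := by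
  set K : ℝ := 2 ^ (q + 1) with hK
  have hK0 : 0 < K := by positivity
  set δ := min (1 / (2 * K)) (ε / (2 * (1 + K))) with hδ
  have hδ0 : 0 < δ := by positivity
  have hδ1 : δ * K ≤ 1 / 2 := by
    calc δ * K ≤ 1 / (2 * K) * K := by gcongr; exact min_le_left _ _
      _ = 1 / 2 := by field_simp
  have hδ2 : 2 * (δ * (1 + K)) ≤ ε := by
    calc 2 * (δ * (1 + K)) ≤ 2 * (ε / (2 * (1 + K)) * (1 + K)) := by
          gcongr; exact min_le_right _ _
      _ = ε := by field_simp
  obtain ⟨C, hC, h⟩ := exists_norm_sub_rpow_le (N := N) hq hδ0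
  refine ⟨2 * C, by positivity, fun u v => ?_⟩
  have h1 := h u v
  have h2 : δ * ‖v‖ ^ (q + 1) ≤ δ * (K * (‖u‖ ^ (q + 1) + ‖u - v‖ ^ (q + 1))) := by
    gcongr
    exact norm_rpow_le_add (by linarith) u v
  have h3 : δ * K * ‖u - v‖ ^ (q + 1) ≤ 1 / 2 * ‖u - v‖ ^ (q + 1) := by gcongr
  have h4 : 2 * (δ * (1 + K)) * ‖u‖ ^ (q + 1) ≤ ε * ‖u‖ ^ (q + 1) := by gcongr
  linarith

/-- A bound of `b` by which `∫ b[u, v]` is small when `v` is close to `u` in `L^{q+1}`. -/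
theorem exists_bTerm_le {q : ℝ} (hq : 0 < q) {ε : ℝ} (hε : 0 < ε) :
    ∃ C : ℝ, 0 < C ∧ ∀ (N : ℕ) (u v : Vec N),
      bTerm q u v ≤ ε * ‖u‖ ^ (q + 1) + C * ‖u - v‖ ^ (q + 1) := by
  set K : ℝ := 2 ^ (q + 1) with hK
  have hK0 : 0 < K := by positivity
  set δ := ε / (2 * (1 + K)) with hδ
  have hδ0 : 0 < δ := by positivity
  have hδ2 : 2 * δ * (1 + K) = ε := by rw [hδ]; field_simp
  refine ⟨2 * δ * K + 2 * δ⁻¹ ^ q, by positivity, fun N u v => ?_⟩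
  have h1 := bTerm_le hq hδ0 u v
  have h2 : 2 * δ * ‖v‖ ^ (q + 1) ≤ 2 * δ * (K * (‖u‖ ^ (q + 1) + ‖u - v‖ ^ (q + 1))) := by
    gcongr
    exact norm_rpow_le_add (by linarith) u v
  rw [norm_sub_rev v u] at h1
  rw [← hδ2]
  linarith

section Density

variable {n N : ℕ} {U : Set (Vec n)}

/-- `C₀^∞(U)` is dense in `L^r(U)`. -/
theorem exists_isTestFunction_eLpNorm_sub_le (hU : IsOpen U) {r : ℝ≥0∞} (hr : r ≠ ⊤)
    {g : Vec n → Vec N} (hg : MemLp g r (volume.restrict U)) {ε : ℝ≥0∞} (hε : ε ≠ 0) :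
    ∃ φ, eLpNorm (g - φ) r (volume.restrict U) ≤ ε ∧ IsTestFunction U φ := by
  refine hg.induction_dense hr (IsTestFunction U) ?_ (fun φ ψ => IsTestFunction.add)
    (fun φ hφ => hφ.1.continuous.aestronglyMeasurable) hε
  -- Indicators of sets `s` of finite measure remain: with `K ⊆ s ∩ U ⊆ V`, `K` compact, `V` open
  -- and `V \ K` of small measure, use a smooth function that is `1` on `K` and supported in `V ∩ U`.
  intro c s hs hμs ε hε
  obtain ⟨η, hη, hηs⟩ := exists_eLpNorm_indicator_le (μ := volume.restrict U) hr c hε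
  have hA : MeasurableSet (s ∩ U) := hs.inter hU.measurableSet
  have hμA : volume (s ∩ U) ≠ ⊤ := by
    rw [← Measure.restrict_apply hs]; exact hμs.ne
  have hη2 : ((η / 2 : ℝ≥0) : ℝ≥0∞) ≠ 0 := by simpa using hη.ne'
  obtain ⟨K, hKA, hK, hKc, hμK⟩ := hA.exists_isCompact_isClosed_sdiff_lt hμA hη2
  obtain ⟨V, hAV, hV, -, hμV⟩ := hA.exists_isOpen_sdiff_lt hμA hη2
  obtain ⟨L, hL, hKL, hLV⟩ := exists_compact_between hK (hV.inter hU)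
    (subset_inter (hKA.trans hAV) (hKA.trans inter_subset_right))
  obtain ⟨f, hf, hf01, hfs, hfK⟩ := exists_contMDiff_support_eq_eq_one_iff
    (modelWithCornersSelf ℝ (Vec n)) (n := ⊤) (isOpen_interior (s := L)) hKc hKL
  have hfL : tsupport f ⊆ L := by
    rw [tsupport, hfs]; exact closure_minimal interior_subset hL.isClosed
  have htest : IsTestFunction U (fun x => f x • c) := by
    refine ⟨hf.contDiff.smul contDiff_const, ?_, ?_⟩
    · exact (HasCompactSupport.of_support_subset_isCompact hL
        ((subset_tsupport f).trans hfL)).smul_right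
    · exact (tsupport_smul_subset_left f _).trans (hfL.trans (hLV.trans inter_subset_right))
  refine ⟨_, ?_, htest⟩
  have hmeas : volume.restrict U (V \ K) ≤ η := by
    calc volume.restrict U (V \ K) ≤ volume (V \ K) := Measure.restrict_apply_le _ _
      _ ≤ volume (V \ (s ∩ U) ∪ (s ∩ U) \ K) := measure_mono fun x hx => by
          by_cases h : x ∈ s ∩ U
          · exact Or.inr ⟨h, hx.2⟩
          · exact Or.inl ⟨hx.1, h⟩
      _ ≤ (η / 2 : ℝ≥0) + (η / 2 : ℝ≥0) := (measure_union_le _ _).trans (add_le_add hμV.le hμK.le)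
      _ = η := by rw [← ENNReal.coe_add, add_halves]
  refine (eLpNorm_mono_ae ?_).trans (hηs (V \ K) hmeas)
  filter_upwards [ae_restrict_mem hU.measurableSet] with x hxU
  have h01 := hf01 (mem_range_self x)
  simp only [Pi.sub_apply]
  by_cases hxK : x ∈ K
  · have hxs : x ∈ s := (hKA hxK).1
    simp [(hfK x).1 hxK, hxs]
  by_cases hxV : x ∈ V
  · have : x ∈ V \ K := ⟨hxV, hxK⟩
    rw [indicator_of_mem this]
    by_cases hxs : x ∈ s
    · rw [indicator_of_mem hxs, show f x • c - c = (f x - 1) • c by rw [sub_smul, one_smul],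
        norm_smul]
      refine mul_le_of_le_one_left (norm_nonneg _) ?_
      rw [Real.norm_eq_abs, abs_le]
      constructor <;> linarith [h01.1, h01.2]
    · rw [indicator_of_notMem hxs, sub_zero, norm_smul]
      refine mul_le_of_le_one_left (norm_nonneg _) ?_
      rw [Real.norm_eq_abs, abs_le]
      constructor <;> linarith [h01.1, h01.2]
  · have hxs : x ∉ s := fun h => hxV (hAV ⟨h, hxU⟩)
    have hfx : f x = 0 := by
      by_contra h
      exact hxV (hLV (hfL (subset_tsupport f h))).1
    simp [hxs, hfx]

variable {q : ℝ} {Ω : Set (Vec n)}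

theorem integrable_bTerm {μ : Measure (Vec n)} (hq : 0 < q) {v w : Vec n → Vec N}
    (hv : MemLp v (ENNReal.ofReal (q + 1)) μ) (hw : MemLp w (ENNReal.ofReal (q + 1)) μ) :
    Integrable (fun x => bTerm q (v x) (w x)) μ := by
  have h0 : ENNReal.ofReal (q + 1) ≠ 0 := by simp; linarith
  have hv' := hv.integrable_norm_rpow h0 ENNReal.ofReal_ne_top
  have hw' := hw.integrable_norm_rpow h0 ENNReal.ofReal_ne_top
  rw [ENNReal.toReal_ofReal (by linarith)] at hv' hw'
  have hm : AEStronglyMeasurable (fun x => bTerm q (v x) (w x)) μ :=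
    Continuous.comp_aestronglyMeasurable (g := fun z : Vec N × Vec N => bTerm q z.1 z.2)
      (f := fun x => (v x, w x)) (continuous_bTerm hq) (hv.1.prodMk hw.1)
  have hi : Integrable (fun x => 4 * (‖v x‖ ^ (q + 1) + ‖w x‖ ^ (q + 1))) μ :=
    (hv'.add hw').const_mul 4
  refine hi.mono' hm (ae_of_all _ fun x => ?_)
  rw [Real.norm_of_nonneg (bTerm_nonneg hq _ _)]
  exact bTerm_le_const hq _ _

theorem integrable_norm_rpow_add_one {μ : Measure (Vec n)} (hq : 0 < q) {v : Vec n → Vec N}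
    (hv : MemLp v (ENNReal.ofReal (q + 1)) μ) : Integrable (fun x => ‖v x‖ ^ (q + 1)) μ := by
  have hv' := hv.integrable_norm_rpow (by simp; linarith) ENNReal.ofReal_ne_top
  rwa [ENNReal.toReal_ofReal (by linarith)] at hv'

theorem eLpNorm_rpow_eq_ofReal {μ : Measure (Vec n)} (hq : 0 < q) {v : Vec n → Vec N}
    (hv : MemLp v (ENNReal.ofReal (q + 1)) μ) :
    eLpNorm v (ENNReal.ofReal (q + 1)) μ ^ (q + 1) =
      ENNReal.ofReal (∫ x, ‖v x‖ ^ (q + 1) ∂μ) := by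
  have hq1 : 0 < q + 1 := by linarith
  rw [eLpNorm_eq_lintegral_rpow_enorm_toReal (by simp; linarith) ENNReal.ofReal_ne_top,
    ENNReal.toReal_ofReal hq1.le, ← ENNReal.rpow_mul, one_div_mul_cancel hq1.ne', ENNReal.rpow_one,
    ofReal_integral_eq_lintegral_ofReal (integrable_norm_rpow_add_one hq hv)
      (ae_of_all _ fun x => by positivity)]
  refine lintegral_congr fun x => ?_
  rw [← ENNReal.ofReal_rpow_of_nonneg (norm_nonneg _) hq1.le, ofReal_norm]

/-- The initial datum is approximated by admissible initial values. -/
theorem exists_isTestFunction_integral_bTerm_le (hq : 0 < q) (hU : IsOpen U)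
    {uo ustar : Vec n → Vec N} (huo : MemLp uo (ENNReal.ofReal (q + 1)) (volume.restrict U))
    (hus : MemLp ustar (ENNReal.ofReal (q + 1)) (volume.restrict U)) {δ : ℝ} (hδ : 0 < δ) :
    ∃ φ : Vec n → Vec N, IsTestFunction U φ ∧ ∫ x in U, bTerm q (uo x) ((ustar + φ) x) ≤ δ := by
  have hq1 : 0 < q + 1 := by linarith
  set M := ∫ x in U, ‖uo x‖ ^ (q + 1)
  have hM : 0 ≤ M := integral_nonneg fun x => by positivity
  obtain ⟨C, hC, hb⟩ := exists_bTerm_le hq (ε := δ / (2 * (M + 1))) (by positivity)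
  set η : ℝ := (δ / (2 * C)) ^ (1 / (q + 1)) with hη
  have hη0 : 0 < η := by positivity
  obtain ⟨φ, hφ, hφt⟩ := exists_isTestFunction_eLpNorm_sub_le hU ENNReal.ofReal_ne_top
    (huo.sub hus) (ε := ENNReal.ofReal η) (by simpa using hη0)
  have hφL : MemLp φ (ENNReal.ofReal (q + 1)) (volume.restrict U) := hφt.memLp _
  refine ⟨φ, hφt, ?_⟩
  have hd : MemLp (fun x => uo x - (ustar + φ) x) (ENNReal.ofReal (q + 1)) (volume.restrict U) :=
    huo.sub (hus.add hφL)
  have hD : ∫ x in U, ‖uo x - (ustar + φ) x‖ ^ (q + 1) ≤ δ / (2 * C) := by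
    have h1 := eLpNorm_rpow_eq_ofReal hq hd
    have h2 : eLpNorm (fun x => uo x - (ustar + φ) x) (ENNReal.ofReal (q + 1))
        (volume.restrict U) ≤ ENNReal.ofReal η := by
      convert! hφ using 2
      ext x : 1
      simp [sub_sub]
    have h3 := ENNReal.rpow_le_rpow h2 hq1.le
    rw [h1, ENNReal.ofReal_rpow_of_nonneg hη0.le hq1.le, hη, ← Real.rpow_mul (by positivity),
      one_div_mul_cancel hq1.ne', Real.rpow_one] at h3
    exact (ENNReal.ofReal_le_ofReal_iff (by positivity)).1 h3
  calc ∫ x in U, bTerm q (uo x) ((ustar + φ) x)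
      ≤ ∫ x in U, (δ / (2 * (M + 1)) * ‖uo x‖ ^ (q + 1) +
          C * ‖uo x - (ustar + φ) x‖ ^ (q + 1)) :=
        integral_mono (integrable_bTerm hq huo (hus.add hφL))
          (((integrable_norm_rpow_add_one hq huo).const_mul _).add
            ((integrable_norm_rpow_add_one hq hd).const_mul _)) fun x => hb N _ _
    _ = δ / (2 * (M + 1)) * M + C * ∫ x in U, ‖uo x - (ustar + φ) x‖ ^ (q + 1) := by
        rw [integral_add ((integrable_norm_rpow_add_one hq huo).const_mul _)
          ((integrable_norm_rpow_add_one hq hd).const_mul _), integral_const_mul,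
          integral_const_mul]
    _ ≤ δ / (2 * (M + 1)) * (M + 1) + C * (δ / (2 * C)) := by gcongr; linarith
    _ = δ := by field_simp; ring

end Density

end

/-! ### Testing with the mollification -/

section

variable {n N : ℕ} {Ω : Set (Vec n)} {T lam p q : ℝ} {E : Set (Vec n × ℝ)}
  {F : Vec n → Vec N → Mat N n → ℝ≥0} {uo ustar : Vec n → Vec N} {Dustar : Vec n → Mat N n}
  {u : Vec n × ℝ → Vec N} {Du : Vec n × ℝ → Mat N n}

/-- Cancellation of a finite energy `A` in the variational inequality. -/
theorem toReal_add_nonneg_of_ereal_le {A B D : ℝ≥0∞} (hA : A ≠ ⊤) (hD : D ≠ ⊤) (hB : B ≤ A + D)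
    {r : ℝ} (h : (A : EReal) ≤ (B : EReal) + (r : EReal)) : 0 ≤ D.toReal + r := by
  have hB' : B ≠ ⊤ := ne_top_of_le_ne_top (ENNReal.add_ne_top.2 ⟨hA, hD⟩) hB
  lift A to ℝ≥0 using hA
  lift B to ℝ≥0 using hB'
  lift D to ℝ≥0 using hD
  have h1 : (A : ℝ) ≤ B + r := by
    rwa [EReal.coe_nnreal_eq_coe_real, EReal.coe_nnreal_eq_coe_real, ← EReal.coe_add,
      EReal.coe_le_coe_iff] at h
  have h2 : (B : ℝ) ≤ A + D := by exact_mod_cast hB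
  simp only [ENNReal.coe_toReal]
  linarith

theorem lt_top_of_ereal_le {A B : ℝ≥0∞} (hB : B < ⊤) {r : ℝ}
    (h : (A : EReal) ≤ (B : EReal) + (r : EReal)) : A < ⊤ := by
  by_contra hA
  rw [not_lt_top_iff] at hA
  lift B to ℝ≥0 using hB.ne
  rw [hA, EReal.coe_ennreal_top, top_le_iff] at h
  exact absurd h (EReal.add_ne_top (by simp) (by simp))

theorem memVpq_const [IsFiniteMeasure (volume.restrict Ω)]
    (hsp : MemLp ustar (ENNReal.ofReal p) (volume.restrict Ω))
    (hDsp : MemLp Dustar (ENNReal.ofReal p) (volume.restrict Ω))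
    (hsq : MemLp ustar (ENNReal.ofReal (q + 1)) (volume.restrict Ω)) :
    MemVpq Ω T E p q ustar Dustar (fun z => ustar z.1) (fun z => Dustar z.1) := by
  refine ⟨?_, ?_, ae_of_all _ fun t => ?_, ae_of_all _ fun t => ae_of_all _ fun x => rfl, ?_⟩
  · rw [volume_restrict_cylinder]; exact hsp.comp_fst _
  · rw [volume_restrict_cylinder]; exact hDsp.comp_fst _
  · have h1 : slice (fun z : Vec n × ℝ => ustar z.1) t - ustar = 0 := by ext x : 1; simp [slice]
    have h2 : slice (fun z : Vec n × ℝ => Dustar z.1) t - Dustar = 0 := by ext x : 1; simp [slice]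
    rw [h1, h2]
    exact ⟨MemLp.zero, MemLp.zero, fun ε hε => ⟨0, .zero, by simpa using hε, by
      simpa [classicalGrad_zero] using hε⟩⟩
  · rw [volume_restrict_cylinder]; exact hsq.comp_fst _

/-- The energy of a variational solution is finite, by comparison with `u_*`, in the form of the
mollification of the map that is `u_*` at all times. -/
theorem ae_energy_lt_top [IsFiniteMeasure (volume.restrict Ω)] (hF : IsNormalIntegrand F)
    (hΩ : IsOpen Ω) (hT : 0 < T) (hp : 1 ≤ p) (hq : 0 < q) (hE : IsRelativelyOpen Ω T E)
    (hEmono : IsNondecreasing T E) (hE0 : volume (frontier E) = 0)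
    (hs : StronglyMeasurable ustar) (hDs : StronglyMeasurable Dustar)
    (hsp : MemLp ustar (ENNReal.ofReal p) (volume.restrict Ω))
    (hDsp : MemLp Dustar (ENNReal.ofReal p) (volume.restrict Ω))
    (hsq : MemLp ustar (ENNReal.ofReal (q + 1)) (volume.restrict Ω))
    (hfin : ∫⁻ x in Ω, (F x (ustar x) (Dustar x) : ℝ≥0∞) < ⊤)
    (hVI : ∀ (v : Vec n × ℝ → Vec N) (Dv : Vec n × ℝ → Mat N n) (dv : Vec n × ℝ → Vec N),
      IsComparisonMap Ω T E p q ustar Dustar v Dv dv →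
      ∀ᵐ τ ∂(volume.restrict (Ioo 0 T)), VariationalInequality Ω E q F uo u Du v Dv dv τ) :
    ∀ᵐ τ ∂volume.restrict (Ioo 0 T), energy Ω E F τ u Du < ⊤ := by
  have hV := memVpq_const (T := T) (E := E) hsp hDsp hsq
  have hs' : StronglyMeasurable fun z : Vec n × ℝ => ustar z.1 :=
    hs.comp_measurable measurable_fst
  have hDs' : StronglyMeasurable fun z : Vec n × ℝ => Dustar z.1 :=
    hDs.comp_measurable measurable_fst
  have h0 : IsTestFunction (timeSlice E 0) (0 : Vec n → Vec N) := .zero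
  filter_upwards [hVI _ _ _ (isComparisonMap_mollify hΩ hT hp hq.le one_pos hE hEmono hV hs' hDs'
    hs hDs hsp hDsp hsq h0), ae_restrict_mem measurableSet_Ioo] with τ hτ hτT
  refine lt_top_of_ereal_le ?_ hτ
  refine (energy_mollify_le hF hΩ hp one_pos hE hEmono hE0 hV hs' hDs' hs hDs hfin h0
    hτT.2).trans_lt (ENNReal.add_lt_top.2 ⟨?_, ENNReal.mul_lt_top ENNReal.ofReal_lt_top ?_⟩)
  · exact (lintegral_mono_set inter_subset_right).trans_lt
      (lintegral_cylinder_const_lt_top hF hs hDs hfin τ)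
  · simpa [classicalGrad_zero] using hfin

/-- The variational inequality tested with the mollification of the solution itself. The term with
the time derivative has a sign, because `∂ₜv = λ(u - v)` and `u ↦ |u|^{q-1}u` is monotone. -/
theorem ae_integral_bTerm_mollify_le [IsFiniteMeasure (volume.restrict Ω)]
    (hF : IsNormalIntegrand F) (hΩ : IsOpen Ω) (hT : 0 < T) (hp : 1 ≤ p) (hq : 0 < q)
    (hlam : 0 < lam) (hE : IsRelativelyOpen Ω T E) (hEmono : IsNondecreasing T E)
    (hE0 : volume (frontier E) = 0) (hV : MemVpq Ω T E p q ustar Dustar u Du)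
    (hu : StronglyMeasurable u) (hDu : StronglyMeasurable Du) (hs : StronglyMeasurable ustar)
    (hDs : StronglyMeasurable Dustar)
    (hsp : MemLp ustar (ENNReal.ofReal p) (volume.restrict Ω))
    (hDsp : MemLp Dustar (ENNReal.ofReal p) (volume.restrict Ω))
    (hsq : MemLp ustar (ENNReal.ofReal (q + 1)) (volume.restrict Ω))
    (hfin : ∀ φ : Vec n → Vec N, IsTestFunction Ω φ →
      ∫⁻ x in Ω, (F x ((ustar + φ) x) ((Dustar + classicalGrad φ) x) : ℝ≥0∞) < ⊤)
    (hVI : ∀ (v : Vec n × ℝ → Vec N) (Dv : Vec n × ℝ → Mat N n) (dv : Vec n × ℝ → Vec N),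
      IsComparisonMap Ω T E p q ustar Dustar v Dv dv →
      ∀ᵐ τ ∂(volume.restrict (Ioo 0 T)), VariationalInequality Ω E q F uo u Du v Dv dv τ)
    {φ : Vec n → Vec N} (hφ : IsTestFunction (timeSlice E 0) φ) :
    ∀ᵐ τ ∂volume.restrict (Ioo 0 T),
      ∫ x in timeSlice E τ, bTerm q (u (x, τ)) (mollify lam (ustar + φ) u (x, τ)) ≤
        lam⁻¹ * (∫⁻ x in Ω, (F x ((ustar + φ) x) ((Dustar + classicalGrad φ) x) : ℝ≥0∞)).toReal +
          ∫ x in timeSlice E 0, bTerm q (uo x) ((ustar + φ) x) := by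
  have hφΩ := hφ.mono (hE.timeSlice_zero hΩ hT).2
  have hfin0 : ∫⁻ x in Ω, (F x (ustar x) (Dustar x) : ℝ≥0∞) < ⊤ := by
    simpa [classicalGrad_zero] using hfin 0 .zero
  filter_upwards [hVI _ _ _ (isComparisonMap_mollify hΩ hT hp hq.le hlam hE hEmono hV hu hDu
    hs hDs hsp hDsp hsq hφ), ae_restrict_mem measurableSet_Ioo,
    ae_energy_lt_top hF hΩ hT hp hq hE hEmono hE0 hs hDs hsp hDsp hsq hfin0 hVI] with τ hτ hτT hτu
  have h1 := toReal_add_nonneg_of_ereal_le hτu.ne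
    (ENNReal.mul_lt_top ENNReal.ofReal_lt_top (hfin φ hφΩ)).ne
    (energy_mollify_le hF hΩ hp hlam hE hEmono hE0 hV hu hDu hs hDs hfin0 hφ hτT.2) hτ
  rw [ENNReal.toReal_mul, ENNReal.toReal_ofReal (by positivity)] at h1
  simp only [mollify_zero] at h1
  have h2 : ∫ z in E ∩ cylinder Ω τ, inner ℝ (lam • (u z - mollify lam (ustar + φ) u z))
      (spow q (mollify lam (ustar + φ) u z) - spow q (u z)) ≤ 0 := by
    refine integral_nonpos fun z => ?_
    have h3 := inner_sub_spow_sub_nonneg hq (u z) (mollify lam (ustar + φ) u z)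
    have h4 : inner ℝ (lam • (u z - mollify lam (ustar + φ) u z))
        (spow q (mollify lam (ustar + φ) u z) - spow q (u z)) =
        -(lam * inner ℝ (mollify lam (ustar + φ) u z - u z)
          (spow q (mollify lam (ustar + φ) u z) - spow q (u z))) := by
      rw [inner_smul_left, ← neg_sub (mollify lam (ustar + φ) u z) (u z), inner_neg_left]
      simp
    show inner ℝ (lam • (u z - mollify lam (ustar + φ) u z))
      (spow q (mollify lam (ustar + φ) u z) - spow q (u z)) ≤ 0
    rw [h4]
    have := mul_nonneg hlam.le h3
    linarith
  linarith

/-- A variational solution is, uniformly for almost all times, a limit in `L^{q+1}` of curves that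
are continuous on `[0, T]`. The curves are mollifications of `u`: the test function `φ` makes
`∫ b[uₒ, u_* + φ]` small on `E^0`, and then a large `λ` makes `λ⁻¹` times the energy of `u_* + φ`
small. -/
theorem exists_continuousInLp_approx [IsFiniteMeasure (volume.restrict Ω)]
    (hF : IsNormalIntegrand F) (hΩ : IsOpen Ω) (hT : 0 < T) (hp : 1 ≤ p) (hq : 0 < q)
    (hE : IsRelativelyOpen Ω T E) (hEmono : IsNondecreasing T E)
    (hE0 : volume (frontier E) = 0) (hV : MemVpq Ω T E p q ustar Dustar u Du)
    (hu : StronglyMeasurable u) (hDu : StronglyMeasurable Du) (hs : StronglyMeasurable ustar)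
    (hDs : StronglyMeasurable Dustar)
    (hsp : MemLp ustar (ENNReal.ofReal p) (volume.restrict Ω))
    (hDsp : MemLp Dustar (ENNReal.ofReal p) (volume.restrict Ω))
    (hsq : MemLp ustar (ENNReal.ofReal (q + 1)) (volume.restrict Ω))
    (huo : MemLp uo (ENNReal.ofReal (q + 1)) (volume.restrict Ω))
    (hfin : ∀ φ : Vec n → Vec N, IsTestFunction Ω φ →
      ∫⁻ x in Ω, (F x ((ustar + φ) x) ((Dustar + classicalGrad φ) x) : ℝ≥0∞) < ⊤)
    (hVI : ∀ (v : Vec n × ℝ → Vec N) (Dv : Vec n × ℝ → Mat N n) (dv : Vec n × ℝ → Vec N),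
      IsComparisonMap Ω T E p q ustar Dustar v Dv dv →
      ∀ᵐ τ ∂(volume.restrict (Ioo 0 T)), VariationalInequality Ω E q F uo u Du v Dv dv τ)
    {C : ℝ≥0} (hC : ∀ᵐ t ∂(volume.restrict (Ioo 0 T)),
      eLpNorm (slice u t) (ENNReal.ofReal (q + 1)) (volume.restrict Ω) ≤ C) {ε : ℝ} (hε : 0 < ε) :
    ∃ v : Vec n × ℝ → Vec N, ContinuousInLp Ω (q + 1) (Icc 0 T) v ∧
      ∀ᵐ t ∂(volume.restrict (Ioo 0 T)), eLpNorm (slice v t - slice u t)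
        (ENNReal.ofReal (q + 1)) (volume.restrict Ω) ≤ ENNReal.ofReal ε := by
  have hq1 : 0 < q + 1 := by linarith
  obtain ⟨hU, hUΩ⟩ := hE.timeSlice_zero hΩ hT
  have hEm := hE.measurableSet hΩ
  set M : ℝ := (C : ℝ) ^ (q + 1) with hM
  have hM0 : 0 ≤ M := by positivity
  -- With these constants, coercivity yields at most `ε^{q+1} / 2` from `∫ |u|^{q+1} ≤ M`,
  -- and `K (δ + δ) = ε^{q+1} / 2` from `∫ b[u, v]`.
  obtain ⟨K, hK, hb⟩ := exists_norm_sub_rpow_le_bTerm (N := N) hq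
    (ε := ε ^ (q + 1) / (2 * (M + 1))) (by positivity)
  set δ : ℝ := ε ^ (q + 1) / (4 * K) with hδ
  have hδ0 : 0 < δ := by positivity
  have hmU : volume.restrict (timeSlice E 0) ≤ volume.restrict Ω := Measure.restrict_mono hUΩ le_rfl
  obtain ⟨φ, hφ, hφδ⟩ := exists_isTestFunction_integral_bTerm_le hq hU (huo.mono_measure hmU)
    (hsq.mono_measure hmU) hδ0
  have hφΩ := hφ.mono hUΩ
  set I : ℝ := (∫⁻ x in Ω, (F x ((ustar + φ) x) ((Dustar + classicalGrad φ) x) : ℝ≥0∞)).toReal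
    with hI
  have hI0 : 0 ≤ I := ENNReal.toReal_nonneg
  have hlam : 0 < (I + 1) / δ := by positivity
  have hlamI : ((I + 1) / δ)⁻¹ * I ≤ δ := by
    calc ((I + 1) / δ)⁻¹ * I ≤ ((I + 1) / δ)⁻¹ * (I + 1) := by gcongr; linarith
      _ = δ := by field_simp
  have haL : MemLp (ustar + φ) (ENNReal.ofReal (q + 1)) (volume.restrict Ω) :=
    hsq.add (hφ.memLp _)
  have hvc := continuousInLp_mollify (lam := (I + 1) / δ) (by linarith) haL hV.memLq
  refine ⟨mollify ((I + 1) / δ) (ustar + φ) u, hvc, ?_⟩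
  have huq := hV.memLq
  rw [volume_restrict_cylinder] at huq
  have huslice := ae_memLp_slice (by simpa using hq1) ENNReal.ofReal_ne_top huq
  have hvout := ae_mollify_eq_outside hlam hEmono (fun x hx => hφ.eq_zero hx)
    (hV.ae_eq_outside hEm hΩ.measurableSet hu hs)
  have huout := ae_ae_slice (hV.ae_eq_outside hEm hΩ.measurableSet hu hs)
  rw [← restrict_Ioo_eq_Ioc] at huslice huout
  filter_upwards [ae_integral_bTerm_mollify_le hF hΩ hT hp hq hlam hE hEmono hE0 hV hu hDu hs hDs
    hsp hDsp hsq hfin hVI hφ, hC, huslice, huout, ae_restrict_mem measurableSet_Ioo] with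
    t ht hCt hut huot htT
  set v := mollify ((I + 1) / δ) (ustar + φ) u with hv
  have hvt : MemLp (fun x => v (x, t)) (ENNReal.ofReal (q + 1)) (volume.restrict Ω) :=
    hvc.1 t (Ioo_subset_Icc_self htT)
  have hEt : MeasurableSet (timeSlice E t) := measurable_prodMk_right hEm
  have hEtΩ : timeSlice E t ⊆ Ω := by
    obtain ⟨O, -, rfl⟩ := hE
    exact fun x hx => hx.2.1
  have hmt : volume.restrict (timeSlice E t) ≤ volume.restrict Ω :=
    Measure.restrict_mono hEtΩ le_rfl
  have hd : MemLp (slice v t - slice u t) (ENNReal.ofReal (q + 1)) (volume.restrict Ω) :=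
    hvt.sub hut
  have hbi : IntegrableOn (fun x => bTerm q (u (x, t)) (v (x, t))) (timeSlice E t) :=
    integrable_bTerm hq (hut.mono_measure hmt) (hvt.mono_measure hmt)
  have hui := integrable_norm_rpow_add_one hq hut
  have huM : ∫ x in Ω, ‖u (x, t)‖ ^ (q + 1) ≤ M := by
    have h1 := eLpNorm_rpow_eq_ofReal hq hut
    have h2 := ENNReal.rpow_le_rpow hCt hq1.le
    change eLpNorm (fun x => u (x, t)) _ _ ^ (q + 1) ≤ _ at h2
    rw [h1, ← ENNReal.coe_rpow_of_nonneg _ hq1.le] at h2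
    have h3 := ENNReal.toReal_mono ENNReal.coe_ne_top h2
    rwa [ENNReal.toReal_ofReal (integral_nonneg fun x => by positivity), ENNReal.coe_toReal,
      NNReal.coe_rpow] at h3
  -- Outside `E^t` both functions are equal to `u_*`.
  have hsplit : ∫ x in Ω, ‖(slice v t - slice u t) x‖ ^ (q + 1) =
      ∫ x in timeSlice E t, ‖u (x, t) - v (x, t)‖ ^ (q + 1) := by
    have h0 : ∀ᵐ x ∂volume.restrict Ω, ‖(slice v t - slice u t) x‖ ^ (q + 1) =
        (timeSlice E t).indicator (fun x => ‖u (x, t) - v (x, t)‖ ^ (q + 1)) x := by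
      filter_upwards [hvout, huot] with x h1 h2
      by_cases hx : x ∈ timeSlice E t
      · rw [indicator_of_mem hx, Pi.sub_apply, slice, slice, norm_sub_rev]
      · rw [indicator_of_notMem hx, Pi.sub_apply, slice, slice, h1 t (Ioo_subset_Ico_self htT) hx,
          h2 hx, sub_self, norm_zero, Real.zero_rpow hq1.ne']
    rw [integral_congr_ae h0, integral_indicator hEt, Measure.restrict_restrict hEt,
      inter_eq_left.2 hEtΩ]
  have hmain : ∫ x in Ω, ‖(slice v t - slice u t) x‖ ^ (q + 1) ≤ ε ^ (q + 1) := by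
    rw [hsplit]
    have hdi : IntegrableOn (fun x => ‖u (x, t) - v (x, t)‖ ^ (q + 1)) (timeSlice E t) :=
      (integrable_norm_rpow_add_one hq (hut.sub hvt)).mono_measure hmt
    have hui' : IntegrableOn (fun x => ‖u (x, t)‖ ^ (q + 1)) (timeSlice E t) :=
      hui.mono_measure hmt
    calc ∫ x in timeSlice E t, ‖u (x, t) - v (x, t)‖ ^ (q + 1)
        ≤ ∫ x in timeSlice E t, (ε ^ (q + 1) / (2 * (M + 1)) * ‖u (x, t)‖ ^ (q + 1) +
            K * bTerm q (u (x, t)) (v (x, t))) :=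
          integral_mono hdi ((hui'.const_mul _).add (hbi.const_mul _)) fun x => hb _ _
      _ = ε ^ (q + 1) / (2 * (M + 1)) * (∫ x in timeSlice E t, ‖u (x, t)‖ ^ (q + 1)) +
            K * ∫ x in timeSlice E t, bTerm q (u (x, t)) (v (x, t)) := by
          rw [integral_add (hui'.const_mul _) (hbi.const_mul _), integral_const_mul,
            integral_const_mul]
      _ ≤ ε ^ (q + 1) / (2 * (M + 1)) * (M + 1) + K * (δ + δ) := by
          gcongr
          · refine ((setIntegral_mono_set hui (ae_of_all _ fun x => by positivity)
              hEtΩ.eventuallyLE).trans huM).trans (by linarith)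
          · exact ht.trans (add_le_add hlamI hφδ)
      _ = ε ^ (q + 1) := by rw [hδ]; field_simp; ring
  have h1 := eLpNorm_rpow_eq_ofReal hq hd
  have h2 : eLpNorm (slice v t - slice u t) (ENNReal.ofReal (q + 1)) (volume.restrict Ω) ^ (q + 1) ≤
      ENNReal.ofReal ε ^ (q + 1) := by
    rw [h1, ENNReal.ofReal_rpow_of_nonneg hε.le hq1.le]
    exact ENNReal.ofReal_le_ofReal hmain
  exact (ENNReal.rpow_le_rpow_iff hq1).1 h2

end

/-! ### Continuous representatives -/

section

/-- Times with an almost sure property are dense. -/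
theorem mem_closure_of_ae {T : ℝ} (hT : 0 < T) {P : ℝ → Prop}
    (hP : ∀ᵐ s ∂(volume.restrict (Ioo 0 T)), P s) {t : ℝ} (ht : t ∈ Icc 0 T) :
    t ∈ closure {s ∈ Ioo 0 T | P s} := by
  rw [mem_closure_iff]
  intro O hO htO
  rw [← closure_Ioo hT.ne, mem_closure_iff] at ht
  have hpos : 0 < volume (O ∩ Ioo 0 T) := (hO.inter isOpen_Ioo).measure_pos _ (ht O hO htO)
  by_contra hne
  rw [not_nonempty_iff_eq_empty] at hne
  rw [ae_restrict_iff' measurableSet_Ioo] at hP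
  refine hpos.ne' (measure_mono_null (fun s hs => ?_) hP)
  intro hPs
  have : s ∈ O ∩ {s ∈ Ioo 0 T | P s} := ⟨hs.1, hs.2, hPs hs.2⟩
  rw [hne] at this
  exact this

/-- A curve in a complete space that is, uniformly for almost all times, a limit of continuous
curves agrees with a continuous curve for almost all times. -/
theorem exists_continuousOn_of_ae_approx {X : Type*} [MetricSpace X] [CompleteSpace X] {T : ℝ}
    (hT : 0 < T) {U : ℝ → X} (h : ∀ ε : ℝ, 0 < ε → ∃ V : ℝ → X, ContinuousOn V (Icc 0 T) ∧
      ∀ᵐ t ∂(volume.restrict (Ioo 0 T)), dist (V t) (U t) ≤ ε) :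
    ∃ W : ℝ → X, ContinuousOn W (Icc 0 T) ∧ ∀ᵐ t ∂(volume.restrict (Ioo 0 T)), W t = U t := by
  have hpos : ∀ k : ℕ, (0 : ℝ) < 1 / (k + 1) := fun k => by positivity
  choose V hV hVU using fun k : ℕ => h _ (hpos k)
  have hlim : Tendsto (fun k : ℕ => (1 : ℝ) / (k + 1)) atTop (𝓝 0) :=
    tendsto_one_div_add_atTop_nhds_zero_nat
  -- The estimate for almost all times extends to all times by continuity.
  have hdist : ∀ k l : ℕ, ∀ t ∈ Icc 0 T, dist (V k t) (V l t) ≤ 1 / (k + 1) + 1 / (l + 1) := by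
    intro k l t ht
    have hae : ∀ᵐ s ∂(volume.restrict (Ioo 0 T)),
        dist (V k s) (V l s) ≤ 1 / ((k : ℝ) + 1) + 1 / ((l : ℝ) + 1) := by
      filter_upwards [hVU k, hVU l] with s h1 h2
      exact (dist_triangle_right _ _ (U s)).trans (add_le_add h1 h2)
    have hcl := mem_closure_of_ae hT hae ht
    have hne : (𝓝[{s ∈ Ioo 0 T | dist (V k s) (V l s) ≤ 1 / ((k : ℝ) + 1) + 1 / ((l : ℝ) + 1)}]
        t).NeBot := mem_closure_iff_nhdsWithin_neBot.1 hcl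
    have hsub : {s ∈ Ioo 0 T | dist (V k s) (V l s) ≤ 1 / ((k : ℝ) + 1) + 1 / ((l : ℝ) + 1)} ⊆
        Icc 0 T := fun s hs => Ioo_subset_Icc_self hs.1
    have htend : Tendsto (fun s => dist (V k s) (V l s))
        (𝓝[{s ∈ Ioo 0 T | dist (V k s) (V l s) ≤ 1 / ((k : ℝ) + 1) + 1 / ((l : ℝ) + 1)}] t)
        (𝓝 (dist (V k t) (V l t))) :=
      ((hV k t ht).mono hsub).dist ((hV l t ht).mono hsub)
    refine le_of_tendsto htend ?_
    filter_upwards [self_mem_nhdsWithin] with s hs using hs.2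
  have hcau : ∀ t ∈ Icc 0 T, CauchySeq fun k => V k t := by
    intro t ht
    refine Metric.cauchySeq_iff'.2 fun ε hε => ?_
    obtain ⟨K, hK⟩ := ((tendsto_order.1 hlim).2 (ε / 2) (by positivity)).exists_forall_of_atTop
    refine ⟨K, fun k hk => (hdist k K t ht).trans_lt ?_⟩
    linarith [hK k hk, hK K le_rfl]
  classical
  have hex : ∀ t, ∃ w, t ∈ Icc 0 T → Tendsto (fun k => V k t) atTop (𝓝 w) := by
    intro t
    by_cases ht : t ∈ Icc 0 T
    · obtain ⟨w, hw⟩ := cauchySeq_tendsto_of_complete (hcau t ht)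
      exact ⟨w, fun _ => hw⟩
    · exact ⟨U t, fun h => absurd h ht⟩
  choose W hW using hex
  have hWV : ∀ k, ∀ t ∈ Icc 0 T, dist (V k t) (W t) ≤ 1 / (k + 1) := by
    intro k t ht
    have h1 : Tendsto (fun l : ℕ => (1 : ℝ) / (k + 1) + 1 / (l + 1)) atTop
        (𝓝 (1 / (k + 1) + 0)) := tendsto_const_nhds.add hlim
    rw [add_zero] at h1
    exact le_of_tendsto_of_tendsto' (tendsto_const_nhds.dist (hW t ht)) h1 fun l => hdist k l t ht
  refine ⟨W, ?_, ?_⟩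
  · have hunif : TendstoUniformlyOn V W atTop (Icc 0 T) := by
      rw [Metric.tendstoUniformlyOn_iff]
      intro ε hε
      filter_upwards [(tendsto_order.1 hlim).2 ε hε] with k hk t ht
      rw [dist_comm]
      exact (hWV k t ht).trans_lt hk
    exact hunif.continuousOn (Eventually.of_forall hV).frequently
  · filter_upwards [ae_all_iff.2 hVU, ae_restrict_mem measurableSet_Ioo] with t h1 ht
    have h2 : Tendsto (fun k => V k t) atTop (𝓝 (U t)) :=
      tendsto_iff_dist_tendsto_zero.2 (squeeze_zero (fun _ => dist_nonneg) h1 hlim)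
    exact tendsto_nhds_unique (hW t (Ioo_subset_Icc_self ht)) h2

variable {n N : ℕ} {Ω : Set (Vec n)} {T p q : ℝ} {E : Set (Vec n × ℝ)}
  {ustar ustar' : Vec n → Vec N} {Dustar Dustar' : Vec n → Mat N n}
  {u u' : Vec n × ℝ → Vec N} {Du Du' : Vec n × ℝ → Mat N n}

theorem exists_continuousInLp_of_approx [IsFiniteMeasure (volume.restrict Ω)] (hT : 0 < T)
    {r : ℝ} (hr : 1 ≤ r) (hu : MemLp u (ENNReal.ofReal r) (volume.restrict (cylinder Ω T)))
    (h : ∀ ε : ℝ, 0 < ε → ∃ v : Vec n × ℝ → Vec N, ContinuousInLp Ω r (Icc 0 T) v ∧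
      ∀ᵐ t ∂(volume.restrict (Ioo 0 T)), eLpNorm (slice v t - slice u t)
        (ENNReal.ofReal r) (volume.restrict Ω) ≤ ENNReal.ofReal ε) :
    ∃ w : Vec n × ℝ → Vec N, ContinuousInLp Ω r (Icc 0 T) w ∧
      ∀ᵐ t ∂(volume.restrict (Ioo 0 T)), slice w t =ᵐ[volume.restrict Ω] slice u t := by
  have : Fact (1 ≤ ENNReal.ofReal r) := ⟨one_le_ofReal hr⟩
  rw [volume_restrict_cylinder] at hu
  have hus := ae_memLp_slice (by simp; linarith) ENNReal.ofReal_ne_top hu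
  rw [← restrict_Ioo_eq_Ioc] at hus
  obtain ⟨W, hW, hWu⟩ := exists_continuousOn_of_ae_approx hT
    (U := sliceLp (ENNReal.ofReal r) (volume.restrict Ω) u) fun ε hε => by
      obtain ⟨v, hv, hvu⟩ := h ε hε
      refine ⟨sliceLp (ENNReal.ofReal r) (volume.restrict Ω) v, fun t ht => ?_, ?_⟩
      · rw [ContinuousWithinAt, tendsto_iff_edist_tendsto_0]
        refine (hv.2 t ht).congr' ?_
        filter_upwards [self_mem_nhdsWithin] with s hs
        rw [Lp.edist_def]
        exact (eLpNorm_congr_ae ((sliceLp_coeFn (hv.1 s hs)).sub (sliceLp_coeFn (hv.1 t ht)))).symm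
      · filter_upwards [hvu, hus, ae_restrict_mem measurableSet_Ioo] with t h1 h2 ht
        rw [← edist_le_ofReal hε.le, Lp.edist_def]
        exact (eLpNorm_congr_ae ((sliceLp_coeFn (hv.1 t (Ioo_subset_Icc_self ht))).sub
          (sliceLp_coeFn h2))).trans_le h1
  refine ⟨fun z => W z.2 z.1, ⟨fun t _ => Lp.memLp (W t), fun t ht => ?_⟩, ?_⟩
  · refine (tendsto_iff_edist_tendsto_0.1 (hW t ht)).congr fun s => ?_
    rw [Lp.edist_def]
    rfl
  · filter_upwards [hWu, hus] with t h1 h2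
    change (W t : Vec n → Vec N) =ᵐ[volume.restrict Ω] _
    rw [h1]
    exact sliceLp_coeFn h2

/-- The choice of representatives does not matter. -/
theorem MemVpq.congr (hp : 1 ≤ p) (h : MemVpq Ω T E p q ustar Dustar u Du)
    (hu : u =ᵐ[volume.restrict (cylinder Ω T)] u')
    (hDu : Du =ᵐ[volume.restrict (cylinder Ω T)] Du')
    (hs : ustar =ᵐ[volume.restrict Ω] ustar') (hDs : Dustar =ᵐ[volume.restrict Ω] Dustar') :
    MemVpq Ω T E p q ustar' Dustar' u' Du' := by
  have : Fact (1 ≤ ENNReal.ofReal p) := ⟨one_le_ofReal hp⟩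
  have hu1 := hu
  have hDu1 := hDu
  rw [volume_restrict_cylinder] at hu1 hDu1
  have hu2 := ae_ae_slice hu1
  have hDu2 := ae_ae_slice hDu1
  rw [← restrict_Ioo_eq_Ioc] at hu2 hDu2
  refine ⟨h.memLp.ae_eq hu, h.grad_memLp.ae_eq hDu, ?_, ?_, h.memLq.ae_eq hu⟩
  · filter_upwards [h.boundary, hu2, hDu2] with t h1 h2 h3
    exact h1.congr (EventuallyEq.sub h2 hs) (EventuallyEq.sub h3 hDs)
  · filter_upwards [h.eq_outside, hu2] with t h1 h2
    filter_upwards [h1, ae_restrict_of_ae_restrict_of_subset sdiff_subset h2,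
      ae_restrict_of_ae_restrict_of_subset sdiff_subset hs] with x h3 h4 h5
    rw [← h5, ← h3]
    exact h4.symm

theorem energy_congr {f F : Vec n → Vec N → Mat N n → ℝ≥0} [SFinite (volume.restrict Ω)] {τ : ℝ}
    (hτ : τ ≤ T) (hF : ∀ᵐ x ∂volume.restrict Ω, ∀ u ξ, F x u ξ = f x u ξ)
    (hu : u =ᵐ[volume.restrict (cylinder Ω T)] u')
    (hDu : Du =ᵐ[volume.restrict (cylinder Ω T)] Du') :
    energy Ω E f τ u Du = energy Ω E F τ u' Du' := by
  have hF' : ∀ᵐ z ∂volume.restrict (cylinder Ω T), ∀ u ξ, F z.1 u ξ = f z.1 u ξ := by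
    rw [volume_restrict_cylinder]
    exact Measure.quasiMeasurePreserving_fst.ae hF
  have hsub : E ∩ cylinder Ω τ ⊆ cylinder Ω T := fun z hz =>
    ⟨hz.2.1, hz.2.2.1, hz.2.2.2.trans_le hτ⟩
  refine lintegral_congr_ae (ae_restrict_of_ae_restrict_of_subset hsub ?_)
  filter_upwards [hF', hu, hDu] with z h1 h2 h3
  rw [h1, h2, h3]

end

end

end DoublyNonlinear

open DoublyNonlinear in
theorem proposition3p10 (n N : ℕ) (hn : 2 ≤ n) (hN : 1 ≤ N)
    (Ω : Set (DoublyNonlinear.Vec n)) (hΩ : IsOpen Ω) (hΩb : Bornology.IsBounded Ω)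
    (T : ℝ) (hT : 0 < T) (p q ν : ℝ) (hp : 1 < p) (hq : 0 < q) (hν : 0 < ν)
    (E : Set (DoublyNonlinear.Vec n × ℝ)) (hE : DoublyNonlinear.IsRelativelyOpen Ω T E)
    (hE0 : volume (frontier E) = 0) (hEmono : DoublyNonlinear.IsNondecreasing T E)
    (f : DoublyNonlinear.Vec n → DoublyNonlinear.Vec N → DoublyNonlinear.Mat N n → ℝ≥0)
    (hf : DoublyNonlinear.IsIntegrand Ω p ν f)
    (uo ustar : DoublyNonlinear.Vec n → DoublyNonlinear.Vec N)
    (Dustar : DoublyNonlinear.Vec n → DoublyNonlinear.Mat N n)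
    (hdata : DoublyNonlinear.AreData Ω p q f uo ustar Dustar)
    (u : DoublyNonlinear.Vec n × ℝ → DoublyNonlinear.Vec N)
    (hu : DoublyNonlinear.IsVariationalSolution Ω T E p q f uo ustar Dustar u) :
    ∃ w : DoublyNonlinear.Vec n × ℝ → DoublyNonlinear.Vec N,
      DoublyNonlinear.ContinuousInLp Ω (q + 1) (Icc 0 T) w ∧
      ∀ᵐ t ∂(volume.restrict (Ioo 0 T)),
        DoublyNonlinear.slice w t =ᵐ[volume.restrict Ω] DoublyNonlinear.slice u t := by
  have : IsFiniteMeasure (volume.restrict Ω) :=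
    isFiniteMeasure_restrict.2 hΩb.measure_lt_top.ne
  obtain ⟨⟨C, hC⟩, Du, hV, hVI⟩ := hu
  -- Replace the integrand and all functions by measurable representatives.
  obtain ⟨F, hF, hFf⟩ := hf.exists_isNormalIntegrand
  obtain ⟨u', hu'm, hu'⟩ := hV.memLp.1
  obtain ⟨Du', hDu'm, hDu'⟩ := hV.grad_memLp.1
  obtain ⟨us', hus'm, hus'⟩ := hdata.boundary_memW1p.memLp.1
  obtain ⟨Dus', hDus'm, hDus'⟩ := hdata.boundary_memW1p.grad_memLp.1
  have hV' := hV.congr hp.le hu' hDu' hus' hDus'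
  have huslice : ∀ᵐ t ∂(volume.restrict (Ioo 0 T)),
      slice u t =ᵐ[volume.restrict Ω] slice u' t := by
    rw [restrict_Ioo_eq_Ioc]
    refine ae_ae_slice (P := fun z => u z = u' z) ?_
    rw [← volume_restrict_cylinder]
    exact hu'
  suffices H : ∀ ε : ℝ, 0 < ε → ∃ v : Vec n × ℝ → Vec N, ContinuousInLp Ω (q + 1) (Icc 0 T) v ∧
      ∀ᵐ t ∂(volume.restrict (Ioo 0 T)), eLpNorm (slice v t - slice u' t)
        (ENNReal.ofReal (q + 1)) (volume.restrict Ω) ≤ ENNReal.ofReal ε by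
    obtain ⟨w, hw, hwu⟩ := exists_continuousInLp_of_approx hT (by linarith : (1 : ℝ) ≤ q + 1)
      hV'.memLq H
    refine ⟨w, hw, ?_⟩
    filter_upwards [hwu, huslice] with t h1 h2
    exact h1.trans h2.symm
  intro ε hε
  refine exists_continuousInLp_approx (uo := uo) hF hΩ hT hp.le hq hE hEmono hE0
    hV' hu'm hDu'm hus'm hDus'm (hdata.boundary_memW1p.memLp.ae_eq hus')
    (hdata.boundary_memW1p.grad_memLp.ae_eq hDus') (hdata.boundary_memLp.ae_eq hus')
    hdata.initial_memLp ?_ ?_ (C := C) ?_ hε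
  · intro φ hφ
    refine lt_of_eq_of_lt (lintegral_congr_ae ?_) (hdata.finite_energy φ hφ)
    filter_upwards [hFf, hus', hDus'] with x h1 h2 h3
    rw [h1, Pi.add_apply, Pi.add_apply, h2, h3]
  · intro v Dv dv hv
    have hv' : IsComparisonMap Ω T E p q ustar Dustar v Dv dv :=
      ⟨hv.memV.congr hp.le (ae_eq_refl _) (ae_eq_refl _) hus'.symm hDus'.symm, hv.time_deriv,
        hv.continuous⟩
    filter_upwards [hVI v Dv dv hv', huslice, ae_restrict_mem measurableSet_Ioo] with τ h1 h2 hτ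
    have hEΩ : timeSlice E τ ⊆ Ω := by
      obtain ⟨O, -, rfl⟩ := hE
      exact fun x hx => hx.2.1
    have hsub : E ∩ cylinder Ω τ ⊆ cylinder Ω T := fun z hz =>
      ⟨hz.2.1, hz.2.2.1, hz.2.2.2.trans hτ.2⟩
    rw [VariationalInequality, energy_congr hτ.2.le hFf hu' hDu',
      energy_congr hτ.2.le hFf (ae_eq_refl v) (ae_eq_refl Dv)] at h1
    have e1 : ∫ z in E ∩ cylinder Ω τ, inner ℝ (dv z) (spow q (v z) - spow q (u z)) =
        ∫ z in E ∩ cylinder Ω τ, inner ℝ (dv z) (spow q (v z) - spow q (u' z)) := by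
      refine integral_congr_ae (ae_restrict_of_ae_restrict_of_subset hsub ?_)
      filter_upwards [hu'] with z hz
      rw [hz]
    have e2 : ∫ x in timeSlice E τ, bTerm q (u (x, τ)) (v (x, τ)) =
        ∫ x in timeSlice E τ, bTerm q (u' (x, τ)) (v (x, τ)) := by
      refine integral_congr_ae (ae_restrict_of_ae_restrict_of_subset hEΩ ?_)
      filter_upwards [h2] with x hx
      simp only [slice] at hx
      rw [hx]
    rw [e1, e2] at h1
    exact h1
  · filter_upwards [hC, huslice] with t h1 h2
    rwa [← eLpNorm_congr_ae h2]
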